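/- Let $s\ge 1$ be an integer, $b\in[0,1]$, $\kappa\in\mathbb R$. Let $b_n\in\mathbb N$ be bandwidths with $b_n<n$, $b_n\to\infty$ and $b_n/n\to b$. Let $T_n=(\mathbf 1_{\{|i-j|\le b_n\}}\,a_{i-j})_{i,j=1}^n$, where the entries satisfy one of the following. - Real case: $(a_j)_{j\in\mathbb Z}$ are independent real random variables with $\mathbb E[a_j]=0$, $\mathbb E[|a_j|^2]=1$, $\mathbb E[|a_j|^4]=\kappa$ for all $j\in\mathbb Z$, and $\sup_{j\in\mathbb Z}\mathbb E[|a_j|^k]<\infty$ for every $k\in\mathbb N$. - Complex case: $(\mathrm{Re}\,a_j,\mathrm{Im}\,a_j)_{j\in\mathbb Z}$ is a family of independent real random variables with $\mathbb E[a_j]=0$, $\mathbb E[|a_j|^2]=1$, $\mathbb E[a_j^2]=0$, $\mathbb E[|a_j|^4]=\kappa$ for all $j\in\mathbb Z$, and $\sup_{j\in\mathbb Z}\mathbb E[|a_j|^k]<\infty$ for every $k\in\mathbb N$. Set $W_n^{(s)}=b_n^{-s}\,(T_n^*)^sT_n^s$. For every real polynomial $Q$ and every $n$ the random variable $\mathrm{tr}\,Q(W_n^{(s)})$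 is integrable. Moreover: **Fluctuations.** In each of the two cases, for every real polynomial $Q$ of degree at least $1$ there is $\hat\sigma_Q^2\ge 0$, depending only on the case (real or complex) and on $s,b,\kappa,Q$, such that $$\frac{\sqrt{b_n}}{n}\Bigl(\mathrm{tr}\,Q(W_n^{(s)})-\mathbb E\bigl[\mathrm{tr}\,Q(W_n^{(s)})\bigr]\Bigr)\longrightarrow N(0,\hat\sigma_Q^2)$$ in distribution as $n\to\infty$, and the variances of the left-hand side converge to $\hat\sigma_Q^2$ (where $N(0,0)$ is the point mass at $0$). **Moments.** In both cases, for every integer $p\ge 0$, $\mathbb E\bigl[\frac1n\mathrm{tr}\,(W_n^{(s)})^p\bigr]\to M_p^{(s)}(b)$ as $n\to\infty$, where $$M_p^{(s)}(b)=\sum_{\pi\in\mathcal P_2(2ps)}\int_{[0,1]\times[-1,1]^{ps}}\mathbf 1_{\left\{\sum_{l=1}^{2ps}(-1)^{\lfloor (l-1)/s\rfloor}y_l=0\right\}}\prod_{j=1}^{2ps}\mathbf 1_{[0,1]}\Bigl(x_0+b\sum_{l=1}^{j}(-1)^{\lfloor (l-1)/s\rfloor}y_l\Bigr)\,dx_0\,dx_1\cdots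 dx_{ps}.$$ Here $\mathcal P_2(2ps)$ is the set of partitions of $\{1,\dots,2ps\}$ into blocks of two elements; for given $\pi$, with blocks $V_1,\dots,V_{ps}$, one puts $y_l=x_k$ when $l\in V_k$. **The case $b=0$.** $M_p^{(s)}(0)=2^{ps}(ps)!$ for every integer $p\ge 0$. -/

import Mathlib

universe u

open MeasureTheory ProbabilityTheory Filter Topology
open scoped NNReal ENNReal Matrix Polynomial

namespace ToeplitzPowers

/-- Real entries: independent, centred, of variance one, with common fourth moment `κ` and
all absolute moments uniformly bounded. -/
structure IsRealEntries {Ω : Type*} [MeasurableSpace Ω] (μ : Measure Ω) (κ : ℝ)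
    (a : ℤ → Ω → ℝ) : Prop where
  measurable : ∀ j, Measurable (a j)
  indep : iIndepFun a μ
  mean : ∀ j, ∫ ω, a j ω ∂μ = 0
  variance : ∀ j, ∫ ω, |a j ω| ^ 2 ∂μ = 1
  fourth : ∀ j, ∫ ω, |a j ω| ^ 4 ∂μ = κ
  bounded : ∀ k : ℕ, ⨆ j, ∫⁻ ω, ‖a j ω‖ₑ ^ k ∂μ < ⊤

/-- Complex entries: all the real and imaginary parts together form one independent family
(the Boolean index `true` selects the real part, `false` the imaginary part), with the same
moment conditions and moreover `E[a_j ^ 2] = 0`. -/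
structure IsComplexEntries {Ω : Type*} [MeasurableSpace Ω] (μ : Measure Ω) (κ : ℝ)
    (a : ℤ → Ω → ℂ) : Prop where
  measurable : ∀ j, Measurable (a j)
  indep : iIndepFun
    (fun (i : ℤ × Bool) (ω : Ω) => if i.2 = true then (a i.1 ω).re else (a i.1 ω).im) μ
  mean : ∀ j, ∫ ω, a j ω ∂μ = 0
  variance : ∀ j, ∫ ω, ‖a j ω‖ ^ 2 ∂μ = 1
  square : ∀ j, ∫ ω, (a j ω) ^ 2 ∂μ = 0
  fourth : ∀ j, ∫ ω, ‖a j ω‖ ^ 4 ∂μ = κ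
  bounded : ∀ k : ℕ, ⨆ j, ∫⁻ ω, ‖a j ω‖ₑ ^ k ∂μ < ⊤

/-- Bandwidths `b_n < n` with `b_n → ∞` and `b_n / n → b`. -/
structure IsBandwidth (bw : ℕ → ℕ) (b : ℝ) : Prop where
  lt : ∀ n, 1 ≤ n → bw n < n
  tendsto_atTop : Tendsto bw atTop atTop
  ratio : Tendsto (fun n => (bw n : ℝ) / n) atTop (𝓝 b)

section Model

variable {𝕜 : Type*} [RCLike 𝕜]

/-- The `n × n` Toeplitz band matrix with bandwidth `m` and entries `a_{i-j}`. -/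
def toeplitzBand (n m : ℕ) (a : ℤ → 𝕜) : Matrix (Fin n) (Fin n) 𝕜 :=
  Matrix.of fun i j => if |(i : ℤ) - (j : ℤ)| ≤ (m : ℤ) then a ((i : ℤ) - (j : ℤ)) else 0

/-- `W = m^{-s} T^{*s} T^s` for the Toeplitz band matrix `T` with bandwidth `m`. -/
noncomputable def powerMatrix (s n m : ℕ) (a : ℤ → 𝕜) : Matrix (Fin n) (Fin n) 𝕜 :=
  ((m : 𝕜) ^ s)⁻¹ • ((toeplitzBand n m a)ᴴ ^ s * toeplitzBand n m a ^ s)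

/-- The trace of `Q(W)`, which is a real number (see `im_trace_aeval_powerMatrix`). -/
noncomputable def traceStat (s n m : ℕ) (a : ℤ → 𝕜) (Q : ℝ[X]) : ℝ :=
  RCLike.re (Polynomial.aeval (powerMatrix s n m a) Q).trace

theorem powerMatrix_isHermitian (s n m : ℕ) (a : ℤ → 𝕜) :
    (powerMatrix s n m a).IsHermitian := by
  unfold Matrix.IsHermitian powerMatrix
  simp [Matrix.conjTranspose_smul, Matrix.conjTranspose_mul, Matrix.conjTranspose_pow]

theorem im_trace_aeval_powerMatrix (s n m : ℕ) (a : ℤ → 𝕜) (Q : ℝ[X]) :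
    RCLike.im (Polynomial.aeval (powerMatrix s n m a) Q).trace = 0 := by
  have h : (Polynomial.aeval (powerMatrix s n m a) Q)ᴴ
      = Polynomial.aeval (powerMatrix s n m a) Q := by
    rw [Polynomial.aeval_eq_sum_range, Matrix.conjTranspose_sum]
    refine Finset.sum_congr rfl fun i _ => ?_
    rw [Matrix.conjTranspose_smul, Matrix.conjTranspose_pow,
      (powerMatrix_isHermitian s n m a).eq]
    simp
  rw [← RCLike.conj_eq_iff_im]
  have h2 := Matrix.trace_conjTranspose (Polynomial.aeval (powerMatrix s n m a) Q)
  rw [h] at h2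
  exact h2.symm

/-- The normalised fluctuation `(√b_n / n) (tr Q(W_n) - E tr Q(W_n))`. -/
noncomputable def fluctuation {Ω : Type*} [MeasurableSpace Ω] (μ : Measure Ω) (s : ℕ)
    (bw : ℕ → ℕ) (a : ℤ → Ω → 𝕜) (Q : ℝ[X]) (n : ℕ) (ω : Ω) : ℝ :=
  Real.sqrt (bw n) / n *
    (traceStat s n (bw n) (fun j => a j ω) Q -
      ∫ ω', traceStat s n (bw n) (fun j => a j ω') Q ∂μ)

end Model

section Moments

/-- The pair partitions of an `N`-element set. -/
def pairPartitions (N : ℕ) : Finset (Finpartition (Finset.univ : Finset (Fin N))) :=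
  Finset.univ.filter fun π => ∀ V ∈ π.parts, V.card = 2

/-- The unknown `y_i` is the unknown attached to the block that contains `i`. -/
def blockValue {N : ℕ} (π : Finpartition (Finset.univ : Finset (Fin N)))
    (x : {V // V ∈ π.parts} → ℝ) (i : Fin N) : ℝ :=
  x ⟨π.part i, π.part_mem.2 (Finset.mem_univ i)⟩

/-- The signed unknown `(-1)^{⌊(l-1)/s⌋} y_l`, where `l = i + 1`. -/
def signedValue (s : ℕ) {N : ℕ} (π : Finpartition (Finset.univ : Finset (Fin N)))
    (x : {V // V ∈ π.parts} → ℝ) (i : Fin N) : ℝ :=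
  (-1) ^ ((i : ℕ) / s) * blockValue π x i

/-- The points `(x_0, x)` of `[0,1] × [-1,1]^{blocks}` at which all the indicator functions in
the integrand equal one. -/
def momentRegion (s : ℕ) (b : ℝ) {N : ℕ} (π : Finpartition (Finset.univ : Finset (Fin N))) :
    Set (ℝ × ({V // V ∈ π.parts} → ℝ)) :=
  {z | ∑ i, signedValue s π z.2 i = 0 ∧
    ∀ j : Fin N, z.1 + b * ∑ i ∈ Finset.Iic j, signedValue s π z.2 i ∈ Set.Icc (0 : ℝ) 1}

/-- The sum, over the pair partitions of `{1, …, 2ps}`, of the integrals that give the limit of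
the `p`-th moment. -/
noncomputable def limitMoment (s : ℕ) (b : ℝ) (p : ℕ) : ℝ :=
  ∑ π ∈ pairPartitions (2 * p * s),
    ∫ z in Set.Icc (0 : ℝ) 1 ×ˢ Set.univ.pi fun _ : {V // V ∈ π.parts} => Set.Icc (-1 : ℝ) 1,
      (momentRegion s b π).indicator (fun _ => (1 : ℝ)) z

end Moments

end ToeplitzPowers

set_option linter.unusedSectionVars false

/-! Write m for the bandwidth. The trace of a p-th power of W is a sum over closed words of 2ps
integer labels in [-m, m], with signs prescribed by the positions. A word contributes the product of
the corresponding entries, times the number of starting points in {0, …, n-1} from which the lattice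
path with these signed steps stays inside (`trace_powerMatrix_pow`). Divided by n, this weight
converges to a continuous function of y/m and b (`tendsto_pathWeight`). What remains is to sort the
words by the pattern of coinciding labels and to count free parameters.

Moments. A label used only once kills the expectation, so at most ps labels are free, with equality
only for pair partitions. The closing equation costs one more parameter unless it holds identically,
that is, unless every pair joins a positive with a negative position. The surviving sums are Riemann
sums (`tendsto_riemann_sum`). For the other pair partitions the constraint in the limiting integral
confines it to a proper hyperplane, so both sides agree. For b = 0 the weight is one, and each of
the (ps)! matchings of positive with negative positions contributes 2^(ps).

Fluctuations. By the method of moments it suffices that the variances converge and that E X^(k+2) -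
(k+1) E X^2 E X^k tends to zero. A product of k+2 centred traces is a sum over labelings of k+2
circuits. By independence, the defect of this recursion vanishes unless every label is repeated,
every circuit shares a label with another one, and the cluster of the distinguished circuit has at
least three members (`isRepeating_of_wickDefect_ne_zero`). Such labelings are too few: each circuit
costs a factor √m, which the normalisation compensates, and the large cluster costs one more √m
(`exists_card_large_cluster_le`).

The count is linear algebra modulo two (`two_mul_finrank_solSpace_add_card_le`). All signs become
one there, and coordinates determining the solutions modulo two also determine the integer
solutions. Functions on the letters of the form v(block) + c(circuit), with v a solution, are
orthogonal to those of the same form whose v also vanishes on the blocks of odd size. This bounds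
the sum of two dimensions by the number of letters.

Variance. For two linked circuits with 2M letters the order is m^(M-1). It is reached by pair
partitions, where a linking pair is eliminated through a circuit equation, and by partitions into
M-1 blocks that are balanced on each circuit and hence have sizes two or four. Only the second mixed
moments and κ enter, so the limit is determined by the case and s, b, κ, Q. -/

namespace ToeplitzPowers

/-! ### Method of moments for Gaussian limits -/

section MethodOfMoments

/-- The moments of a centred Gaussian law of variance `v`. -/
noncomputable def gaussianMoment (v : ℝ) : ℕ → ℝ
  | 0 => 1
  | 1 => 0
  | k + 2 => (k + 1) * v * gaussianMoment v k

theorem gaussianMoment_odd (v : ℝ) (j : ℕ) : gaussianMoment v (2 * j + 1) = 0 := by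
  induction j with
  | zero => rfl
  | succ j ih =>
    rw [show 2 * (j + 1) + 1 = (2 * j + 1) + 2 by ring, gaussianMoment, ih, mul_zero]

/-- Normalised by the factorial so that the even Taylor terms of the characteristic function become
those of the exponential series. -/
theorem gaussianMoment_even (v : ℝ) (j : ℕ) :
    gaussianMoment v (2 * j) / (2 * j).factorial = (v / 2) ^ j / j.factorial := by
  induction j with
  | zero => simp [gaussianMoment]
  | succ j ih =>
    rw [show 2 * (j + 1) = (2 * j) + 2 by ring, gaussianMoment, Nat.factorial_succ,
      Nat.factorial_succ, Nat.factorial_succ, pow_succ]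
    have h1 : ((2 * j).factorial : ℝ) ≠ 0 := by positivity
    have h2 : (j.factorial : ℝ) ≠ 0 := by positivity
    have h3 : gaussianMoment v (2 * j) = (v / 2) ^ j / j.factorial * (2 * j).factorial := by
      rw [← ih]; field_simp
    rw [h3]
    push_cast
    field_simp
    ring

/-- Induction on K along the segment from 0 to x: the derivative in t of the remainder of order K +
1 is z times the remainder of order K, so the bound integrates. -/
theorem norm_exp_mul_I_sub_sum_le (x : ℝ) (K : ℕ) :
    ‖Complex.exp (x * Complex.I) - ∑ k ∈ Finset.range K, (x * Complex.I) ^ k / k.factorial‖ ≤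
      |x| ^ K / K.factorial := by
  set z : ℂ := x * Complex.I with hz
  have hzn : ‖z‖ = |x| := by simp [hz]
  suffices H : ∀ t ∈ Set.Icc (0 : ℝ) 1,
      ‖Complex.exp (t * z) - ∑ k ∈ Finset.range K, (t * z) ^ k / k.factorial‖ ≤
        |x| ^ K * t ^ K / K.factorial by
    simpa using H 1 (by simp)
  induction K with
  | zero =>
    intro t _
    have : (t : ℂ) * z = (t * x : ℝ) * Complex.I := by rw [hz]; push_cast; ring
    rw [this]
    simp [-Complex.ofReal_mul, Complex.norm_exp_ofReal_mul_I]
  | succ K ih =>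
    have hder : ∀ t : ℝ, HasDerivAt (fun t : ℝ => Complex.exp (t * z) -
        ∑ k ∈ Finset.range (K + 1), (t * z) ^ k / k.factorial)
        (z * (Complex.exp (t * z) - ∑ k ∈ Finset.range K, (t * z) ^ k / k.factorial)) t := by
      intro t
      have h0 : HasDerivAt (fun t : ℝ => (t : ℂ) * z) z t := by
        simpa using (Complex.ofRealCLM.hasDerivAt (x := t)).mul_const z
      have h1 : HasDerivAt (fun t : ℝ => Complex.exp (t * z)) (Complex.exp (t * z) * z) t :=
        h0.cexp
      have h2 : HasDerivAt (fun t : ℝ => ∑ k ∈ Finset.range (K + 1), (t * z) ^ k / k.factorial)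
          (∑ k ∈ Finset.range (K + 1), (k * (t * z) ^ (k - 1) * z) / (k.factorial : ℂ)) t := by
        refine HasDerivAt.fun_sum fun k _ => ?_
        exact (h0.pow k).div_const _
      refine (h1.sub h2).congr_deriv ?_
      rw [Finset.sum_range_succ', mul_sub, Finset.mul_sum]
      simp only [Nat.cast_zero, zero_mul, zero_div, add_zero]
      congr 1
      · ring
      · refine Finset.sum_congr rfl fun k _ => ?_
        rw [Nat.factorial_succ]
        have : (k.factorial : ℂ) ≠ 0 := by exact_mod_cast k.factorial_ne_zero
        have h' : ((k : ℂ) + 1) ≠ 0 := by exact_mod_cast k.succ_ne_zero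
        push_cast
        field_simp
    refine image_norm_le_of_norm_deriv_right_le_deriv_boundary
      (f' := fun t : ℝ => z * (Complex.exp (t * z) -
        ∑ k ∈ Finset.range K, (t * z) ^ k / k.factorial))
      (B' := fun t => |x| * (|x| ^ K * t ^ K / K.factorial))
      (fun t _ => (hder t).continuousAt.continuousWithinAt)
      (fun t _ => (hder t).hasDerivWithinAt) ?_ ?_ ?_
    · simp [Finset.sum_range_succ']
    · intro t
      have := ((hasDerivAt_pow (K + 1) t).const_mul (|x| ^ (K + 1))).div_const
        ((K + 1).factorial : ℝ)
      refine this.congr_deriv ?_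
      rw [Nat.factorial_succ]
      have : (K.factorial : ℝ) ≠ 0 := by positivity
      push_cast
      field_simp
      ring
    · intro t ht
      rw [norm_mul, hzn]
      exact mul_le_mul_of_nonneg_left (ih t ⟨ht.1, ht.2.le⟩) (abs_nonneg _)

variable {Ω : Type*} [MeasurableSpace Ω] {μ : Measure Ω} [IsProbabilityMeasure μ]

/-- The truncation order is even so that the Taylor remainder is itself a moment, without absolute
values. -/
theorem norm_charFun_sub_sum_moments_le {X : Ω → ℝ} (hm : Measurable X)
    (hX : ∀ k : ℕ, Integrable (fun ω => X ω ^ k) μ) (t : ℝ) (J : ℕ) :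
    ‖charFun (μ.map X) t - ∑ k ∈ Finset.range (2 * J),
        (t * Complex.I) ^ k / k.factorial * ((∫ ω, X ω ^ k ∂μ : ℝ) : ℂ)‖ ≤
      t ^ (2 * J) / (2 * J).factorial * ∫ ω, X ω ^ (2 * J) ∂μ := by
  have hXc : ∀ k : ℕ, Integrable (fun ω => ((X ω ^ k : ℝ) : ℂ)) μ := fun k => (hX k).ofReal
  have e1 : charFun (μ.map X) t = ∫ ω, Complex.exp ((t * X ω : ℝ) * Complex.I) ∂μ := by
    rw [charFun_apply_real, integral_map hm.aemeasurable]
    · simp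
    · exact (by fun_prop : Continuous fun x : ℝ =>
        Complex.exp (t * x * Complex.I)).aestronglyMeasurable
  have e2 : ∑ k ∈ Finset.range (2 * J),
        (t * Complex.I) ^ k / k.factorial * ((∫ ω, X ω ^ k ∂μ : ℝ) : ℂ) =
      ∫ ω, ∑ k ∈ Finset.range (2 * J), ((t * X ω : ℝ) * Complex.I) ^ k / k.factorial ∂μ := by
    rw [integral_finsetSum]
    · refine Finset.sum_congr rfl fun k _ => ?_
      rw [← integral_complex_ofReal, ← integral_const_mul]
      refine integral_congr_ae (Eventually.of_forall fun ω => ?_)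
      push_cast
      simp only [mul_pow]
      ring
    · intro k _
      refine ((hXc k).const_mul ((t * Complex.I) ^ k / k.factorial)).congr
        (Eventually.of_forall fun ω => ?_)
      push_cast
      simp only [mul_pow]
      ring
  have i1 : Integrable (fun ω => Complex.exp ((t * X ω : ℝ) * Complex.I)) μ := by
    refine Integrable.of_bound (C := 1) ?_ (Eventually.of_forall fun ω => ?_)
    · exact (by fun_prop : Measurable fun ω =>
        Complex.exp ((t * X ω : ℝ) * Complex.I)).aestronglyMeasurable
    · rw [Complex.norm_exp_ofReal_mul_I]
  have i2 : Integrable (fun ω => ∑ k ∈ Finset.range (2 * J),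
      ((t * X ω : ℝ) * Complex.I) ^ k / k.factorial) μ := by
    refine integrable_finsetSum _ fun k _ => ?_
    refine ((hXc k).const_mul ((t * Complex.I) ^ k / k.factorial)).congr
        (Eventually.of_forall fun ω => ?_)
    push_cast
    simp only [mul_pow]
    ring
  rw [e1, e2, ← integral_sub i1 i2, ← integral_const_mul]
  refine norm_integral_le_of_norm_le ((hX (2 * J)).const_mul _)
    (Eventually.of_forall fun ω => ?_)
  refine (norm_exp_mul_I_sub_sum_le (t * X ω) (2 * J)).trans (le_of_eq ?_)
  rw [(even_two_mul J).pow_abs, mul_pow]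
  ring

/-- The method of moments for a Gaussian limit, with the moment hypothesis in the form of the
Gaussian integration by parts recursion. -/
theorem tendstoInDistribution_gaussian_of_moments {X : ℕ → Ω → ℝ} (hm : ∀ n, Measurable (X n))
    (hX : ∀ n (k : ℕ), Integrable (fun ω => X n ω ^ k) μ) (v : ℝ≥0)
    (h1 : ∀ n, ∫ ω, X n ω ∂μ = 0)
    (h2 : Tendsto (fun n => ∫ ω, X n ω ^ 2 ∂μ) atTop (𝓝 (v : ℝ)))
    (hrec : ∀ k : ℕ, Tendsto (fun n => ∫ ω, X n ω ^ (k + 2) ∂μ -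
      (k + 1) * (∫ ω, X n ω ^ 2 ∂μ) * ∫ ω, X n ω ^ k ∂μ) atTop (𝓝 0)) :
    TendstoInDistribution X atTop (id : ℝ → ℝ) (fun _ => μ) (gaussianReal 0 v) := by
  -- In the limit, the recursion `hrec` is the one that defines `gaussianMoment`.
  have hmom : ∀ k : ℕ, Tendsto (fun n => ∫ ω, X n ω ^ k ∂μ) atTop (𝓝 (gaussianMoment v k)) := by
    intro k
    induction k using Nat.twoStepInduction with
    | zero => simp [gaussianMoment]
    | one => simp [gaussianMoment, h1]
    | more k ih _ =>
      have := (hrec k).add ((h2.const_mul ((k : ℝ) + 1)).mul ih)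
      simp only [sub_add_cancel, zero_add] at this
      exact this
  refine ⟨fun n => (hm n).aemeasurable, aemeasurable_id, ?_⟩
  refine ProbabilityMeasure.tendsto_iff_tendsto_charFun.2 fun t => ?_
  simp only [ProbabilityMeasure.coe_mk, Measure.map_id, charFun_gaussianReal]
  have hgs : ∀ J : ℕ, ∑ k ∈ Finset.range (2 * J), (t * Complex.I) ^ k / k.factorial *
      ((gaussianMoment v k : ℝ) : ℂ) =
      ∑ j ∈ Finset.range J, (-(v * t ^ 2 / 2 : ℂ)) ^ j / j.factorial := by
    intro J
    induction J with
    | zero => simp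
    | succ J ih =>
      rw [show 2 * (J + 1) = 2 * J + 1 + 1 by ring, Finset.sum_range_succ, Finset.sum_range_succ,
        ih, Finset.sum_range_succ, gaussianMoment_odd]
      have h := congrArg (fun x : ℝ => (x : ℂ)) (gaussianMoment_even v J)
      push_cast at h
      have h' : (t * Complex.I) ^ (2 * J) / (2 * J).factorial * (gaussianMoment v (2 * J) : ℂ) =
          (t * Complex.I) ^ (2 * J) * ((gaussianMoment v (2 * J) : ℂ) / (2 * J).factorial) := by
        ring
      rw [h', h, pow_mul, mul_pow, Complex.I_sq]
      simp only [Complex.ofReal_zero, mul_zero, add_zero]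
      congr 1
      rw [← mul_div_assoc, ← mul_pow]
      congr 2
      ring
  rw [Metric.tendsto_atTop']
  intro ε hε
  have hs1 : Tendsto (fun J : ℕ => ∑ j ∈ Finset.range J, (-(v * t ^ 2 / 2 : ℂ)) ^ j / j.factorial)
      atTop (𝓝 (Complex.exp (-(v * t ^ 2 / 2 : ℂ)))) := by
    have := (NormedSpace.expSeries_div_hasSum_exp (-(v * t ^ 2 / 2 : ℂ))).tendsto_sum_nat
    rwa [← Complex.exp_eq_exp_ℂ] at this
  have hs2 : Tendsto (fun J : ℕ => (v * t ^ 2 / 2 : ℝ) ^ J / J.factorial) atTop (𝓝 0) :=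
    FloorSemiring.tendsto_pow_div_factorial_atTop _
  -- The truncation J is fixed before n: it controls both the tail of the exponential series and the
  -- limit, as n grows, of the remainder bound.
  obtain ⟨J, hJ1, hJ2⟩ := ((Metric.tendsto_nhds.1 hs1 (ε / 3) (by positivity)).and
    (Metric.tendsto_nhds.1 hs2 (ε / 3) (by positivity))).exists
  have hl1 : Tendsto (fun n => ∑ k ∈ Finset.range (2 * J), (t * Complex.I) ^ k / k.factorial *
      ((∫ ω, X n ω ^ k ∂μ : ℝ) : ℂ)) atTop
      (𝓝 (∑ j ∈ Finset.range J, (-(v * t ^ 2 / 2 : ℂ)) ^ j / j.factorial)) := by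
    rw [← hgs]
    exact tendsto_finsetSum _ fun k _ =>
      ((Complex.continuous_ofReal.tendsto _).comp (hmom k)).const_mul _
  have hl2 : Tendsto (fun n => t ^ (2 * J) / (2 * J).factorial * ∫ ω, X n ω ^ (2 * J) ∂μ) atTop
      (𝓝 ((v * t ^ 2 / 2 : ℝ) ^ J / J.factorial)) := by
    have := (hmom (2 * J)).const_mul (t ^ (2 * J) / (2 * J).factorial)
    have e : t ^ (2 * J) / (2 * J).factorial * gaussianMoment v (2 * J) =
        (v * t ^ 2 / 2 : ℝ) ^ J / J.factorial := by
      rw [div_mul_eq_mul_div, mul_div_assoc, gaussianMoment_even, pow_mul, ← mul_div_assoc,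
        ← mul_pow]
      congr 2
      ring
    rwa [e] at this
  have hl1' := Metric.tendsto_nhds.1 hl1 (ε / 3) (by positivity)
  have hl2' : ∀ᶠ n in atTop, t ^ (2 * J) / (2 * J).factorial * ∫ ω, X n ω ^ (2 * J) ∂μ < ε / 3 := by
    refine hl2.eventually (gt_mem_nhds ?_)
    rw [Real.dist_eq, sub_zero] at hJ2
    exact lt_of_abs_lt hJ2
  obtain ⟨N, hN⟩ := eventually_atTop.1 (hl1'.and hl2')
  refine ⟨N, fun n hn => ?_⟩
  obtain ⟨ha, hb⟩ := hN n hn.le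
  have hc := norm_charFun_sub_sum_moments_le (μ := μ) (hm n) (hX n) t J
  rw [← dist_eq_norm] at hc
  have he : Complex.exp (t * (0 : ℝ) * Complex.I - v * t ^ 2 / 2) =
      Complex.exp (-(v * t ^ 2 / 2 : ℂ)) := by
    congr 1; simp
  rw [he]
  calc _ ≤ _ := dist_triangle4 _ _ _ _
    _ < ε / 3 + ε / 3 + ε / 3 := add_lt_add (add_lt_add (hc.trans_lt hb) ha) hJ1
    _ = ε := by ring

end MethodOfMoments

/-! ### Dimension of the circuit equations modulo two -/

section BlockCounting

variable {L ι P : Type*} [Fintype L] [Fintype ι] [Fintype P]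
  [DecidableEq L] [DecidableEq ι] [DecidableEq P]

theorem sum_comp_eq_sum_card_mul {R : Type*} [CommSemiring R] (f : L → P) (g : P → R) :
    ∑ l, g (f l) = ∑ B, ((Finset.univ.filter fun l => f l = B).card : R) * g B := by
  rw [← Finset.sum_fiberwise (s := Finset.univ) (g := f)]
  refine Finset.sum_congr rfl fun B _ => ?_
  rw [Finset.sum_congr rfl (g := fun _ => g B) fun l hl => by rw [(Finset.mem_filter.1 hl).2]]
  simp

/-- The solutions modulo two of the circuit equations on the blocks. -/
def solSpace (circ : L → ι) (blk : L → P) : Submodule (ZMod 2) (P → ZMod 2) where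
  carrier := {y | ∀ i, ∑ l ∈ Finset.univ.filter (fun l => circ l = i), y (blk l) = 0}
  add_mem' := by
    intro x y hx hy i
    simp only [Pi.add_apply, Finset.sum_add_distrib, hx i, hy i, add_zero]
  zero_mem' := by intro i; simp
  smul_mem' := by
    intro c x hx i
    simp only [Pi.smul_apply, smul_eq_mul, ← Finset.mul_sum, hx i, mul_zero]

variable {circ : L → ι} {blk : L → P}

theorem sum_blk_mul_circ_eq_zero {y : P → ZMod 2} (hy : y ∈ solSpace circ blk) (c : ι → ZMod 2) :
    ∑ l, y (blk l) * c (circ l) = 0 := by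
  rw [← Finset.sum_fiberwise (s := Finset.univ) (g := circ)]
  refine Finset.sum_eq_zero fun i _ => ?_
  rw [Finset.sum_congr rfl (g := fun l => y (blk l) * c i) fun l hl => by
    rw [(Finset.mem_filter.1 hl).2], ← Finset.sum_mul, hy i, zero_mul]

/-- The map from pairs of a block function and a circuit function to letter functions. -/
def letterMap (circ : L → ι) (blk : L → P) :
    ((P → ZMod 2) × (ι → ZMod 2)) →ₗ[ZMod 2] (L → ZMod 2) :=
  (LinearMap.funLeft (ZMod 2) (ZMod 2) blk).coprod (LinearMap.funLeft (ZMod 2) (ZMod 2) circ)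

theorem letterMap_apply (v : P → ZMod 2) (c : ι → ZMod 2) (l : L) :
    letterMap circ blk (v, c) l = v (blk l) + c (circ l) := rfl

/-- The dot product embeds U into the annihilator of W, whose dimension is complementary to that of
W. -/
theorem finrank_add_finrank_le_of_dotProduct_eq_zero {K : Type*} [Field K]
    (U W : Submodule K (L → K))
    (h : ∀ u ∈ U, ∀ w ∈ W, u ⬝ᵥ w = 0) :
    Module.finrank K U + Module.finrank K W ≤ Fintype.card L := by
  have h1 : U.map (dotProductEquiv K L).toLinearMap ≤ W.dualAnnihilator := by
    rintro _ ⟨u, hu, rfl⟩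
    rw [Submodule.mem_dualAnnihilator]
    intro w hw
    exact h u hu w hw
  have h2 := Submodule.finrank_mono h1
  rw [LinearEquiv.finrank_map_eq] at h2
  have h3 := Subspace.finrank_add_finrank_dualAnnihilator_eq W
  rw [Module.finrank_pi] at h3
  omega

/-- The set of odd blocks. -/
def oddBlocks (blk : L → P) : Finset P :=
  Finset.univ.filter fun B => Odd (Finset.univ.filter fun l => blk l = B).card

theorem sum_oddBlocks_eq (y : P → ZMod 2) :
    ∑ B ∈ oddBlocks blk, y B = ∑ l, y (blk l) := by
  rw [sum_comp_eq_sum_card_mul blk y, oddBlocks, Finset.sum_filter]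
  refine Finset.sum_congr rfl fun B _ => ?_
  split_ifs with h
  · rw [(ZMod.natCast_eq_one_iff_odd).2 h, one_mul]
  · rw [(ZMod.natCast_eq_zero_iff_even).2 (Nat.not_odd_iff_even.1 h), zero_mul]

/-- In the sum of all circuit equations every block appears with its cardinality, so modulo two only
the odd blocks remain. -/
theorem sum_oddBlocks_eq_zero {y : P → ZMod 2} (hy : y ∈ solSpace circ blk) :
    ∑ B ∈ oddBlocks blk, y B = 0 := by
  rw [sum_oddBlocks_eq]
  simpa using sum_blk_mul_circ_eq_zero hy 1

/-- Of the four terms of the expanded product, the two mixed ones vanish by the circuit equations,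
and the one in c and d because circuits have even length. In the one in v and u, even blocks cancel
modulo two and u vanishes on the odd ones. -/
theorem letterMap_dotProduct_eq_zero (hc : ∀ i, Even (Finset.univ.filter fun l => circ l = i).card)
    {v u : P → ZMod 2} (hv : v ∈ solSpace circ blk) (hu : u ∈ solSpace circ blk)
    (hu' : ∀ B ∈ oddBlocks blk, u B = 0) (c d : ι → ZMod 2) :
    letterMap circ blk (v, c) ⬝ᵥ letterMap circ blk (u, d) = 0 := by
  simp only [dotProduct, letterMap_apply, add_mul, mul_add, Finset.sum_add_distrib]
  have h1 : ∑ l, v (blk l) * u (blk l) = 0 := by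
    rw [← sum_oddBlocks_eq (fun B => v B * u B)]
    exact Finset.sum_eq_zero fun B hB => by rw [hu' B hB, mul_zero]
  have h2 : ∑ l, c (circ l) * d (circ l) = 0 := by
    rw [sum_comp_eq_sum_card_mul circ (fun i => c i * d i)]
    exact Finset.sum_eq_zero fun i _ => by rw [(ZMod.natCast_eq_zero_iff_even).2 (hc i), zero_mul]
  have h3 : ∑ l, c (circ l) * u (blk l) = 0 := by
    simpa only [mul_comm] using sum_blk_mul_circ_eq_zero hu c
  rw [h1, h2, h3, sum_blk_mul_circ_eq_zero hv d]
  simp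

theorem blk_surjective (hb : ∀ B, 2 ≤ (Finset.univ.filter fun l => blk l = B).card) :
    Function.Surjective blk := by
  intro B
  obtain ⟨l, hl⟩ := Finset.card_pos.1 (lt_of_lt_of_le two_pos (hb B))
  exact ⟨l, (Finset.mem_filter.1 hl).2⟩

/-- On a kernel element c(circ l) is determined by the block of l, which is exactly the situation in
which connectivity forces c to be constant. -/
theorem circ_const_of_letterMap_eq_zero
    (hconn : ∀ c : ι → ZMod 2, (∀ l l', blk l = blk l' → c (circ l) = c (circ l')) →
      ∀ i i', c i = c i') {v : P → ZMod 2} {c : ι → ZMod 2}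
    (h : letterMap circ blk (v, c) = 0) (i i' : ι) : c i = c i' := by
  refine hconn c (fun l l' hl => ?_) i i'
  have h1 := congrFun h l
  have h2 := congrFun h l'
  rw [letterMap_apply, Pi.zero_apply] at h1 h2
  rw [hl] at h1
  exact add_left_cancel (h1.trans h2.symm)

theorem eq_zero_of_letterMap_eq_zero (hb : ∀ B, 2 ≤ (Finset.univ.filter fun l => blk l = B).card)
    {v : P → ZMod 2} (h : letterMap circ blk (v, 0) = 0) : v = 0 := by
  funext B
  obtain ⟨l, rfl⟩ := blk_surjective hb B
  simpa [letterMap_apply] using congrFun h l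

/-- The restriction of `letterMap` to the block functions in a subspace. -/
def letterMapOn (circ : L → ι) (blk : L → P) (V : Submodule (ZMod 2) (P → ZMod 2)) :
    (V × (ι → ZMod 2)) →ₗ[ZMod 2] (L → ZMod 2) :=
  letterMap circ blk ∘ₗ V.subtype.prodMap LinearMap.id

theorem finrank_range_letterMapOn_add (V : Submodule (ZMod 2) (P → ZMod 2)) :
    Module.finrank (ZMod 2) (LinearMap.range (letterMapOn circ blk V)) +
      Module.finrank (ZMod 2) (LinearMap.ker (letterMapOn circ blk V)) =
      Module.finrank (ZMod 2) V + Fintype.card ι := by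
  rw [LinearMap.finrank_range_add_finrank_ker, Module.finrank_prod, Module.finrank_pi]

/-- A kernel element is determined by the constant value of its circuit part, since every block is
nonempty. -/
theorem finrank_ker_letterMapOn_le [Nonempty ι]
    (hb : ∀ B, 2 ≤ (Finset.univ.filter fun l => blk l = B).card)
    (hconn : ∀ c : ι → ZMod 2, (∀ l l', blk l = blk l' → c (circ l) = c (circ l')) →
      ∀ i i', c i = c i') (V : Submodule (ZMod 2) (P → ZMod 2)) :
    Module.finrank (ZMod 2) (LinearMap.ker (letterMapOn circ blk V)) ≤ 1 := by
  obtain ⟨i0⟩ := ‹Nonempty ι›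
  set g : LinearMap.ker (letterMapOn circ blk V) →ₗ[ZMod 2] ZMod 2 :=
    LinearMap.proj i0 ∘ₗ LinearMap.snd _ _ _ ∘ₗ (LinearMap.ker (letterMapOn circ blk V)).subtype
  have hg : Function.Injective g := by
    rw [← LinearMap.ker_eq_bot, LinearMap.ker_eq_bot']
    rintro ⟨⟨v, c⟩, hz⟩ hm
    change letterMap circ blk (v.1, c) = 0 at hz
    have hc0 : c = 0 := by
      funext i
      rw [circ_const_of_letterMap_eq_zero hconn hz i i0]
      exact hm
    subst hc0
    have := eq_zero_of_letterMap_eq_zero hb hz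
    ext1
    exact Prod.ext (Subtype.ext this) rfl
  have := LinearMap.finrank_le_finrank_of_injective hg
  rwa [Module.finrank_self] at this

/-- A block on which all of V vanishes forces the constant value of the circuit part to be zero, so
the one-dimensional kernel disappears. -/
theorem ker_letterMapOn_eq_bot
    (hb : ∀ B, 2 ≤ (Finset.univ.filter fun l => blk l = B).card)
    (hconn : ∀ c : ι → ZMod 2, (∀ l l', blk l = blk l' → c (circ l) = c (circ l')) →
      ∀ i i', c i = c i') (V : Submodule (ZMod 2) (P → ZMod 2)) {B : P}
    (hV : ∀ v ∈ V, v B = 0) :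
    LinearMap.ker (letterMapOn circ blk V) = ⊥ := by
  rw [LinearMap.ker_eq_bot']
  rintro ⟨⟨v, hv⟩, c⟩ hz
  change letterMap circ blk (v, c) = 0 at hz
  obtain ⟨l, rfl⟩ := blk_surjective hb B
  have hc0 : c = 0 := by
    funext i
    rw [circ_const_of_letterMap_eq_zero hconn hz i (circ l)]
    have := congrFun hz l
    rw [letterMap_apply] at this
    simpa [hV v hv] using this
  subst hc0
  exact Prod.ext (Subtype.ext (eq_zero_of_letterMap_eq_zero hb hz)) rfl

/-- The solutions modulo two that vanish on the odd blocks. -/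
def evenSolSpace (circ : L → ι) (blk : L → P) : Submodule (ZMod 2) (P → ZMod 2) where
  carrier := {y | y ∈ solSpace circ blk ∧ ∀ B ∈ oddBlocks blk, y B = 0}
  add_mem' := by
    intro x y hx hy
    exact ⟨add_mem hx.1 hy.1, fun B hB => by simp [hx.2 B hB, hy.2 B hB]⟩
  zero_mem' := ⟨zero_mem _, fun B _ => rfl⟩
  smul_mem' := by
    intro c x hx
    exact ⟨Submodule.smul_mem _ _ hx.1, fun B hB => by simp [hx.2 B hB]⟩

theorem finrank_range_add_finrank_range_le
    (hc : ∀ i, Even (Finset.univ.filter fun l => circ l = i).card) :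
    Module.finrank (ZMod 2) (LinearMap.range (letterMapOn circ blk (solSpace circ blk))) +
    Module.finrank (ZMod 2) (LinearMap.range (letterMapOn circ blk (evenSolSpace circ blk))) ≤
      Fintype.card L := by
  refine finrank_add_finrank_le_of_dotProduct_eq_zero _ _ ?_
  rintro _ ⟨⟨⟨v, hv⟩, c⟩, rfl⟩ _ ⟨⟨⟨u, hu⟩, d⟩, rfl⟩
  exact letterMap_dotProduct_eq_zero hc hv hu.1 hu.2 c d

/-- Without odd blocks the image of the solution space is orthogonal to itself, hence has at most
half the dimension of the ambient space. -/
theorem two_mul_finrank_solSpace_of_oddBlocks_eq_empty [Nonempty ι]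
    (hc : ∀ i, Even (Finset.univ.filter fun l => circ l = i).card)
    (hb : ∀ B, 2 ≤ (Finset.univ.filter fun l => blk l = B).card)
    (hconn : ∀ c : ι → ZMod 2, (∀ l l', blk l = blk l' → c (circ l) = c (circ l')) →
      ∀ i i', c i = c i') (h : oddBlocks blk = ∅) :
    2 * Module.finrank (ZMod 2) (solSpace circ blk) + 2 * Fintype.card ι ≤
      Fintype.card L + 2 := by
  have e : evenSolSpace circ blk = solSpace circ blk := by
    ext y
    simp [evenSolSpace, h]
  have h1 := finrank_range_add_finrank_range_le (blk := blk) hc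
  rw [e] at h1
  have h2 := finrank_range_letterMapOn_add (circ := circ) (blk := blk) (solSpace circ blk)
  have h3 := finrank_ker_letterMapOn_le hb hconn (solSpace circ blk)
  omega

/-- Restricting solutions to the odd blocks has the even solutions as kernel, and is not surjective,
because the restricted values sum to zero. -/
theorem exists_solSpace_finrank_evenSolSpace (h : (oddBlocks blk).Nonempty) :
    Module.finrank (ZMod 2) (solSpace circ blk) + 1 ≤
      Module.finrank (ZMod 2) (evenSolSpace circ blk) + (oddBlocks blk).card := by
  set ρ : solSpace circ blk →ₗ[ZMod 2] (oddBlocks blk → ZMod 2) :=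
    LinearMap.funLeft (ZMod 2) (ZMod 2) (Subtype.val : oddBlocks blk → P) ∘ₗ
      (solSpace circ blk).subtype with hρ
  have h1 := LinearMap.finrank_range_add_finrank_ker ρ
  have h2 : (LinearMap.ker ρ).map (solSpace circ blk).subtype = evenSolSpace circ blk := by
    ext y
    simp only [Submodule.mem_map, LinearMap.mem_ker, Submodule.subtype_apply, Subtype.exists,
      exists_and_right, exists_eq_right]
    constructor
    · rintro ⟨hy, h0⟩
      exact ⟨hy, fun B hB => congrFun h0 ⟨B, hB⟩⟩
    · rintro ⟨hy, h0⟩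
      exact ⟨hy, funext fun B => h0 B.1 B.2⟩
  have h3 : Module.finrank (ZMod 2) (LinearMap.ker ρ) =
      Module.finrank (ZMod 2) (evenSolSpace circ blk) := by
    rw [← h2]
    exact (LinearEquiv.finrank_eq (Submodule.equivMapOfInjective _
      (solSpace circ blk).injective_subtype _))
  have h4 : LinearMap.range ρ < ⊤ := by
    rw [lt_top_iff_ne_top]
    intro htop
    obtain ⟨B0, hB0⟩ := h
    have : (Pi.single ⟨B0, hB0⟩ 1 : oddBlocks blk → ZMod 2) ∈ LinearMap.range ρ := by
      rw [htop]; trivial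
    obtain ⟨⟨y, hy⟩, hy2⟩ := this
    have h5 := sum_oddBlocks_eq_zero hy
    rw [← Finset.sum_coe_sort] at h5
    have h6 : ∑ B : oddBlocks blk, y B = ∑ B, (Pi.single ⟨B0, hB0⟩ 1 : oddBlocks blk → ZMod 2) B :=
      Finset.sum_congr rfl fun B _ => congrFun hy2 B
    rw [h6, Finset.sum_pi_single'] at h5
    simp at h5
  have h5 := Submodule.finrank_lt h4.ne
  rw [Module.finrank_pi, Fintype.card_coe] at h5
  omega

theorem finrank_solSpace_add_one_le (h : (oddBlocks blk).Nonempty) :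
    Module.finrank (ZMod 2) (solSpace circ blk) + 1 ≤ Fintype.card P := by
  have h4 : solSpace circ blk < ⊤ := by
    rw [lt_top_iff_ne_top]
    intro htop
    obtain ⟨B0, hB0⟩ := h
    have : (Pi.single B0 1 : P → ZMod 2) ∈ solSpace circ blk := by
      rw [htop]; trivial
    have h5 := sum_oddBlocks_eq_zero this
    rw [Finset.sum_pi_single', if_pos hB0] at h5
    exact one_ne_zero h5
  have h5 := Submodule.finrank_lt h4.ne
  rw [Module.finrank_pi] at h5
  omega

/-- An odd block with at least two letters has at least three. -/
theorem two_mul_card_add_card_oddBlocks_le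
    (hb : ∀ B, 2 ≤ (Finset.univ.filter fun l => blk l = B).card) :
    2 * Fintype.card P + (oddBlocks blk).card ≤ Fintype.card L := by
  have h1 : Fintype.card L = ∑ B, (Finset.univ.filter fun l => blk l = B).card :=
    Finset.card_eq_sum_card_fiberwise fun _ _ => Finset.mem_coe.2 (Finset.mem_univ _)
  have h2 : 2 * Fintype.card P + (oddBlocks blk).card =
      ∑ B : P, (2 + if B ∈ oddBlocks blk then 1 else 0) := by
    rw [Finset.sum_add_distrib]
    simp [mul_comm]
  rw [h1, h2]
  refine Finset.sum_le_sum fun B _ => ?_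
  have := hb B
  split_ifs with h
  · have h3 : Odd _ := (Finset.mem_filter.1 h).2
    rcases this.lt_or_eq with h4 | h4
    · omega
    · rw [← h4] at h3
      exact absurd h3 (by decide)
  · omega

/-- The dimension bound for the solution space of a connected configuration. -/
theorem two_mul_finrank_solSpace_add_card_le [Nonempty ι]
    (hc : ∀ i, Even (Finset.univ.filter fun l => circ l = i).card)
    (hb : ∀ B, 2 ≤ (Finset.univ.filter fun l => blk l = B).card)
    (hconn : ∀ c : ι → ZMod 2, (∀ l l', blk l = blk l' → c (circ l) = c (circ l')) →
      ∀ i i', c i = c i') (e : ℕ) (he : e ≤ 1) (h2 : 2 + e ≤ Fintype.card ι) :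
    2 * Module.finrank (ZMod 2) (solSpace circ blk) + (Fintype.card ι + e) ≤
      Fintype.card L := by
  rcases (oddBlocks blk).eq_empty_or_nonempty with h | h
  · have := two_mul_finrank_solSpace_of_oddBlocks_eq_empty hc hb hconn h
    omega
  -- Let d be the dimension, r the number of circuits and o the number of odd blocks. `h1` to `h6`
  -- give 2d + 2r ≤ |L| + o, while `h7` and `h8` give 2d + 2 + o ≤ |L|. The average of the two is 2d
  -- + r + 1 ≤ |L|.
  · have h1 := finrank_range_add_finrank_range_le (blk := blk) hc
    have h2 := finrank_range_letterMapOn_add (circ := circ) (blk := blk) (solSpace circ blk)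
    have h3 := finrank_ker_letterMapOn_le hb hconn (solSpace circ blk)
    have h4 := finrank_range_letterMapOn_add (circ := circ) (blk := blk) (evenSolSpace circ blk)
    have h5 : Module.finrank (ZMod 2)
        (LinearMap.ker (letterMapOn circ blk (evenSolSpace circ blk))) = 0 := by
      obtain ⟨B, hB⟩ := h
      rw [ker_letterMapOn_eq_bot hb hconn (evenSolSpace circ blk)
        (fun v (hv : _ ∧ _) => hv.2 B hB), finrank_bot]
    have h6 := exists_solSpace_finrank_evenSolSpace (circ := circ) h
    have h7 := finrank_solSpace_add_one_le (circ := circ) h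
    have h8 := two_mul_card_add_card_oddBlocks_le hb
    omega

/-- A subspace of coordinate dimension `d` is determined by at most `d` coordinates. -/
theorem exists_coords_injective {K : Type*} [Field K] (V : Submodule K (P → K)) :
    ∃ S : Finset P, S.card ≤ Module.finrank K V ∧ ∀ v ∈ V, (∀ B ∈ S, v B = 0) → v = 0 := by
  set φ : P → Module.Dual K V := fun B => LinearMap.proj B ∘ₗ V.subtype
  -- A maximal independent set among the restricted coordinate functionals; one coordinate is chosen
  -- for each of its members.
  obtain ⟨b, hb, hspan, hli⟩ := exists_linearIndependent K (Set.range φ)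
  have hfin : b.Finite := (Set.finite_range φ).subset hb
  have hsec : ∀ f : b, ∃ B, φ B = f.1 := fun f => hb f.2
  choose g hg using hsec
  have := hfin.fintype
  refine ⟨Finset.univ.image g, Finset.card_image_le.trans ?_, fun v hv h0 => ?_⟩
  · have := hli.fintype_card_le_finrank
    rwa [Subspace.dual_finrank_eq] at this
  · have key : ∀ f ∈ Submodule.span K b, f ⟨v, hv⟩ = 0 := by
      intro f hf
      induction hf using Submodule.span_induction with
      | mem x hx =>
        have h1 := h0 (g ⟨x, hx⟩) (Finset.mem_image_of_mem _ (Finset.mem_univ _))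
        have h2 : φ (g ⟨x, hx⟩) = x := hg ⟨x, hx⟩
        rw [← h2]
        exact h1
      | zero => rfl
      | add x y _ _ hx hy => rw [LinearMap.add_apply, hx, hy, add_zero]
      | smul a x _ hx => rw [LinearMap.smul_apply, hx, smul_zero]
    funext B
    exact key (φ B) (hspan ▸ Submodule.subset_span ⟨B, rfl⟩)

/-- Integer solutions of equations with odd coefficients are determined by coordinates that
determine the solutions modulo two. -/
theorem int_eq_zero_of_coords {sgn : L → ℤ} (hs : ∀ l, Odd (sgn l)) {S : Finset P}
    (hS : ∀ v ∈ solSpace circ blk, (∀ B ∈ S, v B = 0) → v = 0) {y : P → ℤ}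
    (hy : ∀ i, ∑ l ∈ Finset.univ.filter (fun l => circ l = i), sgn l * y (blk l) = 0)
    (h0 : ∀ B ∈ S, y B = 0) : y = 0 := by
  by_contra hne
  obtain ⟨B0, hB0⟩ := Function.ne_iff.1 hne
  -- Dividing by the gcd leaves a primitive solution g. Its reduction modulo two solves the
  -- equations and vanishes on S, hence is zero, so all entries of g are even, contradicting
  -- primitivity.
  obtain ⟨g, hg, hg1⟩ := Finset.extract_gcd y (s := Finset.univ) ⟨B0, Finset.mem_univ _⟩
  set d := Finset.univ.gcd y
  have hd : d ≠ 0 := by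
    intro hd
    exact hB0 (Finset.gcd_eq_zero_iff.1 hd B0 (Finset.mem_univ _))
  have hv : (fun B => (g B : ZMod 2)) ∈ solSpace circ blk := by
    intro i
    have h1 : d * ∑ l ∈ Finset.univ.filter (fun l => circ l = i), sgn l * g (blk l) = 0 := by
      rw [← hy i, Finset.mul_sum]
      refine Finset.sum_congr rfl fun l _ => ?_
      rw [hg (blk l) (Finset.mem_univ _)]
      ring
    have h2 := congrArg (fun z : ℤ => (z : ZMod 2)) ((mul_eq_zero.1 h1).resolve_left hd)
    simp only [Int.cast_sum, Int.cast_mul, Int.cast_zero] at h2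
    rw [← h2]
    refine Finset.sum_congr rfl fun l _ => ?_
    rw [(ZMod.intCast_eq_one_iff_odd).2 (hs l), one_mul]
  have hz := hS _ hv fun B hB => by
    have := h0 B hB
    rw [hg B (Finset.mem_univ _)] at this
    simp [(mul_eq_zero.1 this).resolve_left hd]
  have h2 : (2 : ℤ) ∣ Finset.univ.gcd g := Finset.dvd_gcd fun B _ => by
    have := congrFun hz B
    exact (ZMod.intCast_zmod_eq_zero_iff_dvd (g B) 2).1 this
  rw [hg1] at h2
  exact absurd h2 (by decide)

end BlockCounting

/-! ### Counting closed labelings of circuits -/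

section LabelCounting

/-- Labelings of a finite set of letters by integers of absolute value at most `m`. -/
noncomputable def labelBox (L : Type*) [Fintype L] [DecidableEq L] (m : ℕ) : Finset (L → ℤ) :=
  Fintype.piFinset fun _ => Finset.Icc (-(m : ℤ)) m

theorem mem_labelBox {L : Type*} [Fintype L] [DecidableEq L] {m : ℕ} {J : L → ℤ} :
    J ∈ labelBox L m ↔ ∀ l, |J l| ≤ m := by
  simp [labelBox, abs_le]

theorem card_labelBox (L : Type*) [Fintype L] [DecidableEq L] (m : ℕ) :
    (labelBox L m).card = (2 * m + 1) ^ Fintype.card L := by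
  rw [labelBox, Fintype.card_piFinset, Finset.prod_const, Int.card_Icc, Finset.card_univ]
  congr 1
  omega

variable {L ι : Type} [Fintype L] [Fintype ι] [DecidableEq L] [DecidableEq ι]

/-- The signed sum of the labels vanishes along every circuit. -/
def IsClosedLabeling (circ : L → ι) (sgn : L → ℤ) (J : L → ℤ) : Prop :=
  ∀ i, ∑ l ∈ Finset.univ.filter (fun l => circ l = i), sgn l * J l = 0

/-- Every label is used at least twice. -/
def IsRepeating (J : L → ℤ) : Prop := ∀ l, ∃ l', l' ≠ l ∧ J l' = J l

/-- A function on the circuits that takes equal values on circuits with a common label. -/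
def RespectsLinks (circ : L → ι) (J : L → ℤ) (c : ι → ZMod 2) : Prop :=
  ∀ l l', J l = J l' → c (circ l) = c (circ l')

/-- The circuits are connected through common labels. -/
def IsConnectedLabeling (circ : L → ι) (J : L → ℤ) : Prop :=
  ∀ c : ι → ZMod 2, RespectsLinks circ J c → ∀ i i', c i = c i'

/-- Every circuit has a label in common with another one. -/
def IsLinking (circ : L → ι) (J : L → ℤ) : Prop :=
  ∀ i, ∃ l l', circ l = i ∧ circ l' ≠ i ∧ J l = J l'

open scoped Classical in
/-- The connected component of a circuit. -/
noncomputable def cluster (circ : L → ι) (J : L → ℤ) (i0 : ι) : Finset ι :=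
  Finset.univ.filter fun i => ∀ c : ι → ZMod 2, RespectsLinks circ J c → c i = c i0

theorem mem_cluster {circ : L → ι} {J : L → ℤ} {i0 i : ι} : i ∈ cluster circ J i0 ↔
    ∀ c : ι → ZMod 2, RespectsLinks circ J c → c i = c i0 := by
  simp [cluster]

theorem self_mem_cluster (circ : L → ι) (J : L → ℤ) (i0 : ι) : i0 ∈ cluster circ J i0 :=
  mem_cluster.2 fun _ _ => rfl

/-- No common label crosses the boundary of a cluster; this is what allows a labeling to be cut into
its parts inside and outside. -/
theorem circ_mem_cluster_iff {circ : L → ι} {J : L → ℤ} {i0 : ι} {l l' : L} (h : J l = J l') :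
    circ l ∈ cluster circ J i0 ↔ circ l' ∈ cluster circ J i0 := by
  simp only [mem_cluster]
  exact forall₂_congr fun c hc => by rw [hc l l' h]

/-- The number of labelings with a given kernel is bounded through the solution space. -/
theorem card_filter_ker_le (circ : L → ι) {sgn : L → ℤ} (hs : ∀ l, Odd (sgn l)) (m : ℕ)
    (σ : Setoid L) [Fintype (Quotient σ)] [DecidableEq (Quotient σ)] (A : Finset (L → ℤ))
    (hA : ∀ J ∈ A, J ∈ labelBox L m ∧ IsClosedLabeling circ sgn J ∧ ∀ l l', σ l l' → J l = J l') :
    A.card ≤ (2 * m + 1) ^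
      Module.finrank (ZMod 2) (solSpace circ (Quotient.mk σ)) := by
  obtain ⟨S, hcard, hS⟩ := exists_coords_injective (solSpace circ (Quotient.mk σ))
  have h1 : A.card ≤ (labelBox S m).card := by
    refine Finset.card_le_card_of_injOn (fun J (B : S) => J B.1.out) ?_ ?_
    · intro J hJ
      rw [Finset.mem_coe, mem_labelBox]
      intro B
      exact mem_labelBox.1 (hA J hJ).1 _
    · intro J hJ J' hJ' he
      obtain ⟨-, hc, hk⟩ := hA J hJ
      obtain ⟨-, hc', hk'⟩ := hA J' hJ'
      have hy : ∀ l, J (Quotient.mk σ l).out - J' (Quotient.mk σ l).out = J l - J' l := by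
        intro l
        have : σ (Quotient.mk σ l).out l := Quotient.mk_out l
        rw [hk _ _ this, hk' _ _ this]
      have h0 := int_eq_zero_of_coords hs hS (y := fun B => J B.out - J' B.out) (fun i => by
        simp only [hy, mul_sub, Finset.sum_sub_distrib]
        rw [hc i, hc' i, sub_zero]) (fun B hB => sub_eq_zero.2 (congrFun he ⟨B, hB⟩))
      funext l
      have := congrFun h0 (Quotient.mk σ l)
      simp only [hy, Pi.zero_apply] at this
      exact sub_eq_zero.1 this
  refine h1.trans ?_
  rw [card_labelBox, Fintype.card_coe]
  exact Nat.pow_le_pow_right (by omega) hcard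

/-- Connected labelings: the count loses a factor `√m` for every circuit, and one more if there
are at least three of them. -/
theorem exists_card_connected_le (circ : L → ι) {sgn : L → ℤ} (hs : ∀ l, Odd (sgn l))
    (hc : ∀ i, Even (Finset.univ.filter fun l => circ l = i).card) (e : ℕ) (he : e ≤ 1)
    (hr : 2 + e ≤ Fintype.card ι) :
    ∃ C : ℝ, 0 ≤ C ∧ ∀ m : ℕ, 1 ≤ m → ∀ A : Finset (L → ℤ),
      (∀ J ∈ A, J ∈ labelBox L m ∧ IsClosedLabeling circ sgn J ∧ IsRepeating J ∧
        IsConnectedLabeling circ J) →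
      (A.card : ℝ) * √m ^ (Fintype.card ι + e) ≤ C * √m ^ Fintype.card L := by
  classical
  have hne : Nonempty ι := Fintype.card_pos_iff.1 (by omega)
  have : Fintype (Setoid L) := Fintype.ofInjective (fun σ : Setoid L => fun a b => σ a b)
    (fun σ τ h => Setoid.ext fun a b => by rw [show σ a b = τ a b from congrFun₂ h a b])
  refine ⟨(Fintype.card (Setoid L) : ℝ) * 3 ^ Fintype.card L, by positivity, fun m hm A hA => ?_⟩
  have hm1 : (1 : ℝ) ≤ m := by exact_mod_cast hm
  have hsq : (1 : ℝ) ≤ √m := Real.one_le_sqrt.2 hm1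
  have h1 : A.card = ∑ σ : Setoid L, (A.filter fun J => Setoid.ker J = σ).card :=
    Finset.card_eq_sum_card_fiberwise fun _ _ => Finset.mem_coe.2 (Finset.mem_univ _)
  have h2 : ∀ σ : Setoid L, ((A.filter fun J => Setoid.ker J = σ).card : ℝ) *
      √m ^ (Fintype.card ι + e) ≤ 3 ^ Fintype.card L * √m ^ Fintype.card L := by
    intro σ
    rcases (A.filter fun J => Setoid.ker J = σ).eq_empty_or_nonempty with h | ⟨J0, hJ0⟩
    · rw [h]; simp
    · obtain ⟨hJA, hJk⟩ := Finset.mem_filter.1 hJ0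
      obtain ⟨-, -, hrep, hcon⟩ := hA J0 hJA
      have hmk : ∀ l l', Quotient.mk σ l = Quotient.mk σ l' ↔ J0 l = J0 l' := by
        intro l l'
        rw [Quotient.eq, ← hJk]
        exact Setoid.ker_def
      have h3 := card_filter_ker_le circ hs m σ (A.filter fun J => Setoid.ker J = σ)
        (fun J hJ => by
          obtain ⟨hJ1, hJ2⟩ := Finset.mem_filter.1 hJ
          obtain ⟨a, b, -, -⟩ := hA J hJ1
          refine ⟨a, b, fun l l' hl => ?_⟩
          rw [← hJ2] at hl
          exact hl)
      have h4 := two_mul_finrank_solSpace_add_card_le (circ := circ) (blk := Quotient.mk σ) hc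
        (fun B => by
          obtain ⟨l, rfl⟩ := Quotient.exists_rep B
          obtain ⟨l', hl', hJ'⟩ := hrep l
          refine Finset.one_lt_card.2 ⟨l, by simp, l', ?_, hl'.symm⟩
          simp only [Finset.mem_filter, Finset.mem_univ, true_and]
          exact (hmk _ _).2 hJ')
        (fun c hc' => hcon c fun l l' hl => hc' l l' ((hmk l l').2 hl)) e he hr
      set d := Module.finrank (ZMod 2) (solSpace circ (Quotient.mk σ))
      -- 2m + 1 ≤ 3m because m ≥ 1, which is the origin of the 3 in the constant.
      have h5 : ((A.filter fun J => Setoid.ker J = σ).card : ℝ) ≤ (3 * (m : ℝ)) ^ d := by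
        refine (Nat.cast_le.2 h3).trans ?_
        push_cast
        exact pow_le_pow_left₀ (by positivity) (by linarith) _
      calc _ ≤ (3 * (m : ℝ)) ^ d * √m ^ (Fintype.card ι + e) := by gcongr
        _ = 3 ^ d * √m ^ (2 * d + (Fintype.card ι + e)) := by
          rw [mul_pow, pow_add _ (2 * d), pow_mul √(m : ℝ) 2 d, Real.sq_sqrt (by positivity)]
          ring
        _ ≤ _ := by
          gcongr
          · norm_num
          · omega
  rw [h1]
  push_cast
  rw [Finset.sum_mul]
  refine (Finset.sum_le_sum fun σ _ => h2 σ).trans (le_of_eq ?_)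
  rw [Finset.sum_const, Finset.card_univ, nsmul_eq_mul, mul_assoc]

section Restriction

variable (circ : L → ι) (p : ι → Prop) [DecidablePred p]

/-- The circuit map on the letters of a subfamily of the circuits. -/
def circOn (l : {l : L // p (circ l)}) : {i // p i} := ⟨circ l.1, l.2⟩

theorem map_filter_circOn (i : {i // p i}) :
    (Finset.univ.filter fun l => circOn circ p l = i).map (Function.Embedding.subtype _) =
      Finset.univ.filter fun l => circ l = i.1 := by
  ext l
  simp only [Finset.mem_map, Finset.mem_filter, Finset.mem_univ, true_and,
    Function.Embedding.subtype_apply, Subtype.exists, exists_and_right, exists_eq_right, circOn,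
    Subtype.ext_iff]
  exact ⟨fun ⟨_, h⟩ => h, fun h => ⟨h ▸ i.2, h⟩⟩

theorem even_card_circOn (hc : ∀ i, Even (Finset.univ.filter fun l => circ l = i).card)
    (i : {i // p i}) : Even (Finset.univ.filter fun l => circOn circ p l = i).card := by
  rw [← Finset.card_map (Function.Embedding.subtype _), map_filter_circOn]
  exact hc i

theorem isClosedLabeling_circOn {sgn : L → ℤ} {J : L → ℤ} (h : IsClosedLabeling circ sgn J) :
    IsClosedLabeling (circOn circ p) (fun l => sgn l.1) (fun l => J l.1) := by
  intro i
  rw [← h i, ← map_filter_circOn, Finset.sum_map]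
  rfl

variable {circ p}

theorem isRepeating_subtype {J : L → ℤ} (h : IsRepeating J)
    (hp : ∀ l l', J l = J l' → (p (circ l) ↔ p (circ l'))) :
    IsRepeating (fun l : {l : L // p (circ l)} => J l.1) := by
  rintro ⟨l, hl⟩
  obtain ⟨l', hne, he⟩ := h l
  exact ⟨⟨l', (hp l' l he).2 hl⟩, fun h => hne (congrArg Subtype.val h), he⟩

theorem isLinking_circOn {J : L → ℤ} (h : IsLinking circ J)
    (hp : ∀ l l', J l = J l' → (p (circ l) ↔ p (circ l'))) :
    IsLinking (circOn circ p) (fun l : {l : L // p (circ l)} => J l.1) := by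
  rintro ⟨i, hi⟩
  obtain ⟨l, l', h1, h2, h3⟩ := h i
  have hl : p (circ l) := h1 ▸ hi
  exact ⟨⟨l, hl⟩, ⟨l', (hp l l' h3).1 hl⟩, Subtype.ext h1,
    fun h => h2 (congrArg Subtype.val h), h3⟩

/-- A link-respecting function on the cluster, extended by zero, still respects all links, because
none leaves the cluster. By the definition of the cluster it is therefore constant there. -/
theorem isConnectedLabeling_cluster (circ : L → ι) (J : L → ℤ) (i0 : ι) :
    IsConnectedLabeling (circOn circ (· ∈ cluster circ J i0))
      (fun l : {l : L // circ l ∈ cluster circ J i0} => J l.1) := by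
  classical
  intro c hc
  suffices H : ∀ i : {i // i ∈ cluster circ J i0}, c i = c ⟨i0, self_mem_cluster circ J i0⟩ from
    fun i i' => (H i).trans (H i').symm
  set c' : ι → ZMod 2 := fun i => if h : i ∈ cluster circ J i0 then c ⟨i, h⟩ else 0 with hc'
  have hr : RespectsLinks circ J c' := by
    intro l l' hl
    have := circ_mem_cluster_iff (circ := circ) (i0 := i0) hl
    by_cases h : circ l ∈ cluster circ J i0
    · have h' := this.1 h
      simp only [hc', h, h', dite_true]
      exact hc ⟨l, h⟩ ⟨l', h'⟩ hl
    · have h' : circ l' ∉ cluster circ J i0 := fun h' => h (this.2 h')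
      simp only [hc', h, h', dite_false]
  rintro ⟨i, hi⟩
  have := mem_cluster.1 hi c' hr
  simpa only [hc', hi, self_mem_cluster, dite_true] using this

theorem two_le_card_cluster {J : L → ℤ} (h : IsLinking circ J) (i0 : ι) :
    2 ≤ (cluster circ J i0).card := by
  obtain ⟨l, l', h1, h2, h3⟩ := h i0
  refine Finset.one_lt_card.2 ⟨i0, self_mem_cluster circ J i0, circ l', ?_, h2.symm⟩
  rw [← circ_mem_cluster_iff h3, h1]
  exact self_mem_cluster circ J i0

end Restriction

/-- The count of repeating linking labelings with a given cluster. -/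
theorem card_cluster_le (circ : L → ι) {sgn : L → ℤ} (hs : ∀ l, Odd (sgn l))
    (hc : ∀ i, Even (Finset.univ.filter fun l => circ l = i).card) (e : ℕ) (he : e ≤ 1)
    (i0 : ι) (R : Finset ι) (hR : 2 + e ≤ R.card)
    (hrest : ∃ C : ℝ, 0 ≤ C ∧ ∀ m : ℕ, 1 ≤ m → ∀ A : Finset ({l // circ l ∉ R} → ℤ),
      (∀ J ∈ A, J ∈ labelBox _ m ∧ IsClosedLabeling (circOn circ (· ∉ R)) (fun l => sgn l.1) J ∧
        IsRepeating J ∧ IsLinking (circOn circ (· ∉ R)) J) →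
      (A.card : ℝ) * √m ^ Fintype.card {i // i ∉ R} ≤
        C * √m ^ Fintype.card {l // circ l ∉ R}) :
    ∃ C : ℝ, 0 ≤ C ∧ ∀ m : ℕ, 1 ≤ m → ∀ A : Finset (L → ℤ),
      (∀ J ∈ A, J ∈ labelBox L m ∧ IsClosedLabeling circ sgn J ∧ IsRepeating J ∧
        IsLinking circ J ∧ cluster circ J i0 = R) →
      (A.card : ℝ) * √m ^ (Fintype.card ι + e) ≤ C * √m ^ Fintype.card L := by
  classical
  obtain ⟨C1, hC1, h1⟩ := exists_card_connected_le (circOn circ (· ∈ R))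
    (sgn := fun l => sgn l.1) (fun l => hs l.1) (even_card_circOn circ (· ∈ R) hc) e he
    (by rw [Fintype.card_coe]; exact hR)
  obtain ⟨C2, hC2, h2⟩ := hrest
  refine ⟨C1 * C2, by positivity, fun m hm A hA => ?_⟩
  set A1 := A.image fun J (l : {l // circ l ∈ R}) => J l.1
  set A2 := A.image fun J (l : {l // circ l ∉ R}) => J l.1
  -- A labeling is determined by its restrictions to the cluster and to its complement. The first is
  -- connected, and the second is again repeating and linking.
  have hcard : A.card ≤ A1.card * A2.card := by
    rw [← Finset.card_product]
    refine Finset.card_le_card_of_injOn (fun J => (fun l => J l.1, fun l => J l.1)) ?_ ?_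
    · intro J hJ
      exact Finset.mem_coe.2 (Finset.mem_product.2
        ⟨Finset.mem_image_of_mem _ hJ, Finset.mem_image_of_mem _ hJ⟩)
    · intro J _ J' _ h
      funext l
      by_cases hl : circ l ∈ R
      · exact congrFun (congrArg Prod.fst h) ⟨l, hl⟩
      · exact congrFun (congrArg Prod.snd h) ⟨l, hl⟩
  have hb1 := h1 m hm A1 (fun J' hJ' => by
    obtain ⟨J, hJ, rfl⟩ := Finset.mem_image.1 hJ'
    obtain ⟨a, b, c, d, hcl⟩ := hA J hJ
    have hp : ∀ l l', J l = J l' → (circ l ∈ R ↔ circ l' ∈ R) := fun l l' h => by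
      rw [← hcl]; exact circ_mem_cluster_iff h
    refine ⟨mem_labelBox.2 fun l => mem_labelBox.1 a _, isClosedLabeling_circOn circ _ b,
      isRepeating_subtype c hp, ?_⟩
    have := isConnectedLabeling_cluster circ J i0
    subst hcl
    exact this)
  have hb2 := h2 m hm A2 (fun J' hJ' => by
    obtain ⟨J, hJ, rfl⟩ := Finset.mem_image.1 hJ'
    obtain ⟨a, b, c, d, hcl⟩ := hA J hJ
    have hp : ∀ l l', J l = J l' → (circ l ∉ R ↔ circ l' ∉ R) := fun l l' h => by
      rw [← hcl]; exact not_congr (circ_mem_cluster_iff h)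
    exact ⟨mem_labelBox.2 fun l => mem_labelBox.1 a _, isClosedLabeling_circOn circ _ b,
      isRepeating_subtype c hp, isLinking_circOn d hp⟩)
  have e1 : Fintype.card ι = Fintype.card {i // i ∈ R} + Fintype.card {i // i ∉ R} := by
    rw [Fintype.card_subtype_compl, Fintype.card_coe]
    have := Finset.card_le_univ R
    omega
  have e2 : Fintype.card L = Fintype.card {l // circ l ∈ R} + Fintype.card {l // circ l ∉ R} := by
    rw [Fintype.card_subtype_compl]
    have := Fintype.card_subtype_le fun l => circ l ∈ R
    omega
  calc (A.card : ℝ) * √m ^ (Fintype.card ι + e)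
      ≤ ((A1.card : ℝ) * A2.card) * √m ^ (Fintype.card ι + e) := by
        gcongr; exact_mod_cast hcard
    _ = ((A1.card : ℝ) * √m ^ (Fintype.card {i // i ∈ R} + e)) *
        (A2.card * √m ^ Fintype.card {i // i ∉ R}) := by rw [e1]; ring
    _ ≤ (C1 * √m ^ Fintype.card {l // circ l ∈ R}) *
        (C2 * √m ^ Fintype.card {l // circ l ∉ R}) := by gcongr
    _ = _ := by rw [e2]; ring

/-- Repeating linking labelings: the count loses a factor `√m` for every circuit. -/
theorem exists_card_linking_le (circ : L → ι) {sgn : L → ℤ} (hs : ∀ l, Odd (sgn l))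
    (hc : ∀ i, Even (Finset.univ.filter fun l => circ l = i).card) :
    ∃ C : ℝ, 0 ≤ C ∧ ∀ m : ℕ, 1 ≤ m → ∀ A : Finset (L → ℤ),
      (∀ J ∈ A, J ∈ labelBox L m ∧ IsClosedLabeling circ sgn J ∧ IsRepeating J ∧
        IsLinking circ J) →
      (A.card : ℝ) * √m ^ Fintype.card ι ≤ C * √m ^ Fintype.card L := by
  classical
  induction hn : Fintype.card ι using Nat.strong_induction_on generalizing L ι with
  | _ n ih =>
  rcases isEmpty_or_nonempty ι with hι | ⟨⟨i0⟩⟩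
  · have hL : IsEmpty L := ⟨fun l => hι.elim (circ l)⟩
    refine ⟨1, zero_le_one, fun m _ A _ => ?_⟩
    have : A.card ≤ 1 := Finset.card_le_one_of_subsingleton A
    rw [← hn]
    simpa using this
  -- The labelings are sorted by the cluster R of `i0`. Removing R leaves fewer circuits, to which
  -- the induction hypothesis applies; a cluster with fewer than two members cannot occur in a
  -- linking labeling.
  · have key : ∀ R : Finset ι, ∃ C : ℝ, 0 ≤ C ∧ ∀ m : ℕ, 1 ≤ m → ∀ A : Finset (L → ℤ),
        (∀ J ∈ A, J ∈ labelBox L m ∧ IsClosedLabeling circ sgn J ∧ IsRepeating J ∧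
          IsLinking circ J ∧ cluster circ J i0 = R) →
        (A.card : ℝ) * √m ^ (Fintype.card ι + 0) ≤ C * √m ^ Fintype.card L := by
      intro R
      by_cases hR : 2 ≤ R.card
      · refine card_cluster_le circ hs hc 0 zero_le_one i0 R hR ?_
        refine ih (Fintype.card {i // i ∉ R}) ?_ (circOn circ (· ∉ R)) (fun l => hs l.1)
          (even_card_circOn circ _ hc) rfl
        rw [Fintype.card_subtype_compl, Fintype.card_coe, ← hn]
        have := Finset.card_le_univ R
        omega
      · refine ⟨0, le_rfl, fun m _ A hA => ?_⟩
        rcases A.eq_empty_or_nonempty with rfl | ⟨J, hJ⟩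
        · simp
        · obtain ⟨-, -, -, d, hcl⟩ := hA J hJ
          exact absurd (hcl ▸ two_le_card_cluster d i0) hR
    choose C hC0 hC using key
    refine ⟨∑ R, C R, Finset.sum_nonneg fun R _ => hC0 R, fun m hm A hA => ?_⟩
    have h1 : A.card = ∑ R : Finset ι, (A.filter fun J => cluster circ J i0 = R).card :=
      Finset.card_eq_sum_card_fiberwise fun _ _ => Finset.mem_coe.2 (Finset.mem_univ _)
    rw [h1, ← hn]
    push_cast
    rw [Finset.sum_mul, Finset.sum_mul]
    refine Finset.sum_le_sum fun R _ => hC R m hm _ fun J hJ => ?_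
    obtain ⟨hJ1, hJ2⟩ := Finset.mem_filter.1 hJ
    obtain ⟨a, b, c, d⟩ := hA J hJ1
    exact ⟨a, b, c, d, hJ2⟩

/-- Repeating linking labelings in which the cluster of a given circuit has at least three
elements: one more factor `√m` is lost. -/
theorem exists_card_large_cluster_le (circ : L → ι) {sgn : L → ℤ} (hs : ∀ l, Odd (sgn l))
    (hc : ∀ i, Even (Finset.univ.filter fun l => circ l = i).card) (i0 : ι) :
    ∃ C : ℝ, 0 ≤ C ∧ ∀ m : ℕ, 1 ≤ m → ∀ A : Finset (L → ℤ),
      (∀ J ∈ A, J ∈ labelBox L m ∧ IsClosedLabeling circ sgn J ∧ IsRepeating J ∧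
        IsLinking circ J ∧ 3 ≤ (cluster circ J i0).card) →
      (A.card : ℝ) * √m ^ (Fintype.card ι + 1) ≤ C * √m ^ Fintype.card L := by
  classical
  have key : ∀ R : Finset ι, ∃ C : ℝ, 0 ≤ C ∧ ∀ m : ℕ, 1 ≤ m → ∀ A : Finset (L → ℤ),
      (∀ J ∈ A, J ∈ labelBox L m ∧ IsClosedLabeling circ sgn J ∧ IsRepeating J ∧
        IsLinking circ J ∧ 3 ≤ R.card ∧ cluster circ J i0 = R) →
      (A.card : ℝ) * √m ^ (Fintype.card ι + 1) ≤ C * √m ^ Fintype.card L := by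
    intro R
    by_cases hR : 2 + 1 ≤ R.card
    · obtain ⟨C, h0, h⟩ := card_cluster_le circ hs hc 1 le_rfl i0 R hR
        (exists_card_linking_le (circOn circ (· ∉ R)) (fun l => hs l.1)
          (even_card_circOn circ _ hc))
      exact ⟨C, h0, fun m hm A hA => h m hm A fun J hJ => by
        obtain ⟨a, b, c, d, -, f⟩ := hA J hJ
        exact ⟨a, b, c, d, f⟩⟩
    · refine ⟨0, le_rfl, fun m _ A hA => ?_⟩
      rcases A.eq_empty_or_nonempty with rfl | ⟨J, hJ⟩
      · simp
      · exact absurd (hA J hJ).2.2.2.2.1 hR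
  choose C hC0 hC using key
  refine ⟨∑ R, C R, Finset.sum_nonneg fun R _ => hC0 R, fun m hm A hA => ?_⟩
  have h1 : A.card = ∑ R : Finset ι, (A.filter fun J => cluster circ J i0 = R).card :=
    Finset.card_eq_sum_card_fiberwise fun _ _ => Finset.mem_coe.2 (Finset.mem_univ _)
  rw [h1]
  push_cast
  rw [Finset.sum_mul, Finset.sum_mul]
  refine Finset.sum_le_sum fun R _ => hC R m hm _ fun J hJ => ?_
  obtain ⟨hJ1, hJ2⟩ := Finset.mem_filter.1 hJ
  obtain ⟨a, b, c, d, f⟩ := hA J hJ1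
  exact ⟨a, b, c, d, hJ2 ▸ f, hJ2⟩

end LabelCounting

/-! ### Moments, independence and centred circuit products -/

section Probability

variable {𝕜 : Type*} [RCLike 𝕜] {Ω : Type*} [MeasurableSpace Ω] {μ : Measure Ω}

/-- All absolute moments of `f` are finite. -/
def HasMoments (f : Ω → 𝕜) (μ : Measure Ω) : Prop := ∀ k : ℕ, MemLp f k μ

/-- Hölder with exponents 2k and 2k; requiring all orders at once is what makes the class closed
under products. -/
theorem HasMoments.mul {f g : Ω → 𝕜} (hf : HasMoments f μ) (hg : HasMoments g μ) :
    HasMoments (fun ω => f ω * g ω) μ := by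
  intro k
  have : ENNReal.HolderTriple ((2 * k : ℕ) : ℝ≥0∞) ((2 * k : ℕ) : ℝ≥0∞) (k : ℝ≥0∞) := by
    constructor
    rcases Nat.eq_zero_or_pos k with rfl | hk
    · simp
    · push_cast
      rw [ENNReal.mul_inv (by simp) (by simp), ← add_mul, ENNReal.inv_two_add_inv_two, one_mul]
  exact MemLp.mul' (hg (2 * k)) (hf (2 * k))

theorem HasMoments.const [IsFiniteMeasure μ] (c : 𝕜) : HasMoments (fun _ : Ω => c) μ :=
  fun _ => memLp_const c

theorem HasMoments.sub {f g : Ω → 𝕜} (hf : HasMoments f μ) (hg : HasMoments g μ) :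
    HasMoments (fun ω => f ω - g ω) μ := fun k => (hf k).sub (hg k)

theorem HasMoments.sum {ι : Type*} {s : Finset ι} {f : ι → Ω → 𝕜}
    (hf : ∀ i ∈ s, HasMoments (f i) μ) : HasMoments (fun ω => ∑ i ∈ s, f i ω) μ :=
  fun k => memLp_finsetSum s fun i hi => hf i hi k

theorem HasMoments.prod [IsFiniteMeasure μ] {ι : Type*} {s : Finset ι} {f : ι → Ω → 𝕜}
    (hf : ∀ i ∈ s, HasMoments (f i) μ) : HasMoments (fun ω => ∏ i ∈ s, f i ω) μ := by
  classical
  induction s using Finset.induction_on with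
  | empty => simpa using HasMoments.const (1 : 𝕜)
  | insert i s hi ih =>
    simp only [Finset.prod_insert hi]
    exact (hf i (Finset.mem_insert_self _ _)).mul
      (ih fun j hj => hf j (Finset.mem_insert_of_mem hj))

theorem HasMoments.integrable {f : Ω → 𝕜} (hf : HasMoments f μ) : Integrable f μ := by
  simpa using (memLp_one_iff_integrable (f := f) (μ := μ)).1 (by simpa using hf 1)

theorem HasMoments.integrable_norm_pow [IsFiniteMeasure μ] {f : Ω → 𝕜} (hf : HasMoments f μ)
    (k : ℕ) : Integrable (fun ω => ‖f ω‖ ^ k) μ := (hf k).integrable_norm_pow'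

/-- The entry or its conjugate. -/
def conjIf (c : Bool) (z : 𝕜) : 𝕜 := if c then star z else z

@[simp] theorem norm_conjIf (c : Bool) (z : 𝕜) : ‖conjIf c z‖ = ‖z‖ := by
  cases c <;> simp [conjIf]

theorem measurable_conjIf (c : Bool) : Measurable (conjIf c : 𝕜 → 𝕜) := by
  cases c
  · exact measurable_id
  · exact continuous_star.measurable

theorem integral_conjIf (c : Bool) (f : Ω → 𝕜) :
    ∫ ω, conjIf c (f ω) ∂μ = conjIf c (∫ ω, f ω ∂μ) := by
  cases c
  · rfl
  · exact integral_conj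

theorem HasMoments.conjIf {f : Ω → 𝕜} (hf : HasMoments f μ) (c : Bool) :
    HasMoments (fun ω => conjIf c (f ω)) μ := by
  intro k
  refine (hf k).of_le ?_ (Eventually.of_forall fun ω => (norm_conjIf c _).le)
  exact ((measurable_conjIf c).comp_aemeasurable (hf k).1.aemeasurable).aestronglyMeasurable

/-- The common hypotheses of the real and the complex case, in terms of the mixed moments
`mom p q` of order two, and the one with `p = q = 2`. -/
structure IsEntryFamily (mom : ℕ → ℕ → ℝ) (μ : Measure Ω) (a : ℤ → Ω → 𝕜) : Prop where
  measurable : ∀ j, Measurable (a j)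
  indep : iIndepFun a μ
  mean : ∀ j, ∫ ω, a j ω ∂μ = 0
  moment : ∀ j p q, (p + q ≤ 2 ∨ p = 2 ∧ q = 2) →
    ∫ ω, (star (a j ω)) ^ p * a j ω ^ q ∂μ = (mom p q : 𝕜)
  mom_one : mom 1 1 = 1
  hasMoments : ∀ j, HasMoments (a j) μ
  bounded : ∀ k : ℕ, ∃ C : ℝ, ∀ j, ∫ ω, ‖a j ω‖ ^ k ∂μ ≤ C

/-- The information carried by the entries with index in `S`. -/
@[reducible]
def entrySigma (a : ℤ → Ω → 𝕜) (S : Set ℤ) : MeasurableSpace Ω :=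
  ⨆ j ∈ S, MeasurableSpace.comap (a j) inferInstance

theorem measurable_entrySigma (a : ℤ → Ω → 𝕜) {S : Set ℤ} {j : ℤ} (hj : j ∈ S) :
    Measurable[entrySigma a S] (a j) := by
  have : MeasurableSpace.comap (a j) inferInstance ≤ entrySigma a S :=
    le_iSup₂ (f := fun (j : ℤ) (_ : j ∈ S) => MeasurableSpace.comap (a j) inferInstance) j hj
  exact (comap_measurable (a j)).mono this le_rfl

variable {mom : ℕ → ℕ → ℝ} {a : ℤ → Ω → 𝕜}

/-- Disjoint index sets generate independent σ-algebras. Phrased through `entrySigma`, independence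
of products of entries can be read off from the labels that they use. -/
theorem IsEntryFamily.integral_mul (ha : IsEntryFamily mom μ a) {S T : Set ℤ}
    (hST : Disjoint S T) {f g : Ω → 𝕜} (hf : Measurable[entrySigma a S] f)
    (hg : Measurable[entrySigma a T] g) :
    ∫ ω, f ω * g ω ∂μ = (∫ ω, f ω ∂μ) * ∫ ω, g ω ∂μ := by
  have hle : ∀ j, MeasurableSpace.comap (a j) inferInstance ≤ ‹MeasurableSpace Ω› :=
    fun j => (ha.measurable j).comap_le
  have h1 : Indep (entrySigma a S) (entrySigma a T) μ :=
    indep_iSup_of_disjoint hle ((iIndepFun_iff_iIndep _ _ _).1 ha.indep) hST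
  have h2 : IndepFun f g μ := by
    rw [IndepFun_iff_Indep]
    exact indep_of_indep_of_le_left (indep_of_indep_of_le_right h1 hg.comap_le) hf.comap_le
  have hS : ∀ S, entrySigma a S ≤ ‹MeasurableSpace Ω› := fun S => iSup₂_le fun j _ => hle j
  exact h2.integral_fun_mul_eq_mul_integral (hf.mono (hS S) le_rfl).aestronglyMeasurable
    (hg.mono (hS T) le_rfl).aestronglyMeasurable

section CircuitProducts

variable {L ι : Type} [Fintype L] [Fintype ι] [DecidableEq L] [DecidableEq ι]
  (circ : L → ι) (kd : L → Bool) (J : L → ℤ)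

/-- The product of the entries along a set of letters. -/
def letterProd (a : ℤ → Ω → 𝕜) (kd : L → Bool) (J : L → ℤ) (s : Finset L) (ω : Ω) : 𝕜 :=
  ∏ l ∈ s, conjIf (kd l) (a (J l) ω)

/-- The letters of a circuit. -/
def lettersOf (circ : L → ι) (i : ι) : Finset L := Finset.univ.filter fun l => circ l = i

theorem mem_lettersOf {circ : L → ι} {i : ι} {l : L} : l ∈ lettersOf circ i ↔ circ l = i := by
  simp [lettersOf]

/-- The centred product of the entries along a circuit. -/
noncomputable def circDev (μ : Measure Ω) (a : ℤ → Ω → 𝕜) (circ : L → ι) (kd : L → Bool)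
    (J : L → ℤ) (i : ι) (ω : Ω) : 𝕜 :=
  letterProd a kd J (lettersOf circ i) ω - ∫ ω', letterProd a kd J (lettersOf circ i) ω' ∂μ

/-- The expectation of the product of the centred circuit products. -/
noncomputable def devMean (μ : Measure Ω) (a : ℤ → Ω → 𝕜) (circ : L → ι) (kd : L → Bool)
    (J : L → ℤ) (S : Finset ι) : 𝕜 :=
  ∫ ω, ∏ i ∈ S, circDev μ a circ kd J i ω ∂μ

variable {circ kd J}

theorem measurable_letterProd (s : Finset L) {S : Set ℤ} (h : ∀ l ∈ s, J l ∈ S) :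
    Measurable[entrySigma a S] (letterProd a kd J s) := by
  unfold letterProd
  exact @Finset.measurable_fun_prod _ _ _ _ _ _ (entrySigma a S) _ s fun l hl =>
    (measurable_conjIf (kd l)).comp (measurable_entrySigma a (h l hl))

theorem measurable_circDev (i : ι) {S : Set ℤ} (h : ∀ l, circ l = i → J l ∈ S) :
    Measurable[entrySigma a S] (circDev μ a circ kd J i) :=
  Measurable.sub_const (measurable_letterProd _ fun l hl => h l (mem_lettersOf.1 hl)) _

theorem measurable_prod_circDev (R : Finset ι) {S : Set ℤ} (h : ∀ l, circ l ∈ R → J l ∈ S) :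
    Measurable[entrySigma a S] (fun ω => ∏ i ∈ R, circDev μ a circ kd J i ω) :=
  @Finset.measurable_fun_prod _ _ _ _ _ _ (entrySigma a S) _ R fun i hi =>
    measurable_circDev i fun l hl => h l (hl ▸ hi)

variable [IsProbabilityMeasure μ]

theorem IsEntryFamily.hasMoments_letterProd (ha : IsEntryFamily mom μ a) (s : Finset L) :
    HasMoments (letterProd a kd J s) μ :=
  HasMoments.prod fun l _ => (ha.hasMoments (J l)).conjIf (kd l)

theorem IsEntryFamily.hasMoments_circDev (ha : IsEntryFamily mom μ a) (i : ι) :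
    HasMoments (circDev μ a circ kd J i) μ :=
  (ha.hasMoments_letterProd _).sub (HasMoments.const _)

theorem devMean_singleton (ha : IsEntryFamily mom μ a) (i : ι) :
    devMean μ a circ kd J {i} = 0 := by
  unfold devMean
  simp only [Finset.prod_singleton, circDev]
  rw [integral_sub (ha.hasMoments_letterProd _).integrable (integrable_const _)]
  simp

/-- Circuits without common labels are independent. -/
theorem devMean_mul (ha : IsEntryFamily mom μ a) {R S : Finset ι} (hRS : Disjoint R S)
    (h : ∀ l l', circ l ∈ R → circ l' ∈ S → J l ≠ J l') :
    devMean μ a circ kd J (R ∪ S) = devMean μ a circ kd J R * devMean μ a circ kd J S := by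
  unfold devMean
  simp only [Finset.prod_union hRS]
  refine ha.integral_mul (S := J '' {l | circ l ∈ R}) (T := J '' {l | circ l ∈ S}) ?_
    (measurable_prod_circDev R fun l hl => ⟨l, hl, rfl⟩)
    (measurable_prod_circDev S fun l hl => ⟨l, hl, rfl⟩)
  rw [Set.disjoint_left]
  rintro _ ⟨l, hl, rfl⟩ ⟨l', hl', h'⟩
  exact h l l' hl hl' h'.symm

/-- The factor of circuit `i` is independent of the others and centred. -/
theorem devMean_eq_zero_of_not_linked (ha : IsEntryFamily mom μ a) {S : Finset ι} {i : ι}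
    (hi : i ∈ S) (h : ∀ l l', circ l = i → circ l' ∈ S → circ l' ≠ i → J l ≠ J l') :
    devMean μ a circ kd J S = 0 := by
  have e : S = {i} ∪ S.erase i := by
    rw [← Finset.insert_eq, Finset.insert_erase hi]
  rw [e, devMean_mul ha (by simp), devMean_singleton ha, zero_mul]
  intro l l' hl hl'
  rw [Finset.mem_erase] at hl'
  exact h l l' (Finset.mem_singleton.1 hl) hl'.2 hl'.1

theorem integral_letterProd_eq_zero_of_unique (ha : IsEntryFamily mom μ a) {s : Finset L} {l : L}
    (hl : l ∈ s) (h : ∀ l' ∈ s, l' ≠ l → J l' ≠ J l) : ∫ ω, letterProd a kd J s ω ∂μ = 0 := by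
  have hsplit : ∀ ω, letterProd a kd J s ω =
      conjIf (kd l) (a (J l) ω) * letterProd a kd J (s.erase l) ω :=
    fun ω => (Finset.mul_prod_erase _ _ hl).symm
  have hd : Disjoint ({J l} : Set ℤ) (J '' {l' | l' ∈ s ∧ l' ≠ l}) := by
    rw [Set.disjoint_singleton_left]
    rintro ⟨l', ⟨h1, h2⟩, h3⟩
    exact h l' h1 h2 h3
  have h0 : ∫ ω, conjIf (kd l) (a (J l) ω) ∂μ = 0 := by
    rw [integral_conjIf, ha.mean]
    cases kd l <;> simp [conjIf]
  have hm : Measurable[entrySigma a {J l}] (fun ω => conjIf (kd l) (a (J l) ω)) :=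
    (measurable_conjIf (kd l)).comp (measurable_entrySigma a rfl)
  simp only [hsplit]
  rw [ha.integral_mul hd hm (measurable_letterProd _ fun l' hl' =>
      ⟨l', ⟨(Finset.mem_erase.1 hl').2, (Finset.mem_erase.1 hl').1⟩, rfl⟩), h0, zero_mul]

/-- A label used only once makes the mean of its own circuit product vanish, so that the centring of
this circuit is void. The entry then splits off as an independent factor of mean zero. -/
theorem devMean_eq_zero_of_unique (ha : IsEntryFamily mom μ a) {S : Finset ι} {l : L}
    (hl : circ l ∈ S) (h : ∀ l', circ l' ∈ S → l' ≠ l → J l' ≠ J l) :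
    devMean μ a circ kd J S = 0 := by
  have hsplit : ∀ ω, letterProd a kd J (lettersOf circ (circ l)) ω =
      conjIf (kd l) (a (J l) ω) * letterProd a kd J ((lettersOf circ (circ l)).erase l) ω :=
    fun ω => (Finset.mul_prod_erase _ _ (mem_lettersOf.2 rfl)).symm
  set T : Set ℤ := J '' {l' | circ l' ∈ S ∧ l' ≠ l}
  have hd : Disjoint ({J l} : Set ℤ) T := by
    rw [Set.disjoint_singleton_left]
    rintro ⟨l', ⟨h1, h2⟩, h3⟩
    exact h l' h1 h2 h3
  have hm : Measurable[entrySigma a {J l}] (fun ω => conjIf (kd l) (a (J l) ω)) :=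
    (measurable_conjIf (kd l)).comp (measurable_entrySigma a rfl)
  have hm1 : Measurable[entrySigma a T]
      (letterProd a kd J ((lettersOf circ (circ l)).erase l)) := by
    refine measurable_letterProd _ fun l' hl' => ⟨l', ⟨?_, (Finset.mem_erase.1 hl').1⟩, rfl⟩
    rw [mem_lettersOf.1 (Finset.mem_erase.1 hl').2]
    exact hl
  have hm2 : Measurable[entrySigma a T]
      (fun ω => ∏ i ∈ S.erase (circ l), circDev μ a circ kd J i ω) := by
    refine measurable_prod_circDev _ fun l' hl' => ⟨l', ⟨(Finset.mem_erase.1 hl').2, ?_⟩, rfl⟩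
    rintro rfl
    exact (Finset.mem_erase.1 hl').1 rfl
  have h0 : ∫ ω, conjIf (kd l) (a (J l) ω) ∂μ = 0 := by
    rw [integral_conjIf, ha.mean]
    cases kd l <;> simp [conjIf]
  have hmean : ∫ ω, letterProd a kd J (lettersOf circ (circ l)) ω ∂μ = 0 :=
    integral_letterProd_eq_zero_of_unique ha (mem_lettersOf.2 rfl) fun l' hl' =>
      h l' (by rwa [mem_lettersOf.1 hl'])
  unfold devMean
  simp only [← Finset.mul_prod_erase S _ hl]
  have e : ∀ ω, circDev μ a circ kd J (circ l) ω = conjIf (kd l) (a (J l) ω) *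
      letterProd a kd J ((lettersOf circ (circ l)).erase l) ω := fun ω => by
    rw [circDev, hmean, sub_zero, hsplit]
  simp only [e, mul_assoc]
  have hm3 : Measurable[entrySigma a T] (fun ω =>
      letterProd a kd J ((lettersOf circ (circ l)).erase l) ω *
        ∏ i ∈ S.erase (circ l), circDev μ a circ kd J i ω) := Measurable.mul hm1 hm2
  rw [ha.integral_mul hd hm hm3, h0, zero_mul]

/-- A product is at most a power of its largest factor. This reduces bounds for products of entries
to uniform moment bounds for single entries, whether or not their labels coincide. -/
theorem prod_le_one_add_sum_pow {κ : Type*} (s : Finset κ) {x : κ → ℝ} (hx : ∀ i ∈ s, 0 ≤ x i) :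
    ∏ i ∈ s, x i ≤ 1 + ∑ i ∈ s, x i ^ s.card := by
  rcases s.eq_empty_or_nonempty with rfl | hs
  · simp
  · obtain ⟨i0, hi0, hmax⟩ := s.exists_max_image x hs
    calc ∏ i ∈ s, x i ≤ x i0 ^ s.card := (Finset.prod_le_prod hx hmax).trans (by simp)
      _ ≤ ∑ i ∈ s, x i ^ s.card :=
        Finset.single_le_sum (f := fun i => x i ^ s.card)
          (fun i hi => pow_nonneg (hx i hi) _) hi0
      _ ≤ _ := by linarith

theorem IsEntryFamily.exists_letterProd_bound (ha : IsEntryFamily mom μ a) (q : ℕ) :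
    ∃ K : ℝ, 0 ≤ K ∧ ∀ (J : L → ℤ) (s : Finset L),
      ∫ ω, ‖letterProd a kd J s ω‖ ^ q ∂μ ≤ K := by
  choose C hC using fun k => ha.bounded k
  have hC0 : ∀ k, 0 ≤ C k := fun k =>
    (integral_nonneg fun ω => pow_nonneg (norm_nonneg _) _).trans (hC k 0)
  -- Summing over all sets of letters makes the bound uniform in s.
  refine ⟨∑ s : Finset L, (1 + ∑ l ∈ s, C (q * s.card)), ?_, fun J s => ?_⟩
  · exact Finset.sum_nonneg fun s _ => add_nonneg zero_le_one (Finset.sum_nonneg fun _ _ => hC0 _)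
  · refine le_trans ?_ (Finset.single_le_sum (f := fun s : Finset L => 1 + ∑ l ∈ s, C (q * s.card))
      (fun s _ => add_nonneg zero_le_one (Finset.sum_nonneg fun _ _ => hC0 _)) (Finset.mem_univ s))
    have h1 : ∀ ω, ‖letterProd a kd J s ω‖ ^ q ≤ 1 + ∑ l ∈ s, ‖a (J l) ω‖ ^ (q * s.card) := by
      intro ω
      rw [letterProd, norm_prod, ← Finset.prod_pow]
      simp only [norm_conjIf, pow_mul]
      exact prod_le_one_add_sum_pow s fun l _ => by positivity
    have hint : ∀ l ∈ s, Integrable (fun ω => ‖a (J l) ω‖ ^ (q * s.card)) μ :=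
      fun l _ => (ha.hasMoments _).integrable_norm_pow _
    refine (integral_mono ((ha.hasMoments_letterProd s).integrable_norm_pow q)
      ((integrable_const (1 : ℝ)).add (integrable_finsetSum s hint)) h1).trans ?_
    rw [integral_add' (integrable_const _) (integrable_finsetSum s hint), integral_finsetSum s hint]
    simp only [integral_const, probReal_univ, smul_eq_mul, mul_one]
    exact add_le_add le_rfl (Finset.sum_le_sum fun l _ => hC _ _)

theorem IsEntryFamily.exists_devMean_bound (ha : IsEntryFamily mom μ a) (circ : L → ι)
    (kd : L → Bool) : ∃ K : ℝ, 0 ≤ K ∧ ∀ (J : L → ℤ) (S : Finset ι),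
      ‖devMean μ a circ kd J S‖ ≤ K := by
  choose C hC0 hC using fun q => ha.exists_letterProd_bound (kd := kd) q
  have hpos : ∀ S : Finset ι, 0 ≤ 1 + ∑ i ∈ S, 2 ^ S.card * (C S.card + C 1 ^ S.card) :=
    fun S => add_nonneg zero_le_one (Finset.sum_nonneg fun _ _ =>
      mul_nonneg (by positivity) (add_nonneg (hC0 _) (pow_nonneg (hC0 _) _)))
  refine ⟨∑ S : Finset ι, (1 + ∑ i ∈ S, 2 ^ S.card * (C S.card + C 1 ^ S.card)),
    Finset.sum_nonneg fun S _ => hpos S, fun J S => ?_⟩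
  refine le_trans ?_ (Finset.single_le_sum (fun S _ => hpos S) (Finset.mem_univ S))
  refine (norm_integral_le_integral_norm _).trans ?_
  have hb : ∀ i ω, ‖circDev μ a circ kd J i ω‖ ^ S.card ≤
      2 ^ S.card * (‖letterProd a kd J (lettersOf circ i) ω‖ ^ S.card + C 1 ^ S.card) := by
    intro i ω
    have h1 : ‖circDev μ a circ kd J i ω‖ ≤
        ‖letterProd a kd J (lettersOf circ i) ω‖ + C 1 := by
      refine (norm_sub_le _ _).trans (add_le_add le_rfl ?_)
      refine (norm_integral_le_integral_norm _).trans ?_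
      simpa using hC 1 J (lettersOf circ i)
    calc _ ≤ (‖letterProd a kd J (lettersOf circ i) ω‖ + C 1) ^ S.card :=
          pow_le_pow_left₀ (norm_nonneg _) h1 _
      _ ≤ 2 ^ (S.card - 1) * (‖letterProd a kd J (lettersOf circ i) ω‖ ^ S.card +
          C 1 ^ S.card) := add_pow_le (norm_nonneg _) (hC0 1) _
      _ ≤ _ := by
        gcongr
        · have := hC0 1; positivity
        · norm_num
        · omega
  have h1 : ∀ ω, ‖∏ i ∈ S, circDev μ a circ kd J i ω‖ ≤ 1 + ∑ i ∈ S,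
      2 ^ S.card * (‖letterProd a kd J (lettersOf circ i) ω‖ ^ S.card + C 1 ^ S.card) := by
    intro ω
    rw [norm_prod]
    exact (prod_le_one_add_sum_pow S fun i _ => norm_nonneg _).trans
      (add_le_add le_rfl (Finset.sum_le_sum fun i _ => hb i ω))
  have hint : ∀ i ∈ S, Integrable (fun ω => (2 : ℝ) ^ S.card *
      (‖letterProd a kd J (lettersOf circ i) ω‖ ^ S.card + C 1 ^ S.card)) μ := fun i _ =>
    (((ha.hasMoments_letterProd _).integrable_norm_pow _).add (integrable_const _)).const_mul _
  refine (integral_mono (HasMoments.prod fun i _ => ha.hasMoments_circDev i).integrable.norm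
    ((integrable_const (1 : ℝ)).add (integrable_finsetSum S hint)) h1).trans ?_
  rw [integral_add' (integrable_const _) (integrable_finsetSum S hint), integral_finsetSum S hint]
  simp only [integral_const, probReal_univ, smul_eq_mul, mul_one]
  refine add_le_add le_rfl (Finset.sum_le_sum fun i _ => ?_)
  rw [integral_const_mul, integral_add ((ha.hasMoments_letterProd _).integrable_norm_pow _)
    (integrable_const _)]
  simp only [integral_const, probReal_univ, smul_eq_mul, one_mul]
  gcongr
  exact hC _ _ _

/-- The defect in the Wick recursion at a labeling. -/
noncomputable def wickDefect (μ : Measure Ω) (a : ℤ → Ω → 𝕜) (circ : L → ι) (kd : L → Bool)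
    (i0 : ι) (J : L → ℤ) : 𝕜 :=
  devMean μ a circ kd J Finset.univ - ∑ j ∈ Finset.univ.erase i0,
    devMean μ a circ kd J {i0, j} * devMean μ a circ kd J (Finset.univ \ {i0, j})

theorem IsEntryFamily.exists_wickDefect_bound (ha : IsEntryFamily mom μ a) (circ : L → ι)
    (kd : L → Bool) (i0 : ι) : ∃ K : ℝ, 0 ≤ K ∧ ∀ J : L → ℤ,
      ‖wickDefect μ a circ kd i0 J‖ ≤ K := by
  obtain ⟨K, hK0, hK⟩ := ha.exists_devMean_bound circ kd
  refine ⟨K + ∑ j ∈ Finset.univ.erase i0, K * K, by positivity, fun J => ?_⟩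
  refine (norm_sub_le _ _).trans (add_le_add (hK _ _) ((norm_sum_le _ _).trans ?_))
  refine Finset.sum_le_sum fun j _ => ?_
  rw [norm_mul]
  exact mul_le_mul (hK _ _) (hK _ _) (norm_nonneg _) hK0

theorem wickDefect_eq_zero_of_not_isRepeating (ha : IsEntryFamily mom μ a) {i0 : ι}
    (h : ¬ IsRepeating J) : wickDefect μ a circ kd i0 J = 0 := by
  unfold IsRepeating at h
  push Not at h
  obtain ⟨l, hl⟩ := h
  rw [wickDefect, devMean_eq_zero_of_unique ha (Finset.mem_univ (circ l)) fun l' _ h' => hl l' h',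
    zero_sub, neg_eq_zero]
  refine Finset.sum_eq_zero fun j _ => ?_
  by_cases hj : circ l ∈ ({i0, j} : Finset ι)
  · rw [devMean_eq_zero_of_unique ha hj fun l' _ h' => hl l' h', zero_mul]
  · rw [devMean_eq_zero_of_unique ha (S := Finset.univ \ {i0, j}) (l := l) (by simpa using hj)
      fun l' _ h' => hl l' h', mul_zero]

theorem wickDefect_eq_zero_of_not_isLinking (ha : IsEntryFamily mom μ a) {i0 : ι}
    (h : ¬ IsLinking circ J) : wickDefect μ a circ kd i0 J = 0 := by
  unfold IsLinking at h
  push Not at h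
  obtain ⟨i, hi⟩ := h
  have hi' : ∀ l l', circ l = i → circ l' ≠ i → J l ≠ J l' := hi
  rw [wickDefect, devMean_eq_zero_of_not_linked ha (Finset.mem_univ i)
    fun l l' h1 _ h2 => hi' l l' h1 h2, zero_sub, neg_eq_zero]
  refine Finset.sum_eq_zero fun j _ => ?_
  by_cases hj : i ∈ ({i0, j} : Finset ι)
  · rw [devMean_eq_zero_of_not_linked ha hj fun l l' h1 _ h2 => hi' l l' h1 h2, zero_mul]
  · rw [devMean_eq_zero_of_not_linked ha (S := Finset.univ \ {i0, j}) (i := i) (by simpa using hj)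
      fun l l' h1 _ h2 => hi' l l' h1 h2, mul_zero]

/-- If the cluster of `i0` is {i0, j}, these two circuits are independent of all the others, so the
full expectation equals the term of j. For any other j' the circuit `i0` is not linked to j', so
that term vanishes. -/
theorem wickDefect_eq_zero_of_card_cluster (ha : IsEntryFamily mom μ a) {i0 : ι}
    (h : (cluster circ J i0).card = 2) : wickDefect μ a circ kd i0 J = 0 := by
  obtain ⟨j, hj⟩ : ∃ j, (cluster circ J i0).erase i0 = {j} := by
    rw [← Finset.card_eq_one, Finset.card_erase_of_mem (self_mem_cluster circ J i0), h]
  have hcl : cluster circ J i0 = {i0, j} := by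
    rw [← Finset.insert_erase (self_mem_cluster circ J i0), hj]
  have hj0 : j ≠ i0 := by
    have : j ∈ (cluster circ J i0).erase i0 := by rw [hj]; exact Finset.mem_singleton_self j
    exact (Finset.mem_erase.1 this).1
  rw [wickDefect, Finset.sum_eq_single j, sub_eq_zero, ← devMean_mul ha Finset.disjoint_sdiff,
    Finset.union_sdiff_of_subset (Finset.subset_univ _)]
  · intro l l' hl hl' he
    rw [← hcl, circ_mem_cluster_iff he, hcl] at hl
    exact (Finset.mem_sdiff.1 hl').2 hl
  · intro j' hj' hne
    rw [devMean_eq_zero_of_not_linked ha (Finset.mem_insert_self i0 {j'}), zero_mul]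
    intro l l' h1 h2 h3 he
    have h4 : circ l' ∈ cluster circ J i0 := by
      rw [← circ_mem_cluster_iff he, h1]
      exact self_mem_cluster circ J i0
    rw [hcl] at h4
    simp only [Finset.mem_insert, Finset.mem_singleton, h3, false_or] at h2 h4
    exact hne (h2.symm.trans h4)
  · intro hj'
    exact absurd (Finset.mem_erase.2 ⟨hj0, Finset.mem_univ j⟩) hj'

/-- The Wick recursion holds exactly except at labelings covered by
`exists_card_large_cluster_le`. -/
theorem isRepeating_of_wickDefect_ne_zero (ha : IsEntryFamily mom μ a) {i0 : ι}
    (h : wickDefect μ a circ kd i0 J ≠ 0) :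
    IsRepeating J ∧ IsLinking circ J ∧ 3 ≤ (cluster circ J i0).card := by
  have h1 : IsRepeating J := by
    by_contra h'; exact h (wickDefect_eq_zero_of_not_isRepeating ha h')
  have h2 : IsLinking circ J := by
    by_contra h'; exact h (wickDefect_eq_zero_of_not_isLinking ha h')
  refine ⟨h1, h2, ?_⟩
  have h3 := two_le_card_cluster h2 i0
  have h4 : (cluster circ J i0).card ≠ 2 := fun h' => h (wickDefect_eq_zero_of_card_cluster ha h')
  omega

end CircuitProducts

end Probability

/-! ### The Wick recursion for sums over closed words -/

section Wick

variable {𝕜 : Type*} [RCLike 𝕜] {Ω : Type*} [MeasurableSpace Ω] {μ : Measure Ω}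
  [IsProbabilityMeasure μ] {ι : Type} [Fintype ι] [DecidableEq ι]

/-- On the product space the product of two expectations becomes a single integral of a product over
all indices, to which multilinear expansion applies directly. -/
theorem integral_prod_mul_integral_prod_compl (G : ι → Ω → 𝕜) (R : Finset ι) :
    (∫ ω, ∏ i ∈ R, G i ω ∂μ) * ∫ ω, ∏ i ∈ Finset.univ \ R, G i ω ∂μ =
      ∫ z : Ω × Ω, ∏ i, (if i ∈ R then G i z.1 else G i z.2) ∂(μ.prod μ) := by
  rw [← integral_prod_mul]
  refine integral_congr_ae (Eventually.of_forall fun z => ?_)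
  simp only [Finset.prod_ite, Finset.filter_mem_eq_inter, Finset.univ_inter]
  congr 2
  ext i
  simp

theorem integrable_prod_ite {G : ι → Ω → 𝕜} (hG : ∀ i, HasMoments (G i) μ) (R : Finset ι) :
    Integrable (fun z : Ω × Ω => ∏ i, (if i ∈ R then G i z.1 else G i z.2)) (μ.prod μ) := by
  have := (HasMoments.prod (s := R) fun i _ => hG i).integrable.mul_prod
    (HasMoments.prod (s := Finset.univ \ R) fun i _ => hG i).integrable
  refine this.congr (Eventually.of_forall fun z => ?_)
  simp only [Finset.prod_ite, Finset.filter_mem_eq_inter, Finset.univ_inter]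
  congr 2
  ext i
  simp

/-- Products of two expectations of complementary subproducts are multilinear. -/
theorem integral_prod_sum_mul {κ : ι → Type*} (t : ∀ i, Finset (κ i)) {Z : ∀ i, κ i → Ω → 𝕜}
    (hZ : ∀ i k, HasMoments (Z i k) μ) (R : Finset ι) :
    (∫ ω, ∏ i ∈ R, ∑ k ∈ t i, Z i k ω ∂μ) *
      ∫ ω, ∏ i ∈ Finset.univ \ R, ∑ k ∈ t i, Z i k ω ∂μ =
      ∑ f ∈ Fintype.piFinset t, (∫ ω, ∏ i ∈ R, Z i (f i) ω ∂μ) *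
        ∫ ω, ∏ i ∈ Finset.univ \ R, Z i (f i) ω ∂μ := by
  rw [integral_prod_mul_integral_prod_compl (fun i ω => ∑ k ∈ t i, Z i k ω)]
  simp only [integral_prod_mul_integral_prod_compl (fun i ω => Z i _ ω)]
  rw [← integral_finsetSum _ fun f _ => integrable_prod_ite (fun i => hZ i (f i)) R]
  refine integral_congr_ae (Eventually.of_forall fun z => ?_)
  simp only
  rw [← Finset.prod_univ_sum t (fun i k => if i ∈ R then Z i k z.1 else Z i k z.2)]
  refine Finset.prod_congr rfl fun i _ => ?_
  split_ifs <;> rfl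

/-- The defect of the Wick recursion for a family of random variables. -/
noncomputable def wickBracket (μ : Measure Ω) (i0 : ι) (G : ι → Ω → 𝕜) : 𝕜 :=
  ∫ ω, ∏ i, G i ω ∂μ - ∑ j ∈ Finset.univ.erase i0,
    (∫ ω, ∏ i ∈ {i0, j}, G i ω ∂μ) * ∫ ω, ∏ i ∈ Finset.univ \ {i0, j}, G i ω ∂μ

theorem wickBracket_sum {κ : ι → Type*} (t : ∀ i, Finset (κ i)) {Z : ∀ i, κ i → Ω → 𝕜}
    (hZ : ∀ i k, HasMoments (Z i k) μ) (i0 : ι) :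
    wickBracket μ i0 (fun i ω => ∑ k ∈ t i, Z i k ω) =
      ∑ f ∈ Fintype.piFinset t, wickBracket μ i0 (fun i => Z i (f i)) := by
  unfold wickBracket
  rw [Finset.sum_sub_distrib, Finset.sum_comm]
  congr 1
  · simpa using integral_prod_sum_mul t hZ Finset.univ
  · exact Finset.sum_congr rfl fun j _ => integral_prod_sum_mul t hZ {i0, j}

theorem wickBracket_const_mul (c : ι → 𝕜) (i0 : ι) (G : ι → Ω → 𝕜) :
    wickBracket μ i0 (fun i ω => c i * G i ω) = (∏ i, c i) * wickBracket μ i0 G := by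
  unfold wickBracket
  simp only [Finset.prod_mul_distrib, integral_const_mul, mul_sub, Finset.mul_sum]
  congr 1
  refine Finset.sum_congr rfl fun j _ => ?_
  rw [← Finset.prod_sdiff (Finset.subset_univ ({i0, j} : Finset ι))]
  ring

/-- For a single random variable all k + 1 choices of the partner of index 0 contribute equally,
which turns the bracket into the defect of the Gaussian moment recursion. -/
theorem wickBracket_const (k : ℕ) (Y : Ω → 𝕜) :
    wickBracket μ (0 : Fin (k + 2)) (fun _ => Y) =
      ∫ ω, Y ω ^ (k + 2) ∂μ - (k + 1) * (∫ ω, Y ω ^ 2 ∂μ) * ∫ ω, Y ω ^ k ∂μ := by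
  unfold wickBracket
  simp only [Finset.prod_const, Finset.card_univ, Fintype.card_fin]
  congr 1
  have : ∀ j ∈ (Finset.univ : Finset (Fin (k + 2))).erase 0,
      (∫ ω, Y ω ^ ({0, j} : Finset (Fin (k + 2))).card ∂μ) *
        ∫ ω, Y ω ^ (Finset.univ \ ({0, j} : Finset (Fin (k + 2)))).card ∂μ =
      (∫ ω, Y ω ^ 2 ∂μ) * ∫ ω, Y ω ^ k ∂μ := by
    intro j hj
    have h2 : ({0, j} : Finset (Fin (k + 2))).card = 2 :=
      Finset.card_pair (Finset.mem_erase.1 hj).1.symm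
    rw [Finset.card_sdiff_of_subset (Finset.subset_univ _), h2, Finset.card_univ, Fintype.card_fin]
    rfl
  rw [Finset.sum_congr rfl this, Finset.sum_const, Finset.card_erase_of_mem (Finset.mem_univ _),
    Finset.card_univ, Fintype.card_fin, nsmul_eq_mul, mul_assoc]
  push_cast
  ring

/-- The centred product of the entries along a word. -/
noncomputable def wordDev (μ : Measure Ω) (a : ℤ → Ω → 𝕜) {N : ℕ} (kd : Fin N → Bool)
    (y : Fin N → ℤ) (ω : Ω) : 𝕜 :=
  letterProd a kd y Finset.univ ω - ∫ ω', letterProd a kd y Finset.univ ω' ∂μ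

variable {mom : ℕ → ℕ → ℝ} {a : ℤ → Ω → 𝕜}

theorem IsEntryFamily.hasMoments_wordDev (ha : IsEntryFamily mom μ a) {N : ℕ} (kd : Fin N → Bool)
    (y : Fin N → ℤ) : HasMoments (wordDev μ a kd y) μ :=
  (ha.hasMoments_letterProd _).sub (HasMoments.const _)

section Sigma

variable {N : ι → ℕ}

theorem lettersOf_fst_eq (i : ι) :
    lettersOf (Sigma.fst : (Σ i, Fin (N i)) → ι) i =
      Finset.univ.map ⟨Sigma.mk i, sigma_mk_injective⟩ := by
  ext ⟨j, l⟩
  simp only [mem_lettersOf, Finset.mem_map, Finset.mem_univ, true_and, Function.Embedding.coeFn_mk]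
  constructor
  · rintro rfl
    exact ⟨l, rfl⟩
  · rintro ⟨l', h⟩
    exact (congrArg Sigma.fst h).symm

theorem circDev_sigma (kd : ∀ i, Fin (N i) → Bool) (f : ∀ i, Fin (N i) → ℤ) (i : ι) :
    circDev μ a Sigma.fst (fun l : Σ i, Fin (N i) => kd l.1 l.2) (fun l => f l.1 l.2) i =
      wordDev μ a (kd i) (f i) := by
  funext ω
  simp only [circDev, wordDev, letterProd, lettersOf_fst_eq, Finset.prod_map,
    Function.Embedding.coeFn_mk]

/-- The Wick recursion for weighted sums over closed words, with an error of lower order. -/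
theorem IsEntryFamily.exists_wickBracket_le (ha : IsEntryFamily mom μ a)
    (hN : ∀ i, Even (N i)) (kd : ∀ i, Fin (N i) → Bool) (sgn : ∀ i, Fin (N i) → ℤ)
    (hs : ∀ i l, Odd (sgn i l)) (i0 : ι) :
    ∃ C : ℝ, 0 ≤ C ∧ ∀ m : ℕ, 1 ≤ m → ∀ (T : ∀ i, Finset (Fin (N i) → ℤ)),
      (∀ i, ∀ y ∈ T i, (∀ l, |y l| ≤ m) ∧ ∑ l, sgn i l * y l = 0) →
      ∀ (w : ∀ i, (Fin (N i) → ℤ) → 𝕜) (W : ι → ℝ), (∀ i y, ‖w i y‖ ≤ W i) →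
      ‖wickBracket μ i0 (fun i ω => ∑ y ∈ T i, w i y * wordDev μ a (kd i) y ω)‖ *
        √m ^ (Fintype.card ι + 1) ≤ C * (∏ i, W i) * √m ^ ∑ i, N i := by
  classical
  set kd' : (Σ i, Fin (N i)) → Bool := fun l => kd l.1 l.2 with hkd
  set sgn' : (Σ i, Fin (N i)) → ℤ := fun l => sgn l.1 l.2 with hsgn
  have hcirc : ∀ i, Even (Finset.univ.filter fun l : Σ i, Fin (N i) => l.1 = i).card := by
    intro i
    have := lettersOf_fst_eq (N := N) i
    unfold lettersOf at this
    rw [this, Finset.card_map, Finset.card_univ, Fintype.card_fin]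
    exact hN i
  obtain ⟨K, hK0, hK⟩ := ha.exists_wickDefect_bound Sigma.fst kd' i0
  obtain ⟨C, hC0, hC⟩ := exists_card_large_cluster_le (Sigma.fst : (Σ i, Fin (N i)) → ι)
    (sgn := sgn') (fun l => hs l.1 l.2) hcirc i0
  refine ⟨K * C, by positivity, fun m hm T hT w W hW => ?_⟩
  have hW0 : ∀ i, 0 ≤ W i := fun i => (norm_nonneg _).trans (hW i 0)
  rw [wickBracket_sum T fun i y => (HasMoments.const (w i y)).mul (ha.hasMoments_wordDev _ _)]
  have hterm : ∀ f : ∀ i, Fin (N i) → ℤ,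
      wickBracket μ i0 (fun i ω => w i (f i) * wordDev μ a (kd i) (f i) ω) =
      (∏ i, w i (f i)) * wickDefect μ a Sigma.fst kd' i0 (fun l => f l.1 l.2) := by
    intro f
    rw [wickBracket_const_mul (fun i => w i (f i)) i0 (fun i => wordDev μ a (kd i) (f i))]
    simp only [wickBracket, wickDefect, devMean, hkd, circDev_sigma]
  simp only [hterm]
  set unc : (∀ i, Fin (N i) → ℤ) → ((Σ i, Fin (N i)) → ℤ) := fun f l => f l.1 l.2 with hunc
  have hinj : Function.Injective unc := by
    intro f g h
    funext i l
    exact congrFun h ⟨i, l⟩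
  -- Only these families of words contribute; glued to labelings of the disjoint union, they are
  -- counted by `exists_card_large_cluster_le`.
  set B := (Fintype.piFinset T).filter fun f => wickDefect μ a Sigma.fst kd' i0 (unc f) ≠ 0 with hB
  have h1 : ‖∑ f ∈ Fintype.piFinset T,
      (∏ i, w i (f i)) * wickDefect μ a Sigma.fst kd' i0 (unc f)‖ ≤
      B.card * ((∏ i, W i) * K) := by
    rw [← Finset.sum_filter_of_ne (p := fun f => wickDefect μ a Sigma.fst kd' i0 (unc f) ≠ 0)
      fun f _ hf => right_ne_zero_of_mul hf, ← nsmul_eq_mul]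
    refine (norm_sum_le _ _).trans (Finset.sum_le_card_nsmul _ _ _ fun f _ => ?_)
    rw [norm_mul, norm_prod]
    exact mul_le_mul (Finset.prod_le_prod (fun _ _ => norm_nonneg _) fun i _ => hW i _) (hK _)
      (norm_nonneg _) (Finset.prod_nonneg fun i _ => hW0 i)
  have h2 := hC m hm (B.image unc) (fun J hJ => by
    obtain ⟨f, hf, rfl⟩ := Finset.mem_image.1 hJ
    obtain ⟨hf1, hf2⟩ := Finset.mem_filter.1 hf
    rw [Fintype.mem_piFinset] at hf1
    obtain ⟨a1, a2, a3⟩ := isRepeating_of_wickDefect_ne_zero ha hf2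
    refine ⟨mem_labelBox.2 fun l => (hT l.1 _ (hf1 l.1)).1 l.2, fun i => ?_, a1, a2, a3⟩
    have := lettersOf_fst_eq (N := N) i
    unfold lettersOf at this
    rw [this, Finset.sum_map]
    exact (hT i _ (hf1 i)).2)
  rw [Finset.card_image_of_injective _ hinj, Fintype.card_sigma] at h2
  simp only [Fintype.card_fin] at h2
  have hWK : 0 ≤ (∏ i, W i) * K := mul_nonneg (Finset.prod_nonneg fun i _ => hW0 i) hK0
  calc _ ≤ (B.card * ((∏ i, W i) * K)) * √m ^ (Fintype.card ι + 1) := by gcongr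
    _ = (B.card * √m ^ (Fintype.card ι + 1)) * ((∏ i, W i) * K) := by ring
    _ ≤ (C * √m ^ ∑ i, N i) * ((∏ i, W i) * K) := by gcongr
    _ = _ := by ring

end Sigma

/-- The Wick recursion for a combination of weighted sums over closed words, with the natural
normalisation. -/
theorem IsEntryFamily.tendsto_wick (ha : IsEntryFamily mom μ a) {N : ℕ → ℕ}
    (hN : ∀ p, Even (N p)) (kd : ∀ p, Fin (N p) → Bool) (sgn : ∀ p, Fin (N p) → ℤ)
    (hs : ∀ p l, Odd (sgn p l)) {m : ℕ → ℕ} (hm : Tendsto m atTop atTop) (D : ℕ)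
    (T : ∀ (_ p : ℕ), Finset (Fin (N p) → ℤ))
    (hT : ∀ n p, ∀ y ∈ T n p, (∀ l, |y l| ≤ m n) ∧ ∑ l, sgn p l * y l = 0)
    (w : ∀ (_ p : ℕ), (Fin (N p) → ℤ) → 𝕜) (W : ℝ)
    (hw : ∀ n p y, p ∈ Finset.range D → ‖w n p y‖ ≤ W * √(m n) / √(m n) ^ N p) (k : ℕ) :
    Tendsto (fun n => wickBracket μ (0 : Fin (k + 2)) (fun _ ω =>
      ∑ p ∈ Finset.range D, ∑ y ∈ T n p, w n p y * wordDev μ a (kd p) y ω)) atTop (𝓝 0) := by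
  have hmom : ∀ n p, HasMoments (fun ω => ∑ y ∈ T n p, w n p y * wordDev μ a (kd p) y ω) μ :=
    fun n p => HasMoments.sum fun y _ => (HasMoments.const _).mul (ha.hasMoments_wordDev _ _)
  have hexp : ∀ n, wickBracket μ (0 : Fin (k + 2)) (fun _ ω =>
      ∑ p ∈ Finset.range D, ∑ y ∈ T n p, w n p y * wordDev μ a (kd p) y ω) =
      ∑ f ∈ Fintype.piFinset (fun _ : Fin (k + 2) => Finset.range D),
        wickBracket μ (0 : Fin (k + 2))
          (fun i ω => ∑ y ∈ T n (f i), w n (f i) y * wordDev μ a (kd (f i)) y ω) := fun n =>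
    wickBracket_sum (fun _ : Fin (k + 2) => Finset.range D) (fun _ p => hmom n p) 0
  simp only [hexp]
  rw [show (0 : 𝕜) = ∑ _f ∈ Fintype.piFinset (fun _ : Fin (k + 2) => Finset.range D), (0 : 𝕜) by
    simp]
  refine tendsto_finsetSum (M := 𝕜) _ fun f hf => ?_
  rw [Fintype.mem_piFinset] at hf
  obtain ⟨C, hC0, hC⟩ := ha.exists_wickBracket_le (N := fun i => N (f i)) (fun i => hN (f i))
    (fun i => kd (f i)) (fun i => sgn (f i)) (fun i => hs (f i)) (0 : Fin (k + 2))
  -- The weights contribute at most W^(k+2) √m^(k+2) / √m^(ΣN), the count at most C √m^(ΣN) /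
  -- √m^(k+3); a factor 1/√m is left over.
  have hlim : Tendsto (fun n => C * W ^ (k + 2) / √(m n)) atTop (𝓝 0) :=
    Tendsto.const_div_atTop (Real.tendsto_sqrt_atTop.comp
      (tendsto_natCast_atTop_atTop.comp hm)) _
  refine squeeze_zero_norm' ?_ hlim
  filter_upwards [hm.eventually_ge_atTop 1] with n hn
  have hpos : 0 < √(m n : ℝ) := Real.sqrt_pos.2 (by exact_mod_cast hn)
  set v : ∀ i : Fin (k + 2), (Fin (N (f i)) → ℤ) → 𝕜 := fun i y => w n (f i) y
  have h1 := hC (m n) hn (fun i => T n (f i)) (fun i => hT n (f i)) v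
    (fun i => W * √(m n) / √(m n) ^ N (f i)) (fun i y => hw n (f i) y (hf i))
  rw [Finset.prod_div_distrib, Finset.prod_pow_eq_pow_sum, Finset.prod_const, Finset.card_univ,
    Fintype.card_fin, mul_assoc, div_mul_cancel₀ _ (by positivity), mul_pow, pow_succ √(m n : ℝ),
    ← mul_assoc, ← mul_assoc, mul_right_comm] at h1
  have h2 := le_of_mul_le_mul_right h1 (by positivity)
  rw [le_div_iff₀ hpos]
  exact h2

end Wick

/-! ### Riemann sums and generic linear conditions -/

section RiemannSums

variable {ι : Type} [Fintype ι] [DecidableEq ι]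

/-- The cell of the lattice of mesh `1 / m` with a given corner. -/
def latticeCell (m : ℕ) (y : ι → ℤ) : Set (ι → ℝ) :=
  Set.univ.pi fun i => Set.Ico ((y i : ℝ) / m) ((y i + 1 : ℝ) / m)

theorem measurableSet_latticeCell (m : ℕ) (y : ι → ℤ) : MeasurableSet (latticeCell m y) :=
  MeasurableSet.univ_pi fun _ => measurableSet_Ico

theorem mem_latticeCell {m : ℕ} (hm : 1 ≤ m) {y : ι → ℤ} {u : ι → ℝ} :
    u ∈ latticeCell m y ↔ (fun i => ⌊(m : ℝ) * u i⌋) = y := by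
  have hm0 : (0 : ℝ) < m := by exact_mod_cast hm
  simp only [latticeCell, Set.mem_univ_pi, Set.mem_Ico, funext_iff, Int.floor_eq_iff,
    div_le_iff₀' hm0, lt_div_iff₀' hm0]

theorem volume_real_latticeCell {m : ℕ} (hm : 1 ≤ m) (y : ι → ℤ) :
    volume.real (latticeCell m y) = ((m : ℝ) ^ Fintype.card ι)⁻¹ := by
  have hm0 : (0 : ℝ) < m := by exact_mod_cast hm
  have h : ∀ i, ((y i + 1 : ℝ) / m) - (y i : ℝ) / m = (m : ℝ)⁻¹ := fun i => by field_simp; ring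
  rw [measureReal_def, latticeCell, Real.volume_pi_Ico]
  simp only [h, Finset.prod_const, Finset.card_univ]
  rw [ENNReal.toReal_pow, ENNReal.toReal_ofReal (by positivity), inv_pow]

theorem sum_indicator_latticeCell {m : ℕ} (hm : 1 ≤ m) (B : Finset (ι → ℤ)) (f : (ι → ℤ) → ℝ)
    (u : ι → ℝ) :
    ∑ y ∈ B, (latticeCell m y).indicator (fun _ => f y) u =
      if (fun i => ⌊(m : ℝ) * u i⌋) ∈ B then f (fun i => ⌊(m : ℝ) * u i⌋) else 0 := by
  classical
  simp only [Set.indicator_apply, mem_latticeCell hm]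
  rw [Finset.sum_ite_eq B (fun i => ⌊(m : ℝ) * u i⌋) f]

/-- Convergence of Riemann sums of bounded functions that converge almost everywhere. -/
theorem tendsto_riemann_sum {m : ℕ → ℕ} (hm : Tendsto m atTop atTop) {h : ℕ → (ι → ℤ) → ℝ}
    {C : ℝ} (hC : ∀ n y, |h n y| ≤ C) {H : (ι → ℝ) → ℝ}
    (hH : ∀ᵐ u : ι → ℝ, Tendsto (fun n => h n fun i => ⌊(m n : ℝ) * u i⌋) atTop (𝓝 (H u))) :
    Tendsto (fun n => (∑ y ∈ labelBox ι (m n), h n y) / (m n : ℝ) ^ Fintype.card ι) atTop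
      (𝓝 (∫ u in Set.univ.pi fun _ : ι => Set.Icc (-1 : ℝ) 1, H u)) := by
  have hC0 : 0 ≤ C := (abs_nonneg _).trans (hC 0 0)
  have hmeas : MeasurableSet (Set.univ.pi fun _ : ι => Set.Icc (-1 : ℝ) 1) :=
    MeasurableSet.univ_pi fun _ => measurableSet_Icc
  have hmeas2 : MeasurableSet (Set.univ.pi fun _ : ι => Set.Icc (-2 : ℝ) 2) :=
    MeasurableSet.univ_pi fun _ => measurableSet_Icc
  rw [← integral_indicator hmeas]
  -- The normalised sum is the integral of this step function, so dominated convergence applies.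
  set F : ℕ → (ι → ℝ) → ℝ := fun n u =>
    ∑ y ∈ labelBox ι (m n), (latticeCell (m n) y).indicator (fun _ => h n y) u with hF
  have hFint : ∀ᶠ n in atTop, ∫ u, F n u =
      (∑ y ∈ labelBox ι (m n), h n y) / (m n : ℝ) ^ Fintype.card ι := by
    filter_upwards [hm.eventually_ge_atTop 1] with n hn
    have hvol := fun y : ι → ℤ => volume_real_latticeCell hn y
    simp only [hF]
    rw [integral_finsetSum]
    · simp only [integral_indicator (measurableSet_latticeCell _ _), integral_const,
        measureReal_restrict_apply_univ, hvol, smul_eq_mul]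
      rw [← Finset.mul_sum, div_eq_inv_mul]
    · intro y _
      refine (integrable_indicator_iff (measurableSet_latticeCell _ _)).2 ?_
      refine integrableOn_const ?_
      rw [latticeCell, Real.volume_pi_Ico]
      exact ENNReal.prod_ne_top fun _ _ => ENNReal.ofReal_ne_top
  have hle : ∀ k : ℕ, 1 ≤ k → ∀ u : ι → ℝ, (fun i => ⌊(k : ℝ) * u i⌋) ∈ labelBox ι k →
      ∀ i, -1 ≤ u i ∧ (k : ℝ) * u i < k + 1 := by
    intro k hk u hu i
    have hk0 : (0 : ℝ) < k := by exact_mod_cast hk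
    have := abs_le.1 (mem_labelBox.1 hu i)
    constructor
    · have h1 := Int.le_floor.1 this.1
      push_cast at h1
      nlinarith
    · have h2 := Int.floor_lt.1 (Int.lt_add_one_of_le this.2)
      push_cast at h2
      exact h2
  -- The outermost cells reach up to (m + 1)/m ≤ 2, beyond the cube [-1, 1], hence the larger
  -- dominating cube.
  have hbound : ∀ᶠ n in atTop, ∀ᵐ u : ι → ℝ, ‖F n u‖ ≤
      (Set.univ.pi fun _ : ι => Set.Icc (-2 : ℝ) 2).indicator (fun _ => C) u := by
    filter_upwards [hm.eventually_ge_atTop 1] with n hn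
    refine Eventually.of_forall fun u => ?_
    simp only [hF]
    rw [sum_indicator_latticeCell hn]
    split_ifs with hu
    · rw [Set.indicator_of_mem, Real.norm_eq_abs]
      · exact hC _ _
      · intro i _
        obtain ⟨h1, h2⟩ := hle _ hn u hu i
        have hn1 : (1 : ℝ) ≤ m n := by exact_mod_cast hn
        refine ⟨by linarith, ?_⟩
        by_contra hc
        push Not at hc
        nlinarith
    · rw [norm_zero]
      exact Set.indicator_nonneg (fun _ _ => hC0) u
  -- The faces of the cube, where the indicators need not converge, form a null set.
  have hne : ∀ᵐ u : ι → ℝ, ∀ i, u i ≠ 1 ∧ u i ≠ -1 := by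
    rw [ae_all_iff]
    intro i
    have hq : ∀ t : ℝ, ∀ᵐ u : ι → ℝ, u i ≠ t := fun t => by
      have h0 : ∀ᵐ x : ℝ, x ≠ t := by simp [ae_iff]
      exact (Measure.quasiMeasurePreserving_eval (fun _ : ι => (volume : Measure ℝ)) i).ae h0
    exact (hq 1).and (hq (-1))
  have hlim := tendsto_integral_filter_of_dominated_convergence (μ := volume)
    (F := F) (f := (Set.univ.pi fun _ : ι => Set.Icc (-1 : ℝ) 1).indicator H) (l := atTop)
    ((Set.univ.pi fun _ : ι => Set.Icc (-2 : ℝ) 2).indicator fun _ => C) ?_ hbound ?_ ?_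
  · exact hlim.congr' hFint
  · refine Eventually.of_forall fun n => ?_
    exact (Finset.measurable_fun_sum _ fun y _ =>
      measurable_const.indicator (measurableSet_latticeCell _ _)).aestronglyMeasurable
  · refine (integrable_indicator_iff hmeas2).2 (integrableOn_const ?_)
    rw [Set.pi_univ_Icc, Real.volume_Icc_pi]
    exact ENNReal.prod_ne_top fun _ _ => ENNReal.ofReal_ne_top
  · filter_upwards [hH, hne] with u hu hne
    by_cases hin : ∀ i, |u i| < 1
    · have hmem : u ∈ Set.univ.pi fun _ : ι => Set.Icc (-1 : ℝ) 1 :=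
        fun i _ => ⟨(abs_lt.1 (hin i)).1.le, (abs_lt.1 (hin i)).2.le⟩
      rw [Set.indicator_of_mem hmem]
      refine hu.congr' ?_
      filter_upwards [hm.eventually_ge_atTop 1] with n hn
      simp only [hF]
      rw [sum_indicator_latticeCell hn, if_pos]
      refine mem_labelBox.2 fun i => abs_le.2 ?_
      have hn0 : (0 : ℝ) < m n := by exact_mod_cast hn
      have h1 := abs_lt.1 (hin i)
      constructor
      · refine Int.le_floor.2 ?_
        push_cast
        nlinarith
      · refine Int.le_of_lt_add_one (Int.floor_lt.2 ?_)
        push_cast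
        nlinarith
    · push Not at hin
      obtain ⟨i, hi⟩ := hin
      have hi' : 1 < u i ∨ u i < -1 := by
        rcases le_abs.1 hi with h1 | h1
        · exact Or.inl (lt_of_le_of_ne h1 (hne i).1.symm)
        · exact Or.inr (lt_of_le_of_ne (by linarith) (hne i).2)
      have hnot : u ∉ Set.univ.pi fun _ : ι => Set.Icc (-1 : ℝ) 1 := by
        intro hu'
        have := hu' i (Set.mem_univ i)
        rcases hi' with h1 | h1
        · exact absurd this.2 (not_le.2 h1)
        · exact absurd this.1 (not_le.2 h1)
      rw [Set.indicator_of_notMem hnot]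
      refine tendsto_const_nhds.congr' ?_
      -- The two sides differ because of the floor: below -1 a point is outside the box at once,
      -- above 1 only when m(u_i - 1) exceeds one.
      have hbig : ∀ᶠ n in atTop, 1 < (m n : ℝ) * (u i - 1) ∨ u i < -1 := by
        rcases hi' with h1 | h1
        · filter_upwards [((tendsto_natCast_atTop_atTop (R := ℝ)).comp hm).atTop_mul_const
            (sub_pos.2 h1) |>.eventually_gt_atTop 1] with n hn
          exact Or.inl hn
        · exact Eventually.of_forall fun _ => Or.inr h1
      filter_upwards [hm.eventually_ge_atTop 1, hbig] with n hn hb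
      simp only [hF]
      rw [sum_indicator_latticeCell hn, if_neg]
      intro hmem
      obtain ⟨h1, h2⟩ := hle _ hn u hmem i
      rcases hb with h3 | h3
      · linarith
      · linarith

/-- Proper affine hyperplanes are null sets. -/
theorem ae_sum_mul_ne {c : ι → ℝ} (hc : c ≠ 0) (t : ℝ) : ∀ᵐ u : ι → ℝ, ∑ i, c i * u i ≠ t := by
  set f : (ι → ℝ) →ₗ[ℝ] ℝ := Fintype.linearCombination ℝ c
  have hf : ∀ u, f u = ∑ i, c i * u i := fun u => by
    simp [f, Fintype.linearCombination_apply, mul_comm]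
  have hne : f ≠ 0 := by
    intro h
    apply hc
    funext i
    have := hf (Pi.single i 1)
    rw [h] at this
    simpa [Pi.single_apply] using this.symm
  change volume {u : ι → ℝ | ¬ (∑ i, c i * u i ≠ t)} = 0
  simp only [not_not]
  rcases Set.eq_empty_or_nonempty {u : ι → ℝ | ∑ i, c i * u i = t} with h | ⟨p, hp⟩
  · rw [h, measure_empty]
  · have e : {u : ι → ℝ | ∑ i, c i * u i = t} =
        (AffineSubspace.mk' p (LinearMap.ker f) : Set (ι → ℝ)) := by
      ext u
      have hp' : ∑ i, c i * p i = t := hp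
      simp only [Set.mem_ofPred_eq, SetLike.mem_coe, AffineSubspace.mem_mk', vsub_eq_sub,
        LinearMap.mem_ker]
      rw [map_sub, hf, hf, hp', sub_eq_zero]
    rw [e]
    refine Measure.addHaar_affineSubspace _ _ fun h => hne ?_
    have := congrArg AffineSubspace.direction h
    rw [AffineSubspace.direction_mk', AffineSubspace.direction_top] at this
    exact LinearMap.ker_eq_top.1 this

theorem tendsto_floor_mul_div {m : ℕ → ℕ} (hm : Tendsto m atTop atTop) (x : ℝ) :
    Tendsto (fun n => (⌊(m n : ℝ) * x⌋ : ℝ) / m n) atTop (𝓝 x) := by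
  have h := ((tendsto_natCast_atTop_atTop (R := ℝ)).comp hm)
  have h1 : Tendsto (fun n => x - 1 / (m n : ℝ)) atTop (𝓝 x) := by
    simpa using (tendsto_const_nhds (x := x)).sub (h.const_div_atTop 1)
  refine tendsto_of_tendsto_of_tendsto_of_le_of_le' h1 tendsto_const_nhds ?_ ?_
  · filter_upwards [hm.eventually_ge_atTop 1] with n hn
    have hn0 : (0 : ℝ) < m n := by exact_mod_cast hn
    rw [le_div_iff₀ hn0]
    have := Int.sub_one_lt_floor ((m n : ℝ) * x)
    rw [sub_mul, one_div_mul_cancel hn0.ne', mul_comm]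
    exact this.le
  · filter_upwards [hm.eventually_ge_atTop 1] with n hn
    have hn0 : (0 : ℝ) < m n := by exact_mod_cast hn
    rw [div_le_iff₀ hn0, mul_comm]
    exact Int.floor_le _

theorem tendsto_sum_mul_floor_div {m : ℕ → ℕ} (hm : Tendsto m atTop atTop) (c : ι → ℤ)
    (u : ι → ℝ) : Tendsto (fun n => ((∑ i, c i * ⌊(m n : ℝ) * u i⌋ : ℤ) : ℝ) / m n) atTop
      (𝓝 (∑ i, (c i : ℝ) * u i)) := by
  have := tendsto_finsetSum (Finset.univ : Finset ι)
    fun i _ => (tendsto_floor_mul_div hm (u i)).const_mul (c i : ℝ)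
  refine this.congr fun n => ?_
  push_cast
  rw [Finset.sum_div]
  exact Finset.sum_congr rfl fun i _ => by rw [mul_div_assoc]

/-- The lattice condition `S` is asymptotically equivalent to the constant `c`, at almost every
point. -/
def IsAEConst (S : (ι → ℤ) → Prop) (c : Prop) : Prop :=
  ∀ m : ℕ → ℕ, Tendsto m atTop atTop →
    ∀ᵐ u : ι → ℝ, ∀ᶠ n in atTop, (S (fun i => ⌊(m n : ℝ) * u i⌋) ↔ c)

theorem IsAEConst.and {S S' : (ι → ℤ) → Prop} {c c' : Prop} (h : IsAEConst S c)
    (h' : IsAEConst S' c') : IsAEConst (fun y => S y ∧ S' y) (c ∧ c') := by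
  intro m hm
  filter_upwards [h m hm, h' m hm] with u hu hu'
  filter_upwards [hu, hu'] with n hn hn'
  rw [hn, hn']

theorem IsAEConst.iff_const {S : (ι → ℤ) → Prop} {c : Prop} (h : IsAEConst S c) (r : Prop) :
    IsAEConst (fun y => S y ↔ r) (c ↔ r) := by
  intro m hm
  filter_upwards [h m hm] with u hu
  filter_upwards [hu] with n hn
  rw [hn]

theorem IsAEConst.forall {κ : Type*} [Finite κ] {S : κ → (ι → ℤ) → Prop} {c : κ → Prop}
    (h : ∀ k, IsAEConst (S k) (c k)) : IsAEConst (fun y => ∀ k, S k y) (∀ k, c k) := by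
  intro m hm
  filter_upwards [ae_all_iff.2 fun k => h k m hm] with u hu
  filter_upwards [eventually_all.2 hu] with n hn
  exact forall_congr' hn

/-- A nonzero linear form is nonzero at almost every u, and its rescaled values at the lattice
points converge to this nonzero value. -/
theorem isAEConst_sum_eq_zero (c : ι → ℤ) : IsAEConst (fun y => ∑ i, c i * y i = 0) (c = 0) := by
  intro m hm
  by_cases hc : c = 0
  · simp [hc]
  · have hc' : (fun i => (c i : ℝ)) ≠ 0 := by
      intro h
      apply hc
      funext i
      exact Int.cast_eq_zero.1 (congrFun h i)
    filter_upwards [ae_sum_mul_ne hc' 0] with u hu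
    filter_upwards [(tendsto_sum_mul_floor_div hm c u).eventually_ne hu] with n hn
    simp only [hc, iff_false]
    intro h0
    rw [h0] at hn
    simp at hn

/-- The limit can only disagree where the form equals 1 or -1, which are null sets when the form is
nonzero. -/
theorem ae_eventually_abs_sum_le_iff (c : ι → ℤ) {m : ℕ → ℕ} (hm : Tendsto m atTop atTop) :
    ∀ᵐ u : ι → ℝ, ∀ᶠ n in atTop, (|∑ i, c i * ⌊(m n : ℝ) * u i⌋| ≤ (m n : ℤ) ↔
      |∑ i, (c i : ℝ) * u i| ≤ 1) := by
  by_cases hc : c = 0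
  · simp [hc]
  · have hc' : (fun i => (c i : ℝ)) ≠ 0 := by
      intro h
      apply hc
      funext i
      exact Int.cast_eq_zero.1 (congrFun h i)
    filter_upwards [ae_sum_mul_ne hc' 1, ae_sum_mul_ne hc' (-1)] with u h1 h2
    have hlim := (tendsto_sum_mul_floor_div hm c u).abs
    have hne : |∑ i, (c i : ℝ) * u i| ≠ 1 := by
      intro h
      rcases eq_or_eq_neg_of_abs_eq h with h | h
      · exact h1 h
      · exact h2 h
    have key : ∀ n, 1 ≤ m n → (|∑ i, c i * ⌊(m n : ℝ) * u i⌋| ≤ (m n : ℤ) ↔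
        |((∑ i, c i * ⌊(m n : ℝ) * u i⌋ : ℤ) : ℝ) / m n| ≤ 1) := by
      intro n hn
      have hn0 : (0 : ℝ) < m n := by exact_mod_cast hn
      rw [abs_div, abs_of_pos hn0, div_le_one hn0, ← Int.cast_abs]
      exact_mod_cast Iff.rfl
    rcases hne.lt_or_gt with h | h
    · filter_upwards [hm.eventually_ge_atTop 1, hlim.eventually_lt_const h] with n hn hl
      rw [key n hn]
      exact iff_of_true hl.le h.le
    · filter_upwards [hm.eventually_ge_atTop 1, hlim.eventually_const_lt h] with n hn hl
      rw [key n hn]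
      exact iff_of_false (not_le.2 hl) (not_le.2 h)

end RiemannSums

/-! ### Counting the starting points of a path -/

section Spread

variable {κ : Type*} [Fintype κ]

/-- The length of the smallest interval containing zero and the values of `x`. -/
noncomputable def spread (x : κ → ℝ) : ℝ :=
  ((Finset.univ.sup fun j => (x j).toNNReal) + Finset.univ.sup fun j => (-x j).toNNReal : ℝ≥0)

theorem continuous_spread : Continuous (spread : (κ → ℝ) → ℝ) := by
  unfold spread
  refine NNReal.continuous_coe.comp (Continuous.add ?_ ?_)
  · exact Continuous.finset_sup_apply fun j _ => continuous_real_toNNReal.comp (continuous_apply j)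
  · exact Continuous.finset_sup_apply fun j _ =>
      continuous_real_toNNReal.comp (continuous_apply j).neg

theorem spread_mul {t : ℝ} (ht : 0 ≤ t) (x : κ → ℝ) : spread (fun j => t * x j) = t * spread x := by
  lift t to ℝ≥0 using ht
  unfold spread
  have h : ∀ y : κ → ℝ, (Finset.univ.sup fun j => ((t : ℝ) * y j).toNNReal) =
      t * Finset.univ.sup fun j => (y j).toNNReal := by
    intro y
    rw [NNReal.mul_finset_sup]
    refine Finset.sup_congr rfl fun j _ => ?_
    rw [Real.toNNReal_mul (NNReal.coe_nonneg t), Real.toNNReal_coe]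
  simp only [← mul_neg, h]
  push_cast
  ring

/-- The number of starting points in `{0, …, n - 1}` from which a path with the partial sums `x`
stays in this set. -/
def pathCount (n : ℕ) (x : κ → ℤ) : ℕ :=
  n - ((Finset.univ.sup fun j => (x j).toNat) + Finset.univ.sup fun j => (-x j).toNat)

theorem pathCount_le (n : ℕ) (x : κ → ℤ) : pathCount n x ≤ n := Nat.sub_le _ _

theorem spread_intCast (x : κ → ℤ) : spread (fun j => (x j : ℝ)) =
    (((Finset.univ.sup fun j => (x j).toNat) + Finset.univ.sup fun j => (-x j).toNat : ℕ) : ℝ) := by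
  have h : ∀ y : κ → ℤ, (Finset.univ.sup fun j => ((y j : ℝ)).toNNReal) =
      ((Finset.univ.sup fun j => (y j).toNat : ℕ) : ℝ≥0) := by
    intro y
    rw [Finset.apply_sup_eq_sup_comp_of_linearOrder (fun k : ℕ => (k : ℝ≥0)) Nat.mono_cast (by simp)]
    refine Finset.sup_congr rfl fun j _ => ?_
    rw [Function.comp_apply, ← NNReal.coe_inj, Real.coe_toNNReal']
    have : (((y j).toNat : ℤ) : ℝ) = ((max (y j) 0 : ℤ) : ℝ) := by rw [Int.toNat_eq_max]
    push_cast at this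
    simpa using this.symm
  unfold spread
  have h2 := h fun j => -x j
  simp only [Int.cast_neg] at h2
  rw [h, h2, NNReal.coe_add, NNReal.coe_natCast, NNReal.coe_natCast, Nat.cast_add]

/-- The truncated subtraction in `pathCount` is the positive part; the same expression is the volume
in `volume_real_starting_points`. -/
theorem pathCount_div (n : ℕ) (hn : 1 ≤ n) (x : κ → ℤ) :
    (pathCount n x : ℝ) / n = max 0 (1 - spread (fun j => (x j : ℝ)) / n) := by
  have hn0 : (0 : ℝ) < n := by exact_mod_cast hn
  rw [pathCount, spread_intCast]
  set k := (Finset.univ.sup fun j => (x j).toNat) + Finset.univ.sup fun j => (-x j).toNat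
  rcases le_total k n with h | h
  · rw [Nat.cast_sub h, sub_div, div_self hn0.ne', max_eq_right]
    have : (k : ℝ) / n ≤ 1 := (div_le_one hn0).2 (by exact_mod_cast h)
    linarith
  · rw [Nat.sub_eq_zero_of_le h, max_eq_left]
    · simp
    · have : 1 ≤ (k : ℝ) / n := (one_le_div hn0).2 (by exact_mod_cast h)
      linarith

theorem pathCount_div_nonneg (n : ℕ) (x : κ → ℤ) : 0 ≤ (pathCount n x : ℝ) / n := by positivity

theorem pathCount_div_le_one (n : ℕ) (x : κ → ℤ) : (pathCount n x : ℝ) / n ≤ 1 :=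
  div_le_one_of_le₀ (by exact_mod_cast pathCount_le n x) (by positivity)

/-- Limit of the proportion of admissible starting points. -/
theorem tendsto_pathCount_div {m : ℕ → ℕ} {b : ℝ} (hm : IsBandwidth m b) {x : ℕ → κ → ℤ}
    {X : κ → ℝ} (hx : ∀ j, Tendsto (fun n => (x n j : ℝ) / m n) atTop (𝓝 (X j))) :
    Tendsto (fun n => (pathCount n (x n) : ℝ) / n) atTop (𝓝 (max 0 (1 - b * spread X))) := by
  have h1 : Tendsto (fun n => spread (fun j => (x n j : ℝ) / m n)) atTop (𝓝 (spread X)) :=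
    (continuous_spread.tendsto X).comp (tendsto_pi_nhds.2 hx)
  have h2 : Tendsto (fun n => max 0 (1 - ((m n : ℝ) / n) * spread (fun j => (x n j : ℝ) / m n)))
      atTop (𝓝 (max 0 (1 - b * spread X))) :=
    tendsto_const_nhds.max (tendsto_const_nhds.sub (hm.ratio.mul h1))
  refine h2.congr' ?_
  filter_upwards [eventually_ge_atTop 1, hm.tendsto_atTop.eventually_ge_atTop 1] with n hn hmn
  have hn0 : (0 : ℝ) < n := by exact_mod_cast hn
  have hm0 : (0 : ℝ) < m n := by exact_mod_cast hmn
  rw [pathCount_div n hn]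
  congr 2
  have := spread_mul (t := (m n : ℝ)) hm0.le (fun j => (x n j : ℝ) / m n)
  simp only [mul_div_cancel₀ _ hm0.ne'] at this
  rw [this]
  ring

end Spread

/-! ### Path expansion of the trace -/

section TraceExpansion

variable {𝕜 : Type*} [RCLike 𝕜]

/-- The sign of the letter with a given position. -/
def letterSign (s l : ℕ) : ℤ := (-1) ^ (l / s)

/-- The conjugated letters are the ones of positive sign. -/
def letterConj (s l : ℕ) : Bool := decide (Even (l / s))

theorem letterSign_mul_self (s l : ℕ) : letterSign s l * letterSign s l = 1 := by
  rw [letterSign, ← pow_add, Even.neg_one_pow ⟨_, rfl⟩]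

theorem abs_letterSign (s l : ℕ) : |letterSign s l| = 1 := by
  rw [letterSign, abs_neg_one_pow]

theorem odd_letterSign (s l : ℕ) : Odd (letterSign s l) := Odd.pow (by decide)

/-- The partial sums of a signed word. -/
def partialSums {N : ℕ} (sgn : ℕ → ℤ) (y : Fin N → ℤ) (k : Fin N) : ℤ :=
  ∑ l ∈ Finset.Iic k, sgn l * y l

theorem partialSums_snoc_castSucc {N : ℕ} (sgn : ℕ → ℤ) (y : Fin N → ℤ) (z : ℤ) (k : Fin N) :
    partialSums sgn (Fin.snoc y z : Fin (N + 1) → ℤ) k.castSucc = partialSums sgn y k := by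
  unfold partialSums
  rw [← Fin.map_castSuccEmb_Iic, Finset.sum_map]
  simp

theorem sum_snoc {N : ℕ} (sgn : ℕ → ℤ) (y : Fin N → ℤ) (z : ℤ) :
    ∑ l : Fin (N + 1), sgn l * (Fin.snoc y z : Fin (N + 1) → ℤ) l =
      (∑ l : Fin N, sgn l * y l) + sgn N * z := by
  rw [Fin.sum_univ_castSucc]
  simp

theorem partialSums_last {N : ℕ} (sgn : ℕ → ℤ) (y : Fin (N + 1) → ℤ) :
    partialSums sgn y (Fin.last N) = ∑ l : Fin (N + 1), sgn l * y l := by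
  unfold partialSums
  congr 1
  ext l
  simp [Fin.le_last]

/-- The path with steps `y` from `i` stays in `{0, …, n - 1}`. -/
def StaysInside {N : ℕ} (n : ℕ) (sgn : ℕ → ℤ) (i : ℤ) (y : Fin N → ℤ) : Prop :=
  ∀ k, 0 ≤ i + partialSums sgn y k ∧ i + partialSums sgn y k < n

theorem staysInside_snoc {N n : ℕ} {sgn : ℕ → ℤ} {i : ℤ} {y : Fin N → ℤ} {z : ℤ} :
    StaysInside n sgn i (Fin.snoc y z : Fin (N + 1) → ℤ) ↔ StaysInside n sgn i y ∧
      0 ≤ i + ((∑ l : Fin N, sgn l * y l) + sgn N * z) ∧ i + ((∑ l : Fin N, sgn l * y l) + sgn N * z) < n := by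
  unfold StaysInside
  rw [Fin.forall_fin_succ']
  simp only [partialSums_snoc_castSucc, partialSums_last, sum_snoc]

theorem StaysInside.sum {N n : ℕ} {sgn : ℕ → ℤ} {i : Fin n} {y : Fin N → ℤ}
    (h : StaysInside n sgn i y) :
    0 ≤ (i : ℤ) + ∑ l : Fin N, sgn l * y l ∧ (i : ℤ) + ∑ l : Fin N, sgn l * y l < n := by
  cases N with
  | zero => simp
  | succ N => simpa [partialSums_last] using h (Fin.last N)

theorem sum_labelBox_succ {E : Type*} [AddCommMonoid E] (N m : ℕ) (f : (Fin (N + 1) → ℤ) → E) :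
    ∑ y ∈ labelBox (Fin (N + 1)) m, f y =
      ∑ y ∈ labelBox (Fin N) m, ∑ z ∈ Finset.Icc (-(m : ℤ)) m, f (Fin.snoc y z) := by
  rw [← Finset.sum_product']
  refine Finset.sum_nbij' (fun y => (Fin.init y, y (Fin.last N)))
    (fun p => (Fin.snoc p.1 p.2 : Fin (N + 1) → ℤ)) ?_ ?_ ?_ ?_ ?_
  · intro y hy
    rw [mem_labelBox] at hy
    exact Finset.mem_product.2 ⟨mem_labelBox.2 fun l => hy _, Finset.mem_Icc.2 (abs_le.1 (hy _))⟩
  · rintro ⟨y, z⟩ h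
    obtain ⟨h1, h2⟩ := Finset.mem_product.1 h
    rw [mem_labelBox] at h1 ⊢
    intro l
    refine Fin.lastCases ?_ (fun l => ?_) l
    · simpa using abs_le.2 (Finset.mem_Icc.1 h2)
    · simpa using h1 l
  · intro y _
    exact Fin.snoc_init_self y
  · rintro ⟨y, z⟩ _
    simp
  · intro y _
    simp only [Fin.snoc_init_self]

open scoped Classical in
/-- Path expansion of the entries of a product of band matrices. -/
theorem list_prod_band_apply {n m : ℕ} {sgn : ℕ → ℤ} (hs : ∀ l, sgn l * sgn l = 1)
    (hs' : ∀ l, |sgn l| = 1) (α : ℕ → ℤ → 𝕜)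
    (M : ℕ → Matrix (Fin n) (Fin n) 𝕜)
    (hM : ∀ l i j, M l i j = if |(j : ℤ) - i| ≤ (m : ℤ) then α l (sgn l * ((j : ℤ) - i)) else 0)
    (N : ℕ) (i j : Fin n) :
    ((List.range N).map M).prod i j = ∑ y ∈ labelBox (Fin N) m,
      if StaysInside n sgn i y ∧ (i : ℤ) + ∑ l : Fin N, sgn l * y l = j then ∏ l : Fin N, α l (y l) else 0 := by
  induction N generalizing j with
  | zero =>
    have h1 : labelBox (Fin 0) m = {0} := by
      ext y
      simp [mem_labelBox, Subsingleton.elim y 0]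
    rw [h1, Finset.sum_singleton]
    simp [StaysInside, Matrix.one_apply, Fin.ext_iff]
  | succ N ih =>
    rw [List.range_succ, List.map_append, List.prod_append, Matrix.mul_apply, sum_labelBox_succ]
    simp only [List.map_cons, List.map_nil, List.prod_cons, List.prod_nil, mul_one, ih,
      Finset.sum_mul]
    rw [Finset.sum_comm]
    refine Finset.sum_congr rfl fun y _ => ?_
    set S := ∑ l : Fin N, sgn l * y l with hS
    -- The end point forces the last step, as the sign is its own inverse; that the path ends inside
    -- is then automatic since j is an index.
    have hterm : ∀ z : ℤ, (StaysInside n sgn i (Fin.snoc y z : Fin (N + 1) → ℤ) ∧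
        (i : ℤ) + ∑ l : Fin (N + 1), sgn l * (Fin.snoc y z : Fin (N + 1) → ℤ) l = j) ↔
        (StaysInside n sgn i y ∧ z = sgn N * ((j : ℤ) - (i + S))) := by
      intro z
      rw [staysInside_snoc, sum_snoc, ← hS]
      have hz : (i : ℤ) + (S + sgn N * z) = j ↔ z = sgn N * ((j : ℤ) - (i + S)) := by
        constructor
        · intro h
          rw [← h, show (i : ℤ) + (S + sgn N * z) - (i + S) = sgn N * z by ring, ← mul_assoc, hs,
            one_mul]
        · rintro rfl
          rw [← mul_assoc, hs]
          ring
      rw [hz]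
      constructor
      · rintro ⟨⟨h1, -⟩, h2⟩
        exact ⟨h1, h2⟩
      · rintro ⟨h1, h2⟩
        refine ⟨⟨h1, ?_⟩, h2⟩
        rw [hz.2 h2]
        have := j.2
        omega
    simp only [hterm]
    by_cases hin : StaysInside n sgn i y
    · obtain ⟨h0, h1⟩ := hin.sum
      rw [← hS] at h0 h1
      simp only [hin, true_and]
      -- The only intermediate index that contributes is the end point of the path of the first N
      -- steps.
      rw [Finset.sum_eq_single (⟨((i : ℤ) + S).toNat, by omega⟩ : Fin n)]
      · have hk : ((((i : ℤ) + S).toNat : ℕ) : ℤ) = i + S := Int.toNat_of_nonneg h0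
        simp only [hk, if_true]
        rw [hM, Finset.sum_ite_eq' (Finset.Icc (-(m : ℤ)) m) (sgn N * ((j : ℤ) - (i + S)))]
        simp only [hk, Finset.mem_Icc, ← abs_le, abs_mul, hs', one_mul]
        rw [mul_ite, mul_zero]
        refine if_congr Iff.rfl ?_ rfl
        rw [Fin.prod_univ_castSucc]
        simp
      · intro k _ hk
        rw [if_neg, zero_mul]
        intro h
        apply hk
        ext
        simp only
        omega
      · intro h
        exact absurd (Finset.mem_univ _) h
    · simp [hin]

/-- The admissible starting points form the interval [Q, n - P), with P the highest rise and Q the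
deepest descent of the path. -/
theorem card_staysInside {κ : Type*} [Fintype κ] (n : ℕ) (x : κ → ℤ) (p : Fin n → Prop)
    [DecidablePred p] (hp : ∀ i, p i ↔ ∀ k, 0 ≤ (i : ℤ) + x k ∧ (i : ℤ) + x k < n) :
    (Finset.univ.filter p).card = pathCount n x := by
  set P := Finset.univ.sup fun j => (x j).toNat with hP
  set Q := Finset.univ.sup fun j => (-x j).toNat with hQ
  have h : (Finset.univ.filter p).map Fin.valEmbedding = Finset.Ico Q (n - P) := by
    ext i
    simp only [Finset.mem_map, Finset.mem_filter, Finset.mem_univ, true_and, Finset.mem_Ico,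
      Fin.valEmbedding_apply, hp]
    constructor
    · rintro ⟨i, hi, rfl⟩
      have h1 : Q ≤ i := Finset.sup_le fun j _ => by have := hi j; omega
      have h2 : P ≤ n - 1 - i := Finset.sup_le fun j _ => by
        have := hi j
        have := i.2
        omega
      have := i.2
      omega
    · rintro ⟨h1, h2⟩
      refine ⟨⟨i, by omega⟩, fun k => ?_, rfl⟩
      have h3 : (x k).toNat ≤ P := Finset.le_sup (f := fun j => (x j).toNat) (Finset.mem_univ k)
      have h4 : (-x k).toNat ≤ Q := Finset.le_sup (f := fun j => (-x j).toNat) (Finset.mem_univ k)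
      simp only
      omega
  rw [← Finset.card_map Fin.valEmbedding, h, Nat.card_Ico, pathCount, ← hP, ← hQ]
  omega

/-- Closed words with labels of absolute value at most `m`. -/
noncomputable def closedWords (sgn : ℕ → ℤ) (N m : ℕ) : Finset (Fin N → ℤ) :=
  (labelBox (Fin N) m).filter fun y => ∑ l : Fin N, sgn l * y l = 0

theorem mem_closedWords {sgn : ℕ → ℤ} {N m : ℕ} {y : Fin N → ℤ} :
    y ∈ closedWords sgn N m ↔ (∀ l, |y l| ≤ m) ∧ ∑ l : Fin N, sgn l * y l = 0 := by
  rw [closedWords, Finset.mem_filter, mem_labelBox]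

/-- Path expansion of the trace of a product of band matrices. -/
theorem trace_list_prod_band {n m : ℕ} {sgn : ℕ → ℤ} (hs : ∀ l, sgn l * sgn l = 1)
    (hs' : ∀ l, |sgn l| = 1) (α : ℕ → ℤ → 𝕜)
    (M : ℕ → Matrix (Fin n) (Fin n) 𝕜)
    (hM : ∀ l i j, M l i j = if |(j : ℤ) - i| ≤ (m : ℤ) then α l (sgn l * ((j : ℤ) - i)) else 0)
    (N : ℕ) :
    ((List.range N).map M).prod.trace = ∑ y ∈ closedWords sgn N m,
      (pathCount n (partialSums sgn y) : 𝕜) * ∏ l : Fin N, α l (y l) := by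
  classical
  simp only [Matrix.trace, Matrix.diag_apply, list_prod_band_apply hs hs' α M hM N]
  rw [Finset.sum_comm, closedWords, Finset.sum_filter]
  refine Finset.sum_congr rfl fun y _ => ?_
  split_ifs with h
  · simp only [h, add_zero, and_true]
    rw [← Finset.sum_filter, Finset.sum_const, nsmul_eq_mul]
    rw [card_staysInside n (partialSums sgn y) (fun i : Fin n => StaysInside n sgn i y)
      fun i => Iff.rfl]
  · refine Finset.sum_eq_zero fun i _ => if_neg ?_
    rintro ⟨-, h2⟩
    exact h (by omega)

/-- The factors alternate in runs of length s, so the parity of l / s decides which matrix stands at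
position l. -/
theorem pow_mul_pow_eq_list_prod {R : Type*} [Monoid R] (A B : R) {s : ℕ} (hs : 1 ≤ s) (p : ℕ) :
    (A ^ s * B ^ s) ^ p =
      ((List.range (2 * p * s)).map fun l => if Even (l / s) then A else B).prod := by
  induction p with
  | zero => simp
  | succ p ih =>
    have e : 2 * (p + 1) * s = (2 * p * s + s) + s := by ring
    rw [e, List.range_add, List.range_add, List.map_append, List.map_append, List.prod_append,
      List.prod_append, ← ih, pow_succ, mul_assoc]
    congr 1
    have hA : ((List.range s).map (fun x => 2 * p * s + x)).map
        (fun l => if Even (l / s) then A else B) = List.replicate s A := by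
      rw [List.map_map, List.eq_replicate_iff]
      refine ⟨by simp, fun x hx => ?_⟩
      obtain ⟨l, hl, rfl⟩ := List.mem_map.1 hx
      have h1 : (2 * p * s + l) / s = 2 * p := by
        rw [mul_comm, Nat.mul_add_div (by omega), Nat.div_eq_of_lt (List.mem_range.1 hl), add_zero]
      simp [h1]
    have hB : ((List.range s).map (fun x => 2 * p * s + s + x)).map
        (fun l => if Even (l / s) then A else B) = List.replicate s B := by
      rw [List.map_map, List.eq_replicate_iff]
      refine ⟨by simp, fun x hx => ?_⟩
      obtain ⟨l, hl, rfl⟩ := List.mem_map.1 hx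
      have h1 : (2 * p * s + s + l) / s = 2 * p + 1 := by
        rw [show 2 * p * s + s + l = s * (2 * p + 1) + l by ring, Nat.mul_add_div (by omega),
          Nat.div_eq_of_lt (List.mem_range.1 hl), add_zero]
      simp [h1]
    rw [hA, hB, List.prod_replicate, List.prod_replicate]

/-- Expansion of the trace of a power of the matrix over closed words. -/
theorem trace_powerMatrix_pow {s : ℕ} (hs : 1 ≤ s) (n m : ℕ) (a : ℤ → 𝕜) (p : ℕ) :
    (powerMatrix s n m a ^ p).trace = ((m : 𝕜) ^ (p * s))⁻¹ *
      ∑ y ∈ closedWords (letterSign s) (2 * p * s) m,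
        (pathCount n (partialSums (letterSign s) y) : 𝕜) *
          ∏ l : Fin (2 * p * s), conjIf (letterConj s l) (a (y l)) := by
  rw [powerMatrix, smul_pow, Matrix.trace_smul, smul_eq_mul, pow_mul_pow_eq_list_prod _ _ hs]
  congr 1
  · rw [inv_pow, ← pow_mul, mul_comm]
  · refine trace_list_prod_band (letterSign_mul_self s) (abs_letterSign s)
      (fun l z => conjIf (letterConj s l) (a z)) _ (fun l i j => ?_) _
    -- In an even run the factor is the adjoint, whose entry at (i, j) is the conjugate of a_{j-i},
    -- so the step is plus the label. In an odd run the entry is a_{i-j}, and the step is minus the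
    -- label.
    by_cases h : Even (l / s)
    · simp only [h, if_true, letterConj, decide_true, conjIf, letterSign, h.neg_one_pow, one_mul,
        Matrix.conjTranspose_apply, toeplitzBand, Matrix.of_apply]
      split_ifs <;> simp
    · have h' := Nat.not_even_iff_odd.1 h
      simp only [h, if_false, letterConj, decide_false, conjIf, letterSign, h'.neg_one_pow,
        toeplitzBand, Matrix.of_apply]
      rw [abs_sub_comm, show (-1 : ℤ) * ((j : ℤ) - i) = i - j by ring]
      simp

end TraceExpansion

/-! ### Labelings with a given kernel -/

section Kernels

variable {L : Type} [Fintype L] [DecidableEq L]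

/-- The labeling `J` takes equal values exactly on the blocks of `π`. -/
def IsKernel (π : Finpartition (Finset.univ : Finset L)) (J : L → ℤ) : Prop :=
  ∀ l l', J l = J l' ↔ π.part l = π.part l'

instance (π : Finpartition (Finset.univ : Finset L)) : DecidablePred (IsKernel π) :=
  fun J => inferInstanceAs (Decidable (∀ l l', J l = J l' ↔ π.part l = π.part l'))

theorem existsUnique_isKernel (J : L → ℤ) : ∃! π, IsKernel π J := by
  classical
  refine ⟨Finpartition.ofSetoid (Setoid.ker J), fun l l' => ?_, fun π hπ => ?_⟩
  · rw [← Finpartition.mem_part_iff_part_eq_part _ (Finset.mem_univ _) (Finset.mem_univ _),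
      Finpartition.mem_part_ofSetoid_iff_rel, Setoid.ker_def, eq_comm]
  · have h : ∀ l, π.part l = (Finpartition.ofSetoid (Setoid.ker J)).part l := by
      intro l
      ext l'
      rw [Finpartition.mem_part_iff_part_eq_part _ (Finset.mem_univ _) (Finset.mem_univ _), ← hπ,
        Finpartition.mem_part_ofSetoid_iff_rel, Setoid.ker_def, eq_comm]
    have key : ∀ ρ ρ' : Finpartition (Finset.univ : Finset L), (∀ l, ρ.part l = ρ'.part l) →
        ρ.parts ⊆ ρ'.parts := by
      intro ρ ρ' h V hV
      obtain ⟨l, hl⟩ := ρ.nonempty_of_mem_parts hV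
      rw [← ρ.part_eq_of_mem hV hl, h]
      exact ρ'.part_mem.2 (Finset.mem_univ l)
    exact Finpartition.ext (Finset.Subset.antisymm (key _ _ h) (key _ _ fun l => (h l).symm))

theorem sum_eq_sum_isKernel {E : Type*} [AddCommMonoid E] (S : Finset (L → ℤ)) (f : (L → ℤ) → E) :
    ∑ J ∈ S, f J = ∑ π, ∑ J ∈ S with IsKernel π J, f J := by
  simp only [Finset.sum_filter]
  rw [Finset.sum_comm]
  refine Finset.sum_congr rfl fun J _ => ?_
  obtain ⟨π, h, hu⟩ := existsUnique_isKernel J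
  rw [Finset.sum_eq_single π (fun ρ _ hρ => if_neg fun h' => hρ (hu ρ h')) (by simp), if_pos h]

theorem card_filter_isKernel_le (π : Finpartition (Finset.univ : Finset L)) (m : ℕ) :
    ((labelBox L m).filter (IsKernel π)).card ≤ (2 * m + 1) ^ π.parts.card := by
  choose rep hrep using fun V : {V // V ∈ π.parts} => π.nonempty_of_mem_parts V.2
  have h := Finset.card_le_card_of_injOn (s := (labelBox L m).filter (IsKernel π))
    (t := labelBox {V // V ∈ π.parts} m) (fun J => J ∘ rep) (fun J hJ => by
      have hJ' := mem_labelBox.1 (Finset.mem_filter.1 (Finset.mem_coe.1 hJ)).1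
      exact Finset.mem_coe.2 (mem_labelBox.2 fun V => hJ' (rep V))) (fun J hJ J' hJ' he => by
      have h1 := (Finset.mem_filter.1 (Finset.mem_coe.1 hJ)).2
      have h2 := (Finset.mem_filter.1 (Finset.mem_coe.1 hJ')).2
      funext l
      set V : {V // V ∈ π.parts} := ⟨π.part l, π.part_mem.2 (Finset.mem_univ l)⟩
      have h3 : π.part l = π.part (rep V) := (π.part_eq_of_mem V.2 (hrep V)).symm
      rw [(h1 _ _).2 h3, (h2 _ _).2 h3]
      exact congrFun he V)
  rwa [card_labelBox, Fintype.card_coe] at h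

/-- The number of letters of a given kind in the part of a block that lies in `s`. -/
def kindCount (kd : L → Bool) (s V : Finset L) (c : Bool) : ℕ :=
  (s.filter fun l => l ∈ V ∧ kd l = c).card

variable {𝕜 : Type*} [RCLike 𝕜] {Ω : Type*} [MeasurableSpace Ω] {μ : Measure Ω}
  [IsProbabilityMeasure μ] {mom : ℕ → ℕ → ℝ} {a : ℤ → Ω → 𝕜} {kd : L → Bool}

/-- Distinct blocks carry distinct labels, hence independent entries, and the expectation factors
into one mixed moment for each block. The condition on the counts admits only those mixed moments
that `IsEntryFamily` prescribes. -/
theorem IsEntryFamily.integral_letterProd (ha : IsEntryFamily mom μ a)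
    {π : Finpartition (Finset.univ : Finset L)} {J : L → ℤ} (hJ : IsKernel π J) (s : Finset L)
    (h : ∀ V ∈ π.parts, kindCount kd s V true + kindCount kd s V false ≤ 2 ∨
      kindCount kd s V true = 2 ∧ kindCount kd s V false = 2) :
    ∫ ω, letterProd a kd J s ω ∂μ =
      ((∏ V ∈ π.parts, mom (kindCount kd s V true) (kindCount kd s V false) : ℝ) : 𝕜) := by
  choose rep hrep using fun V : {V // V ∈ π.parts} => π.nonempty_of_mem_parts V.2
  have hinj : Function.Injective (J ∘ rep) := by
    intro V V' hV
    have := (hJ _ _).1 hV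
    rwa [π.part_eq_of_mem V.2 (hrep V), π.part_eq_of_mem V'.2 (hrep V'), Subtype.coe_inj] at this
  have hprod : ∀ ω, letterProd a kd J s ω = ∏ V : {V // V ∈ π.parts},
      (star (a (J (rep V)) ω) ^ kindCount kd s V true *
        a (J (rep V)) ω ^ kindCount kd s V false) := by
    intro ω
    have hV : ∀ V : {V // V ∈ π.parts}, star (a (J (rep V)) ω) ^ kindCount kd s V true *
        a (J (rep V)) ω ^ kindCount kd s V false =
        ∏ l ∈ s with π.part l = V, conjIf (kd l) (a (J l) ω) := by
      intro V
      rw [← Finset.prod_filter_mul_prod_filter_not _ (fun l => kd l = true), Finset.filter_filter,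
        Finset.filter_filter]
      simp only [π.part_eq_iff_mem V.2, Bool.not_eq_true]
      have hl : ∀ l ∈ (V : Finset L), J l = J (rep V) := fun l hl => by
        rw [hJ, π.part_eq_of_mem V.2 hl, π.part_eq_of_mem V.2 (hrep V)]
      congr 1
      · refine (Finset.prod_eq_pow_card fun l hl' => ?_).symm
        rw [Finset.mem_filter] at hl'
        rw [hl'.2.2, hl l hl'.2.1]
        rfl
      · refine (Finset.prod_eq_pow_card fun l hl' => ?_).symm
        rw [Finset.mem_filter] at hl'
        rw [hl'.2.2, hl l hl'.2.1]
        rfl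
    simp only [hV]
    rw [Finset.prod_coe_sort π.parts
      (fun V => ∏ l ∈ s with π.part l = V, conjIf (kd l) (a (J l) ω)), letterProd]
    exact (Finset.prod_fiberwise_of_maps_to (fun l _ => π.part_mem.2 (Finset.mem_univ l)) _).symm
  simp only [hprod]
  have h1 := (ha.indep.precomp hinj).integral_fun_prod_comp
    (f := fun (V : {V // V ∈ π.parts}) z =>
      star z ^ kindCount kd s V true * z ^ kindCount kd s V false)
    (fun V => (ha.measurable _).aemeasurable) fun V => by
      refine Continuous.aestronglyMeasurable ?_
      exact (continuous_star.pow _).mul (continuous_id.pow _)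
  refine h1.trans ?_
  rw [RCLike.ofReal_prod, ← Finset.prod_coe_sort π.parts fun V =>
    (mom (kindCount kd s V true) (kindCount kd s V false) : 𝕜)]
  exact Finset.prod_congr rfl fun (V : {V // V ∈ π.parts}) _ => ha.moment _ _ _ (h V.1 V.2)

end Kernels

/-! ### Limits of sums over linearly parametrised labelings -/

section Parametrisation

variable {L κ : Type} [Fintype L] [DecidableEq L] [Fintype κ] [DecidableEq κ]

/-- The labeling with the parameters `z`. -/
def expand (A : L → κ → ℤ) (z : κ → ℤ) (l : L) : ℤ := ∑ k, A l k * z k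

/-- The parameters are read off at the representatives `rep`, and `hC` makes this inverse to `expand
A` on the constrained labelings. Membership in the box has to be imposed on the other letters as
well. -/
theorem sum_labelBox_expand {E : Type*} [AddCommMonoid E] {A : L → κ → ℤ} {rep : κ → L}
    (hrep : ∀ z k, expand A z (rep k) = z k) {C : (L → ℤ) → Prop} [DecidablePred C]
    (hC : ∀ J, C J → expand A (J ∘ rep) = J) (m : ℕ) (F : (L → ℤ) → E) :
    ∑ J ∈ labelBox L m with C J, F J = ∑ z ∈ labelBox κ m,
      if C (expand A z) ∧ ∀ l, |expand A z l| ≤ (m : ℤ) then F (expand A z) else 0 := by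
  rw [← Finset.sum_filter]
  refine Finset.sum_nbij' (fun J => J ∘ rep) (expand A) ?_ ?_ ?_ ?_ ?_
  · intro J hJ
    obtain ⟨h1, h2⟩ := Finset.mem_filter.1 hJ
    rw [mem_labelBox] at h1
    refine Finset.mem_filter.2 ⟨mem_labelBox.2 fun k => h1 _, ?_⟩
    rw [hC J h2]
    exact ⟨h2, h1⟩
  · intro z hz
    obtain ⟨-, h1, h2⟩ := Finset.mem_filter.1 hz
    exact Finset.mem_filter.2 ⟨mem_labelBox.2 h2, h1⟩
  · intro J hJ
    exact hC J (Finset.mem_filter.1 hJ).2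
  · intro z _
    exact funext fun k => hrep z k
  · intro J hJ
    rw [hC J (Finset.mem_filter.1 hJ).2]

/-- The limit of a sum over labelings with parametrisation `A`. -/
noncomputable def paramIntegral (A : L → κ → ℤ) (G : (L → ℝ) → ℝ) : ℝ :=
  ∫ u in Set.univ.pi fun _ : κ => Set.Icc (-1 : ℝ) 1,
    if ∀ l, |∑ k, (A l k : ℝ) * u k| ≤ 1 then G (fun l => ∑ k, (A l k : ℝ) * u k) else 0

/-- The weights `w n J` are asymptotically a function of `J / m n`. -/
structure IsScalingWeight (m : ℕ → ℕ) (w : ℕ → (L → ℤ) → ℝ) (G : (L → ℝ) → ℝ) : Prop where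
  le_one : ∀ n J, |w n J| ≤ 1
  tendsto : ∀ (x : ℕ → L → ℤ) (X : L → ℝ),
    (∀ l, Tendsto (fun n => (x n l : ℝ) / m n) atTop (𝓝 (X l))) →
      Tendsto (fun n => w n (x n)) atTop (𝓝 (G X))

-- Generically the constraint has the constant truth value c and the box condition becomes |·| ≤ 1
-- on the letters, so `tendsto_riemann_sum` applies.
open scoped Classical in
theorem tendsto_sum_expand {A : L → κ → ℤ} {rep : κ → L}
    (hrep : ∀ z k, expand A z (rep k) = z k) {C : (L → ℤ) → Prop} [DecidablePred C]
    (hC : ∀ J, C J → expand A (J ∘ rep) = J) {c : Prop}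
    (hc : IsAEConst (fun z => C (expand A z)) c) {m : ℕ → ℕ} (hm : Tendsto m atTop atTop)
    {w : ℕ → (L → ℤ) → ℝ} {G : (L → ℝ) → ℝ} (hw : IsScalingWeight m w G) :
    Tendsto (fun n => (∑ J ∈ labelBox L (m n) with C J, w n J) / (m n : ℝ) ^ Fintype.card κ) atTop
      (𝓝 (if c then paramIntegral A G else 0)) := by
  simp only [sum_labelBox_expand hrep hC]
  have h := tendsto_riemann_sum (ι := κ) hm (h := fun n z =>
    if C (expand A z) ∧ ∀ l, |expand A z l| ≤ (m n : ℤ) then w n (expand A z) else 0)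
    (C := 1) (fun n z => by
      split_ifs
      · exact hw.le_one _ _
      · simp)
    (H := fun u => if c then
      (if ∀ l, |∑ k, (A l k : ℝ) * u k| ≤ 1 then G (fun l => ∑ k, (A l k : ℝ) * u k) else 0)
      else 0) (by
      filter_upwards [hc m hm, ae_all_iff.2 fun l => ae_eventually_abs_sum_le_iff (A l) hm]
        with u h1 h2
      by_cases hcc : c
      · simp only [hcc, if_true]
        by_cases hl : ∀ l, |∑ k, (A l k : ℝ) * u k| ≤ 1
        · rw [if_pos hl]
          refine (hw.tendsto _ _ fun l => tendsto_sum_mul_floor_div hm (A l) u).congr' ?_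
          filter_upwards [h1, eventually_all.2 h2] with n hn hn'
          rw [if_pos ⟨hn.2 hcc, fun l => (hn' l).2 (hl l)⟩]
          rfl
        · rw [if_neg hl]
          refine tendsto_const_nhds.congr' ?_
          filter_upwards [eventually_all.2 h2] with n hn'
          rw [if_neg]
          exact fun hh => hl fun l => (hn' l).1 (hh.2 l)
      · simp only [hcc, if_false]
        refine tendsto_const_nhds.congr' ?_
        filter_upwards [h1] with n hn
        rw [if_neg]
        exact fun hh => hcc (hn.1 hh.1))
  convert h using 2
  by_cases hcc : c <;> simp [hcc, paramIntegral]

variable {𝕜 : Type*} [RCLike 𝕜]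

-- If c fails, the nonnegative weights already sum to lower order and boundedness of E is enough.
-- The value of E is therefore required only when c holds.
open scoped Classical in
theorem tendsto_sum_expand_mul {A : L → κ → ℤ} {rep : κ → L}
    (hrep : ∀ z k, expand A z (rep k) = z k) {C : (L → ℤ) → Prop} [DecidablePred C]
    (hC : ∀ J, C J → expand A (J ∘ rep) = J) {c : Prop}
    (hc : IsAEConst (fun z => C (expand A z)) c) {m : ℕ → ℕ} (hm : Tendsto m atTop atTop)
    {w : ℕ → (L → ℤ) → ℝ} {G : (L → ℝ) → ℝ} (hw : IsScalingWeight m w G) (hw0 : ∀ n J, 0 ≤ w n J)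
    {E : (L → ℤ) → 𝕜} {K : ℝ} (hK : ∀ J, ‖E J‖ ≤ K) {e : ℝ}
    (he : c → ∀ J, C J → E J = (e : 𝕜)) :
    Tendsto (fun n => (∑ J ∈ labelBox L (m n) with C J, (w n J : 𝕜) * E J) /
      (m n : 𝕜) ^ Fintype.card κ) atTop (𝓝 ((if c then e * paramIntegral A G else 0 : ℝ) : 𝕜)) := by
  have h := tendsto_sum_expand hrep hC hc hm hw
  by_cases hcc : c
  · simp only [hcc, if_true] at h ⊢
    have h2 := (RCLike.continuous_ofReal (K := 𝕜)).continuousAt.tendsto.comp (h.const_mul e)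
    refine h2.congr fun n => ?_
    simp only [Function.comp]
    push_cast
    rw [← mul_div_assoc, Finset.mul_sum]
    congr 1
    refine Finset.sum_congr rfl fun J hJ => ?_
    rw [he hcc J (Finset.mem_filter.1 hJ).2, mul_comm]
  · simp only [hcc, if_false] at h ⊢
    rw [RCLike.ofReal_zero]
    refine squeeze_zero_norm (fun n => ?_) (by simpa using h.mul_const K)
    rw [norm_div, norm_pow, RCLike.norm_natCast, div_mul_eq_mul_div, Finset.sum_mul]
    refine div_le_div_of_nonneg_right ((norm_sum_le _ _).trans (Finset.sum_le_sum fun J _ => ?_))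
      (by positivity)
    rw [norm_mul, RCLike.norm_ofReal, abs_of_nonneg (hw0 n J)]
    exact mul_le_mul_of_nonneg_left (hK J) (hw0 n J)

end Parametrisation

/-! ### Sums over closed labelings with a given kernel -/

section KernelSums

variable {L ι : Type} [Fintype L] [DecidableEq L] [Fintype ι] [DecidableEq ι]
  {circ : L → ι} {kd : L → Bool} {sgn : L → ℤ} {π : Finpartition (Finset.univ : Finset L)}
  {κ : Type} [Fintype κ] [DecidableEq κ]

theorem sum_mul_expand (s : Finset L) (t : L → ℤ) (A : L → κ → ℤ) (z : κ → ℤ) :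
    ∑ l ∈ s, t l * expand A z l = ∑ k, (∑ l ∈ s, t l * A l k) * z k := by
  simp only [expand, Finset.mul_sum, Finset.sum_mul, mul_assoc]
  exact Finset.sum_comm

/-- Both conditions consist of finitely many linear equations in the parameters, or comparisons of
their truth with fixed propositions; each equation holds identically or fails almost everywhere. -/
theorem isAEConst_expand (circ : L → ι) (sgn : L → ℤ) (π : Finpartition (Finset.univ : Finset L))
    (A : L → κ → ℤ) :
    IsAEConst (fun z => IsClosedLabeling circ sgn (expand A z) ∧ IsKernel π (expand A z))
      ((∀ i, (fun k => ∑ l ∈ lettersOf circ i, sgn l * A l k) = 0) ∧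
        ∀ l l', A l - A l' = 0 ↔ π.part l = π.part l') := by
  refine IsAEConst.and (IsAEConst.forall fun i => ?_)
    (IsAEConst.forall fun l => IsAEConst.forall fun l' => ?_)
  · simp only [sum_mul_expand]
    exact isAEConst_sum_eq_zero _
  · have h := (isAEConst_sum_eq_zero (A l - A l')).iff_const (π.part l = π.part l')
    simpa only [Pi.sub_apply, sub_mul, Finset.sum_sub_distrib, sub_eq_zero (b := ∑ _, _), expand]
      using h

/-- The block of a letter. -/
def blockOf (π : Finpartition (Finset.univ : Finset L)) (l : L) : {V // V ∈ π.parts} :=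
  ⟨π.part l, π.part_mem.2 (Finset.mem_univ l)⟩

/-- The coefficients in the parametrisation of the labelings with kernel `π` by the blocks. -/
def blockCoeff (π : Finpartition (Finset.univ : Finset L)) (l : L) (V : {V // V ∈ π.parts}) : ℤ :=
  if blockOf π l = V then 1 else 0

theorem expand_blockCoeff (z : {V // V ∈ π.parts} → ℤ) (l : L) :
    expand (blockCoeff π) z l = z (blockOf π l) := by
  simp [expand, blockCoeff]

theorem exists_rep (π : Finpartition (Finset.univ : Finset L)) :
    ∃ rep : {V // V ∈ π.parts} → L, ∀ V, blockOf π (rep V) = V := by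
  choose rep hrep using fun V : {V // V ∈ π.parts} => π.nonempty_of_mem_parts V.2
  exact ⟨rep, fun V => Subtype.ext (π.part_eq_of_mem V.2 (hrep V))⟩

theorem IsKernel.apply_rep {J : L → ℤ} (hJ : IsKernel π J) {rep : {V // V ∈ π.parts} → L}
    (hrep : ∀ V, blockOf π (rep V) = V) (l : L) : J (rep (blockOf π l)) = J l :=
  (hJ _ _).2 (congrArg Subtype.val (hrep (blockOf π l)))

theorem blockCoeff_sub_eq_zero (l l' : L) :
    blockCoeff π l - blockCoeff π l' = 0 ↔ π.part l = π.part l' := by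
  constructor
  · intro h
    have := congrFun h (blockOf π l)
    simp only [Pi.sub_apply, blockCoeff, if_true, Pi.zero_apply] at this
    split_ifs at this with h'
    · exact (congrArg Subtype.val h').symm
    · simp at this
  · intro h
    funext V
    have h' : blockOf π l = blockOf π l' := Subtype.ext h
    simp [blockCoeff, h']

/-- The value of the functional of the circuit `i` on the block `V`. -/
def circuitSum (circ : L → ι) (sgn : L → ℤ) (i : ι) (V : Finset L) : ℤ :=
  ∑ l ∈ (lettersOf circ i).filter (· ∈ V), sgn l

theorem sum_mul_blockCoeff (i : ι) (V : {V // V ∈ π.parts}) :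
    ∑ l ∈ lettersOf circ i, sgn l * blockCoeff π l V = circuitSum circ sgn i V := by
  rw [circuitSum, Finset.sum_filter]
  refine Finset.sum_congr rfl fun l _ => ?_
  rw [blockCoeff, mul_ite, mul_one, mul_zero]
  refine if_congr ?_ rfl rfl
  rw [← π.part_eq_iff_mem V.2]
  exact Subtype.ext_iff

theorem circuitSum_eq (hsgn : ∀ l, sgn l = if kd l then 1 else -1) (i : ι) (V : Finset L) :
    circuitSum circ sgn i V = kindCount kd (lettersOf circ i) V true -
      kindCount kd (lettersOf circ i) V false := by
  simp only [circuitSum, hsgn, Finset.sum_ite, Finset.filter_filter, kindCount]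
  simp [sub_eq_add_neg]

/-- All the functionals of the circuits vanish on the blocks. -/
def IsBalanced (circ : L → ι) (sgn : L → ℤ) (π : Finpartition (Finset.univ : Finset L)) : Prop :=
  ∀ i, ∀ V ∈ π.parts, circuitSum circ sgn i V = 0

/-- With one parameter for each block the kernel is generically the right one, so only the vanishing
of the circuit functionals remains as a condition. -/
theorem isAEConst_blockCoeff (circ : L → ι) (sgn : L → ℤ)
    (π : Finpartition (Finset.univ : Finset L)) :
    IsAEConst (fun z => IsClosedLabeling circ sgn (expand (blockCoeff π) z) ∧
      IsKernel π (expand (blockCoeff π) z)) (IsBalanced circ sgn π) := by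
  convert isAEConst_expand circ sgn π (blockCoeff π) using 1
  simp only [blockCoeff_sub_eq_zero, implies_true, and_true, sum_mul_blockCoeff]
  simp only [funext_iff, Pi.zero_apply, Subtype.forall, IsBalanced]

variable {𝕜 : Type*} [RCLike 𝕜]

open scoped Classical in
theorem tendsto_sum_blocks {m : ℕ → ℕ} (hm : Tendsto m atTop atTop)
    {w : ℕ → (L → ℤ) → ℝ} {G : (L → ℝ) → ℝ} (hw : IsScalingWeight m w G) (hw0 : ∀ n J, 0 ≤ w n J)
    {E : (L → ℤ) → 𝕜} {K : ℝ} (hK : ∀ J, ‖E J‖ ≤ K) {e : ℝ}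
    (he : IsBalanced circ sgn π → ∀ J, IsKernel π J → E J = (e : 𝕜)) :
    Tendsto (fun n => (∑ J ∈ labelBox L (m n) with IsClosedLabeling circ sgn J ∧ IsKernel π J,
      (w n J : 𝕜) * E J) / (m n : 𝕜) ^ π.parts.card) atTop
      (𝓝 ((if IsBalanced circ sgn π then e * paramIntegral (blockCoeff π) G else 0 : ℝ) : 𝕜)) := by
  obtain ⟨rep, hrep⟩ := exists_rep π
  have h := tendsto_sum_expand_mul (𝕜 := 𝕜) (A := blockCoeff π) (rep := rep)
    (fun z V => by rw [expand_blockCoeff, hrep])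
    (C := fun J => IsClosedLabeling circ sgn J ∧ IsKernel π J)
    (fun J hJ => funext fun l => by
      rw [expand_blockCoeff, Function.comp_apply, hJ.2.apply_rep hrep])
    (isAEConst_blockCoeff circ sgn π) hm hw hw0 hK (fun hb J hJ => he hb J hJ.2)
  rwa [Fintype.card_coe] at h

/-- The coefficients in the parametrisation of the closed labelings with kernel `π` in which one
block is eliminated through the functional of a circuit. -/
def elimCoeff (circ : L → ι) (sgn : L → ℤ) (π : Finpartition (Finset.univ : Finset L)) (i : ι)
    (B : {V // V ∈ π.parts}) (l : L) (V : {V : {V // V ∈ π.parts} // V ≠ B}) : ℤ :=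
  if blockOf π l = V.1 then 1 else
    if blockOf π l = B then -(circuitSum circ sgn i B * circuitSum circ sgn i V.1) else 0

theorem IsClosedLabeling.sum_circuitSum {J : L → ℤ} (hJ : IsClosedLabeling circ sgn J)
    (hJ' : IsKernel π J) {rep : {V // V ∈ π.parts} → L} (hrep : ∀ V, blockOf π (rep V) = V)
    (i : ι) : ∑ V : {V // V ∈ π.parts}, circuitSum circ sgn i V * J (rep V) = 0 := by
  simp only [← sum_mul_blockCoeff]
  rw [← sum_mul_expand, ← hJ i]
  refine Finset.sum_congr rfl fun l _ => ?_
  rw [expand_blockCoeff, hJ'.apply_rep hrep]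

open scoped Classical in
/-- The limit of the sums over the closed labelings with kernel `π`, if one block is
eliminated. -/
noncomputable def elimLimit (circ : L → ι) (sgn : L → ℤ)
    (π : Finpartition (Finset.univ : Finset L)) (i : ι) (B : {V // V ∈ π.parts})
    (G : (L → ℝ) → ℝ) : ℝ :=
  if (∀ j, (fun k => ∑ l ∈ lettersOf circ j, sgn l * elimCoeff circ sgn π i B l k) = 0) ∧
    (∀ l l', elimCoeff circ sgn π i B l - elimCoeff circ sgn π i B l' = 0 ↔ π.part l = π.part l')
  then paramIntegral (elimCoeff circ sgn π i B) G else 0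

-- The coefficient of B in its circuit equation is its own inverse by `hB`, so the equation can be
-- solved for the label of B over the integers. The remaining conditions are again generically
-- constant and are recorded in `elimLimit`.
open scoped Classical in
theorem tendsto_sum_elim {i : ι} {B : {V // V ∈ π.parts}}
    (hB : circuitSum circ sgn i B * circuitSum circ sgn i B = 1)
    {m : ℕ → ℕ} (hm : Tendsto m atTop atTop)
    {w : ℕ → (L → ℤ) → ℝ} {G : (L → ℝ) → ℝ} (hw : IsScalingWeight m w G) (hw0 : ∀ n J, 0 ≤ w n J)
    {E : (L → ℤ) → 𝕜} {K : ℝ} (hK : ∀ J, ‖E J‖ ≤ K) {e : ℝ}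
    (he : ∀ J, IsKernel π J → E J = (e : 𝕜)) :
    Tendsto (fun n => (∑ J ∈ labelBox L (m n) with IsClosedLabeling circ sgn J ∧ IsKernel π J,
      (w n J : 𝕜) * E J) / (m n : 𝕜) ^ (π.parts.card - 1)) atTop
      (𝓝 ((e * elimLimit circ sgn π i B G : ℝ) : 𝕜)) := by
  obtain ⟨rep, hrep⟩ := exists_rep π
  have h1 : ∀ (z : {V : {V // V ∈ π.parts} // V ≠ B} → ℤ) (V), blockOf π (rep V) = V →
      ∀ hV : V ≠ B, expand (elimCoeff circ sgn π i B) z (rep V) = z ⟨V, hV⟩ := by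
    intro z V h hV
    rw [expand, Finset.sum_eq_single ⟨V, hV⟩]
    · simp [elimCoeff, h]
    · intro V' _ hne
      have : V ≠ V'.1 := fun hh => hne (Subtype.ext hh.symm)
      simp [elimCoeff, h, this, hV]
    · simp
  have h := tendsto_sum_expand_mul (𝕜 := 𝕜) (A := elimCoeff circ sgn π i B)
    (rep := fun V => rep V.1) (fun z V => h1 z V.1 (hrep V.1) V.2)
    (C := fun J => IsClosedLabeling circ sgn J ∧ IsKernel π J)
    (fun J hJ => funext fun l => by
      have hc := hJ.1.sum_circuitSum hJ.2 hrep i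
      rw [← hJ.2.apply_rep hrep l]
      by_cases hl : blockOf π l = B
      · rw [hl]
        have h2 : ∑ V : {V : {V // V ∈ π.parts} // V ≠ B}, circuitSum circ sgn i V.1 * J (rep V.1)
            = -(circuitSum circ sgn i B * J (rep B)) := by
          rw [← Finset.add_sum_erase _ _ (Finset.mem_univ B)] at hc
          rw [eq_neg_iff_add_eq_zero, add_comm, ← hc]
          congr 1
          refine (Finset.sum_subtype (Finset.univ.erase B) (fun V => by simp)
            (fun V : {V // V ∈ π.parts} => circuitSum circ sgn i V * J (rep V))).symm
        have h3 : expand (elimCoeff circ sgn π i B) (J ∘ fun V => rep V.1) l =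
            -(circuitSum circ sgn i B * ∑ V : {V : {V // V ∈ π.parts} // V ≠ B},
              circuitSum circ sgn i V.1 * J (rep V.1)) := by
          rw [expand, Finset.mul_sum, ← Finset.sum_neg_distrib]
          refine Finset.sum_congr rfl fun V _ => ?_
          have : B ≠ V.1 := fun hh => V.2 hh.symm
          simp only [elimCoeff, hl, this, if_false, if_true, Function.comp_apply]
          ring
        rw [h3, h2, mul_neg, neg_neg, ← mul_assoc, hB, one_mul]
      · rw [expand, Finset.sum_eq_single ⟨blockOf π l, hl⟩]
        · simp [elimCoeff]
        · intro V' _ hne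
          have : blockOf π l ≠ V'.1 := fun hh => hne (Subtype.ext hh.symm)
          simp [elimCoeff, this, hl]
        · simp)
    (isAEConst_expand circ sgn π _) hm hw hw0 hK (fun _ J hJ => he J hJ.2)
  rw [Fintype.card_subtype_compl, Fintype.card_coe, Fintype.card_subtype_eq] at h
  rw [elimLimit, mul_ite, mul_zero]
  convert h

-- Already the number of all labelings with kernel `π` is of lower order; closedness plays no part.
open scoped Classical in
theorem tendsto_sum_negligible {r : ℕ} (hr : π.parts.card < r)
    {m : ℕ → ℕ} (hm : Tendsto m atTop atTop)
    {w : ℕ → (L → ℤ) → ℝ} {G : (L → ℝ) → ℝ} (hw : IsScalingWeight m w G)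
    {E : (L → ℤ) → 𝕜} {K : ℝ} (hK : ∀ J, ‖E J‖ ≤ K) :
    Tendsto (fun n => (∑ J ∈ labelBox L (m n) with IsClosedLabeling circ sgn J ∧ IsKernel π J,
      (w n J : 𝕜) * E J) / (m n : 𝕜) ^ r) atTop (𝓝 0) := by
  have hK0 : 0 ≤ K := (norm_nonneg _).trans (hK 0)
  have hlim : Tendsto (fun n => 3 ^ π.parts.card * K / (m n : ℝ)) atTop (𝓝 0) :=
    Tendsto.const_div_atTop (tendsto_natCast_atTop_atTop.comp hm) _
  refine squeeze_zero_norm' ?_ hlim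
  filter_upwards [hm.eventually_ge_atTop 1] with n hn
  have hn1 : (1 : ℝ) ≤ m n := by exact_mod_cast hn
  have hn0 : (0 : ℝ) < m n := by linarith
  rw [norm_div, norm_pow, RCLike.norm_natCast, div_le_div_iff₀ (by positivity) hn0]
  have h1 : ‖∑ J ∈ labelBox L (m n) with IsClosedLabeling circ sgn J ∧ IsKernel π J,
      (w n J : 𝕜) * E J‖ ≤ (3 * m n : ℝ) ^ π.parts.card * K := by
    refine (norm_sum_le _ _).trans ((Finset.sum_le_card_nsmul _ _ K fun J _ => ?_).trans ?_)
    · rw [norm_mul, RCLike.norm_ofReal]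
      exact (mul_le_of_le_one_left (norm_nonneg _) (hw.le_one n J)).trans (hK J)
    · rw [nsmul_eq_mul]
      refine mul_le_mul_of_nonneg_right ?_ hK0
      have h2 : ((labelBox L (m n)).filter fun J => IsClosedLabeling circ sgn J ∧ IsKernel π J).card
          ≤ (3 * m n) ^ π.parts.card := by
        refine ((Finset.card_le_card fun J hJ => ?_).trans (card_filter_isKernel_le π (m n))).trans
          (Nat.pow_le_pow_left (by omega) _)
        rw [Finset.mem_filter] at hJ ⊢
        exact ⟨hJ.1, hJ.2.2⟩
      exact_mod_cast h2
  calc _ ≤ (3 * m n : ℝ) ^ π.parts.card * K * m n := by gcongr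
    _ = 3 ^ π.parts.card * K * (m n : ℝ) ^ (π.parts.card + 1) := by ring
    _ ≤ _ := by gcongr; exact hr

end KernelSums

/-! ### Block sizes and balance -/

section BlockSizes

variable {L ι : Type} [Fintype L] [DecidableEq L] [Fintype ι] [DecidableEq ι]
  {circ : L → ι} {kd : L → Bool} {sgn : L → ℤ} {π : Finpartition (Finset.univ : Finset L)}

theorem kindCount_add_kindCount_univ (V : Finset L) :
    kindCount kd Finset.univ V true + kindCount kd Finset.univ V false = V.card := by
  have h := Finset.card_filter_add_card_filter_not (s := V) (fun l => kd l = true)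
  rw [← h]
  unfold kindCount
  congr 2
  · ext l; simp
  · ext l; simp

theorem kindCount_le_univ (s V : Finset L) (c : Bool) :
    kindCount kd s V c ≤ kindCount kd Finset.univ V c :=
  Finset.card_le_card (Finset.filter_subset_filter _ (Finset.subset_univ s))

theorem sum_kindCount_lettersOf (circ : L → ι) (V : Finset L) (c : Bool) :
    ∑ i, kindCount kd (lettersOf circ i) V c = kindCount kd Finset.univ V c := by
  unfold kindCount
  rw [Finset.card_eq_sum_card_fiberwise (f := circ) (t := Finset.univ) (by simp)]
  refine Finset.sum_congr rfl fun i _ => ?_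
  congr 1
  ext l
  simp [lettersOf, and_comm]

theorem IsBalanced.kindCount_eq (hsgn : ∀ l, sgn l = if kd l then 1 else -1)
    (h : IsBalanced circ sgn π) {V : Finset L} (hV : V ∈ π.parts) (i : ι) :
    kindCount kd (lettersOf circ i) V true = kindCount kd (lettersOf circ i) V false := by
  have := h i V hV
  rw [circuitSum_eq hsgn] at this
  omega

theorem IsBalanced.kindCount_univ_eq (hsgn : ∀ l, sgn l = if kd l then 1 else -1)
    (h : IsBalanced circ sgn π) {V : Finset L} (hV : V ∈ π.parts) :
    kindCount kd Finset.univ V true = kindCount kd Finset.univ V false := by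
  rw [← sum_kindCount_lettersOf circ, ← sum_kindCount_lettersOf circ]
  exact Finset.sum_congr rfl fun i _ => h.kindCount_eq hsgn hV i

theorem two_mul_card_parts_le (h : ∀ V ∈ π.parts, 2 ≤ V.card) :
    2 * π.parts.card ≤ Fintype.card L := by
  rw [← Finset.card_univ, ← π.sum_card_parts, mul_comm, ← smul_eq_mul]
  exact Finset.card_nsmul_le_sum _ _ _ h

theorem card_eq_two_of_two_mul_card_parts (h : ∀ V ∈ π.parts, 2 ≤ V.card)
    (h2 : Fintype.card L = 2 * π.parts.card) : ∀ V ∈ π.parts, V.card = 2 := by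
  have h3 : ∑ V ∈ π.parts, 2 = ∑ V ∈ π.parts, V.card := by
    rw [π.sum_card_parts, Finset.card_univ, h2, Finset.sum_const, smul_eq_mul, mul_comm]
  exact fun V hV => ((Finset.sum_eq_sum_iff_of_le h).1 h3 V hV).symm

theorem two_mul_card_parts_of_card_eq_two (h : ∀ V ∈ π.parts, V.card = 2) :
    Fintype.card L = 2 * π.parts.card := by
  rw [← Finset.card_univ, ← π.sum_card_parts, Finset.sum_congr rfl h, Finset.sum_const,
    smul_eq_mul, mul_comm]

/-- The total excess of the block sizes over two is two, so a single block can absorb no more than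
that. -/
theorem card_le_four_of_two_mul_card_parts (h : ∀ V ∈ π.parts, 2 ≤ V.card)
    (h2 : Fintype.card L = 2 * π.parts.card + 2) : ∀ V ∈ π.parts, V.card ≤ 4 := by
  intro V hV
  have h3 := π.sum_card_parts
  rw [Finset.card_univ, h2, ← Finset.add_sum_erase _ _ hV] at h3
  have h4 : (π.parts.erase V).card * 2 ≤ ∑ V ∈ π.parts.erase V, V.card := by
    rw [← smul_eq_mul]
    exact Finset.card_nsmul_le_sum _ _ _ fun W hW => h W (Finset.mem_of_mem_erase hW)
  rw [Finset.card_erase_of_mem hV] at h4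
  have := Finset.card_pos.2 ⟨V, hV⟩
  omega

theorem IsKernel.exists_unique_letter {J : L → ℤ} (hJ : IsKernel π J) {V : Finset L}
    (hV : V ∈ π.parts) (h : V.card < 2) : ∃ l, ∀ l', l' ≠ l → J l' ≠ J l := by
  obtain ⟨l, hl⟩ := π.nonempty_of_mem_parts hV
  refine ⟨l, fun l' hne he => hne ?_⟩
  rw [hJ, π.part_eq_of_mem hV hl, π.part_eq_iff_mem hV] at he
  exact Finset.card_le_one.1 (by omega) l' he l hl

open scoped Classical in
theorem sum_closed_eq_sum_isKernel {E : Type*} [AddCommMonoid E] (m : ℕ) (f : (L → ℤ) → E) :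
    ∑ J ∈ labelBox L m with IsClosedLabeling circ sgn J, f J =
      ∑ π, ∑ J ∈ labelBox L m with IsClosedLabeling circ sgn J ∧ IsKernel π J, f J := by
  rw [sum_eq_sum_isKernel]
  simp only [Finset.filter_filter]

end BlockSizes

/-! ### Limits of means and covariances -/

section Limits

variable {L : Type} [Fintype L] [DecidableEq L] {kd : L → Bool} {sgn : L → ℤ} {M : ℕ}
  {mom : ℕ → ℕ → ℝ}

open scoped Classical in
/-- The limit of the expectations. -/
theorem IsEntryFamily.tendsto_sum_mean {ι : Type} [Fintype ι] [DecidableEq ι] {circ : L → ι}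
    {𝕜 : Type*} [RCLike 𝕜] {Ω : Type*} [MeasurableSpace Ω]
    {μ : Measure Ω} [IsProbabilityMeasure μ] {a : ℤ → Ω → 𝕜} (ha : IsEntryFamily mom μ a)
    (hcard : Fintype.card L = 2 * M) (hsgn : ∀ l, sgn l = if kd l then 1 else -1)
    {m : ℕ → ℕ} (hm : Tendsto m atTop atTop)
    {w : ℕ → (L → ℤ) → ℝ} {G : (L → ℝ) → ℝ} (hw : IsScalingWeight m w G)
    (hw0 : ∀ n J, 0 ≤ w n J) :
    Tendsto (fun n => (∑ J ∈ labelBox L (m n) with IsClosedLabeling circ sgn J,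
      (w n J : 𝕜) * ∫ ω, letterProd a kd J Finset.univ ω ∂μ) / (m n : 𝕜) ^ M) atTop
      (𝓝 ((∑ π : Finpartition (Finset.univ : Finset L) with ∀ V ∈ π.parts, V.card = 2,
        if IsBalanced circ sgn π then paramIntegral (blockCoeff π) G else 0 : ℝ) : 𝕜)) := by
  simp only [sum_closed_eq_sum_isKernel, Finset.sum_div Finset.univ,
    Finset.sum_filter (s := Finset.univ)]
  rw [RCLike.ofReal_sum]
  obtain ⟨K, hK0, hK⟩ := ha.exists_letterProd_bound (kd := kd) 1
  have hE : ∀ J : L → ℤ, ‖∫ ω, letterProd a kd J Finset.univ ω ∂μ‖ ≤ K := fun J =>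
    (norm_integral_le_integral_norm _).trans (by simpa using hK J Finset.univ)
  refine tendsto_finsetSum (M := 𝕜) _ fun π _ => ?_
  -- In a balanced pair partition each block has one letter of each kind, and the expectation is
  -- one. An unbalanced pair partition loses a parameter to the closing equation. Any other
  -- partition has a singleton or fewer than M blocks.
  split_ifs with hπ hb
  · have h := tendsto_sum_blocks (circ := circ) (sgn := sgn) (π := π) hm hw hw0 hE (e := 1)
      fun hb J hJ => by
        have h1 : ∀ V ∈ π.parts, kindCount kd Finset.univ V true = 1 ∧
            kindCount kd Finset.univ V false = 1 := fun V hV => by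
          have := kindCount_add_kindCount_univ (kd := kd) V
          rw [hπ V hV, hb.kindCount_univ_eq hsgn hV] at this
          have := hb.kindCount_univ_eq hsgn hV
          omega
        rw [ha.integral_letterProd hJ _ fun V hV => by have := h1 V hV; omega,
          Finset.prod_eq_one fun V hV => by rw [(h1 V hV).1, (h1 V hV).2, ha.mom_one]]
    have hM : π.parts.card = M := by
      have := two_mul_card_parts_of_card_eq_two hπ
      omega
    simpa [hM, hb] using h
  · have h := tendsto_sum_blocks (circ := circ) (sgn := sgn) (π := π) hm hw hw0 hE (e := 1)
      fun hb' => absurd hb' hb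
    have hM : π.parts.card = M := by
      have := two_mul_card_parts_of_card_eq_two hπ
      omega
    simpa [hM, hb] using h
  · rw [RCLike.ofReal_zero]
    by_cases h2 : ∀ V ∈ π.parts, 2 ≤ V.card
    · refine tendsto_sum_negligible ?_ hm hw hE
      have h3 := two_mul_card_parts_le h2
      by_contra h4
      exact hπ (card_eq_two_of_two_mul_card_parts h2 (by omega))
    · push Not at h2
      obtain ⟨V, hV, h3⟩ := h2
      refine tendsto_const_nhds.congr fun n => ?_
      rw [Finset.sum_eq_zero, zero_div]
      intro J hJ
      obtain ⟨l, hl⟩ := (Finset.mem_filter.1 hJ).2.2.exists_unique_letter hV h3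
      rw [integral_letterProd_eq_zero_of_unique ha (Finset.mem_univ l) fun l' _ => hl l', mul_zero]

theorem devMean_two {𝕜 : Type*} [RCLike 𝕜] {Ω : Type*} [MeasurableSpace Ω]
    {μ : Measure Ω} [IsProbabilityMeasure μ] {a : ℤ → Ω → 𝕜} (ha : IsEntryFamily mom μ a)
    (circ : L → Fin 2) (J : L → ℤ) :
    devMean μ a circ kd J Finset.univ = ∫ ω, letterProd a kd J Finset.univ ω ∂μ -
      (∫ ω, letterProd a kd J (lettersOf circ 0) ω ∂μ) *
        ∫ ω, letterProd a kd J (lettersOf circ 1) ω ∂μ := by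
  have hu : ∀ ω, letterProd a kd J (lettersOf circ 0) ω * letterProd a kd J (lettersOf circ 1) ω =
      letterProd a kd J Finset.univ ω := by
    intro ω
    unfold letterProd lettersOf
    rw [← Finset.prod_fiberwise Finset.univ circ, Fin.prod_univ_two]
  have h0 := ha.hasMoments_letterProd (kd := kd) (J := J) (lettersOf circ 0)
  have h1 := ha.hasMoments_letterProd (kd := kd) (J := J) (lettersOf circ 1)
  unfold devMean circDev
  simp only [Fin.prod_univ_two]
  set e0 := ∫ ω, letterProd a kd J (lettersOf circ 0) ω ∂μ
  set e1 := ∫ ω, letterProd a kd J (lettersOf circ 1) ω ∂μ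
  have e : ∀ ω, (letterProd a kd J (lettersOf circ 0) ω - e0) *
      (letterProd a kd J (lettersOf circ 1) ω - e1) = letterProd a kd J Finset.univ ω -
      e1 * letterProd a kd J (lettersOf circ 0) ω -
      e0 * letterProd a kd J (lettersOf circ 1) ω + e0 * e1 := fun ω => by
    rw [← hu]; ring
  have hu' := (ha.hasMoments_letterProd (kd := kd) (J := J) Finset.univ).integrable
  have i0 : Integrable (fun ω => e1 * letterProd a kd J (lettersOf circ 0) ω) μ :=
    h0.integrable.const_mul _
  have i1 : Integrable (fun ω => e0 * letterProd a kd J (lettersOf circ 1) ω) μ :=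
    h1.integrable.const_mul _
  have i2 : Integrable (fun ω => letterProd a kd J Finset.univ ω -
      e1 * letterProd a kd J (lettersOf circ 0) ω) μ := hu'.sub i0
  have i3 : Integrable (fun ω => letterProd a kd J Finset.univ ω -
      e1 * letterProd a kd J (lettersOf circ 0) ω -
      e0 * letterProd a kd J (lettersOf circ 1) ω) μ := i2.sub i1
  simp only [e]
  rw [integral_add i3 (integrable_const _), integral_sub i2 i1, integral_sub hu' i0,
    integral_const_mul, integral_const_mul]
  simp only [integral_const, probReal_univ, one_smul]
  change _ - e1 * e0 - e0 * e1 + e0 * e1 = _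
  ring

/-- The value of the covariance at the labelings with kernel `π`. -/
def kernelCov (mom : ℕ → ℕ → ℝ) (circ : L → Fin 2) (kd : L → Bool)
    (π : Finpartition (Finset.univ : Finset L)) : ℝ :=
  (∏ V ∈ π.parts, mom (kindCount kd Finset.univ V true) (kindCount kd Finset.univ V false)) -
    (∏ V ∈ π.parts, mom (kindCount kd (lettersOf circ 0) V true)
      (kindCount kd (lettersOf circ 0) V false)) *
    ∏ V ∈ π.parts, mom (kindCount kd (lettersOf circ 1) V true)
      (kindCount kd (lettersOf circ 1) V false)

/-- In a balanced block of at most four letters both kinds occur equally often, overall and on each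
circuit, so the counts are (0, 0), (1, 1) or (2, 2). In a pair the total is at most two anyway. -/
theorem devMean_eq_kernelCov {𝕜 : Type*} [RCLike 𝕜] {Ω : Type*} [MeasurableSpace Ω]
    {μ : Measure Ω} [IsProbabilityMeasure μ] {a : ℤ → Ω → 𝕜} (ha : IsEntryFamily mom μ a)
    {circ : L → Fin 2} {π : Finpartition (Finset.univ : Finset L)} {J : L → ℤ}
    (hJ : IsKernel π J) (h : (∀ V ∈ π.parts, V.card = 2) ∨
      (∀ l, sgn l = if kd l then 1 else -1) ∧ IsBalanced circ sgn π ∧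
        ∀ V ∈ π.parts, V.card ≤ 4) :
    devMean μ a circ kd J Finset.univ = (kernelCov mom circ kd π : 𝕜) := by
  have hle := fun s V => kindCount_le_univ (kd := kd) s V true
  have hle' := fun s V => kindCount_le_univ (kd := kd) s V false
  have hadd := kindCount_add_kindCount_univ (kd := kd)
  have key : (∀ V ∈ π.parts, kindCount kd Finset.univ V true + kindCount kd Finset.univ V false ≤ 2
      ∨ kindCount kd Finset.univ V true = 2 ∧ kindCount kd Finset.univ V false = 2) ∧
      ∀ i, ∀ V ∈ π.parts, kindCount kd (lettersOf circ i) V true +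
        kindCount kd (lettersOf circ i) V false ≤ 2 ∨ kindCount kd (lettersOf circ i) V true = 2 ∧
        kindCount kd (lettersOf circ i) V false = 2 := by
    rcases h with h | ⟨hsgn, hb, h⟩
    · refine ⟨fun V hV => ?_, fun i V hV => ?_⟩
      · have := h V hV
        have := hadd V
        omega
      · have := h V hV
        have := hadd V
        have := hle (lettersOf circ i) V
        have := hle' (lettersOf circ i) V
        omega
    · refine ⟨fun V hV => ?_, fun i V hV => ?_⟩
      · have := h V hV
        have := hadd V
        have := hb.kindCount_univ_eq hsgn hV
        omega
      · have := h V hV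
        have := hadd V
        have := hb.kindCount_univ_eq hsgn hV
        have := hb.kindCount_eq hsgn hV i
        have := hle (lettersOf circ i) V
        omega
  rw [devMean_two ha, ha.integral_letterProd hJ _ key.1, ha.integral_letterProd hJ _ (key.2 0),
    ha.integral_letterProd hJ _ (key.2 1), kernelCov]
  push_cast
  rfl

-- The extra factor m asks for the order m^(M-1). It is attained by linked pair partitions, which
-- lose one parameter to a circuit equation, and by balanced partitions into M - 1 blocks, which
-- cannot afford to lose any. The constant is chosen before the random model, so it depends on the
-- entries only through `mom`.
open scoped Classical in
theorem exists_tendsto_sum_devMean_isKernel (mom : ℕ → ℕ → ℝ) (hcard : Fintype.card L = 2 * M)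
    (hsgn : ∀ l, sgn l = if kd l then 1 else -1) (circ : L → Fin 2) (G : (L → ℝ) → ℝ)
    (π : Finpartition (Finset.univ : Finset L)) (𝕜 : Type*) [RCLike 𝕜] :
    ∃ c : ℝ, ∀ (Ω : Type u) [MeasurableSpace Ω] (μ : Measure Ω) [IsProbabilityMeasure μ]
      (a : ℤ → Ω → 𝕜) (m : ℕ → ℕ) (w : ℕ → (L → ℤ) → ℝ), IsEntryFamily mom μ a →
      Tendsto m atTop atTop → IsScalingWeight m w G → (∀ n J, 0 ≤ w n J) →
      Tendsto (fun n => (m n : 𝕜) *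
        (∑ J ∈ labelBox L (m n) with IsClosedLabeling circ sgn J ∧ IsKernel π J,
          (w n J : 𝕜) * devMean μ a circ kd J Finset.univ) / (m n : 𝕜) ^ M) atTop
        (𝓝 (c : 𝕜)) := by
  have hzero : (∀ (Ω : Type u) [MeasurableSpace Ω] (μ : Measure Ω) [IsProbabilityMeasure μ]
      (a : ℤ → Ω → 𝕜), IsEntryFamily mom μ a → ∀ J, IsKernel π J →
        devMean μ a circ kd J Finset.univ = 0) → ∃ c : ℝ, ∀ (Ω : Type u) [MeasurableSpace Ω]
      (μ : Measure Ω) [IsProbabilityMeasure μ]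
      (a : ℤ → Ω → 𝕜) (m : ℕ → ℕ) (w : ℕ → (L → ℤ) → ℝ), IsEntryFamily mom μ a →
      Tendsto m atTop atTop → IsScalingWeight m w G → (∀ n J, 0 ≤ w n J) →
      Tendsto (fun n => (m n : 𝕜) *
        (∑ J ∈ labelBox L (m n) with IsClosedLabeling circ sgn J ∧ IsKernel π J,
          (w n J : 𝕜) * devMean μ a circ kd J Finset.univ) / (m n : 𝕜) ^ M) atTop
        (𝓝 (c : 𝕜)) := by
    refine fun h => ⟨0, fun Ω _ μ _ a m w ha _ _ _ => tendsto_const_nhds.congr fun n => ?_⟩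
    rw [RCLike.ofReal_zero, Finset.sum_eq_zero, mul_zero, zero_div]
    intro J hJ
    rw [h Ω μ a ha J (Finset.mem_filter.1 hJ).2.2, mul_zero]
  by_cases h2 : ∀ V ∈ π.parts, 2 ≤ V.card
  swap
  · push Not at h2
    obtain ⟨V, hV, h3⟩ := h2
    refine hzero fun Ω _ μ _ a ha J hJ => ?_
    obtain ⟨l, hl⟩ := hJ.exists_unique_letter hV h3
    exact devMean_eq_zero_of_unique ha (Finset.mem_univ _) fun l' _ => hl l'
  by_cases hX : ∃ l l', circ l = 0 ∧ circ l' ≠ 0 ∧ π.part l = π.part l'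
  swap
  · push Not at hX
    refine hzero fun Ω _ μ _ a ha J hJ => ?_
    refine devMean_eq_zero_of_not_linked ha (Finset.mem_univ 0) fun l l' h1 _ h3 he => ?_
    exact hX l l' h1 h3 ((hJ l l').1 he)
  have h2M := two_mul_card_parts_le h2
  obtain ⟨l0, l1, hl0, hl1, hll⟩ := hX
  have hpos : 0 < M := by
    have := Fintype.card_pos_iff.2 ⟨l0⟩
    omega
  have hscale : ∀ (m : ℕ → ℕ) (S : ℕ → 𝕜) (x : 𝕜), Tendsto m atTop atTop →
      Tendsto (fun n => S n / (m n : 𝕜) ^ (M - 1)) atTop (𝓝 x) →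
      Tendsto (fun n => (m n : 𝕜) * S n / (m n : 𝕜) ^ M) atTop (𝓝 x) := by
    intro m S x hm h
    refine h.congr' ?_
    filter_upwards [hm.eventually_ge_atTop 1] with n hn
    have hn0 : (m n : 𝕜) ≠ 0 := Nat.cast_ne_zero.2 (by omega)
    obtain ⟨r, rfl⟩ : ∃ r, M = r + 1 := ⟨M - 1, by omega⟩
    rw [Nat.add_sub_cancel, pow_succ', mul_div_mul_left _ _ hn0]
  by_cases hM : π.parts.card = M
  -- The linking pair {l0, l1} meets circuit 0 in `l0` alone, so its coefficient in that circuit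
  -- equation is a sign and its block can be eliminated.
  · have hpair := card_eq_two_of_two_mul_card_parts h2 (by omega)
    have hV : ({l0, l1} : Finset L) = π.part l0 := by
      refine Finset.eq_of_subset_of_card_le (fun l hl => ?_) ?_
      · rw [Finset.mem_insert, Finset.mem_singleton] at hl
        rw [π.mem_part_iff_part_eq_part (Finset.mem_univ _) (Finset.mem_univ _)]
        rcases hl with rfl | rfl
        · rfl
        · exact hll.symm
      · rw [hpair (π.part l0) (blockOf π l0).2, Finset.card_pair]
        rintro rfl
        exact hl1 hl0
    have hB : circuitSum circ sgn 0 (blockOf π l0) = sgn l0 := by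
      have : (lettersOf circ 0).filter (· ∈ (blockOf π l0 : Finset L)) = {l0} := by
        ext l
        rw [Finset.mem_filter, mem_lettersOf, show (blockOf π l0 : Finset L) = {l0, l1} from hV.symm,
          Finset.mem_insert, Finset.mem_singleton, Finset.mem_singleton]
        constructor
        · rintro ⟨h1, rfl | rfl⟩
          · rfl
          · exact absurd h1 hl1
        · rintro rfl
          exact ⟨hl0, Or.inl rfl⟩
      rw [circuitSum, this, Finset.sum_singleton]
    have hB' : circuitSum circ sgn 0 (blockOf π l0) * circuitSum circ sgn 0 (blockOf π l0) = 1 := by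
      rw [hB, hsgn]
      split_ifs <;> rfl
    refine ⟨kernelCov mom circ kd π * elimLimit circ sgn π 0 (blockOf π l0) G,
      fun Ω _ μ _ a m w ha hm hw hw0 => ?_⟩
    obtain ⟨K, hK0, hK⟩ := ha.exists_devMean_bound circ kd
    refine hscale m _ _ hm ?_
    rw [← hM]
    exact tendsto_sum_elim hB' hm hw hw0 (fun J => hK J Finset.univ) fun J hJ =>
      devMean_eq_kernelCov (sgn := sgn) ha hJ (Or.inl hpair)
  by_cases hM1 : π.parts.card = M - 1
  -- All M - 1 blocks must stay free. Unbalanced partitions therefore drop out, among them those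
  -- with blocks of three letters, whose moments are not prescribed.
  · have h4 := card_le_four_of_two_mul_card_parts h2 (by omega)
    refine ⟨if IsBalanced circ sgn π then kernelCov mom circ kd π *
      paramIntegral (blockCoeff π) G else 0, fun Ω _ μ _ a m w ha hm hw hw0 => ?_⟩
    obtain ⟨K, hK0, hK⟩ := ha.exists_devMean_bound circ kd
    refine hscale m _ _ hm ?_
    rw [← hM1]
    exact tendsto_sum_blocks hm hw hw0 (fun J => hK J Finset.univ) fun hb J hJ =>
      devMean_eq_kernelCov ha hJ (Or.inr ⟨hsgn, hb, h4⟩)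
  · refine ⟨0, fun Ω _ μ _ a m w ha hm hw hw0 => ?_⟩
    obtain ⟨K, hK0, hK⟩ := ha.exists_devMean_bound circ kd
    refine hscale m _ _ hm ?_
    rw [RCLike.ofReal_zero]
    exact tendsto_sum_negligible (by omega) hm hw fun J => hK J Finset.univ

open scoped Classical in
/-- The limit of the covariances. -/
theorem exists_tendsto_sum_devMean (mom : ℕ → ℕ → ℝ) (hcard : Fintype.card L = 2 * M)
    (hsgn : ∀ l, sgn l = if kd l then 1 else -1) (circ : L → Fin 2) (G : (L → ℝ) → ℝ)
    (𝕜 : Type*) [RCLike 𝕜] :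
    ∃ c : ℝ, ∀ (Ω : Type u) [MeasurableSpace Ω] (μ : Measure Ω) [IsProbabilityMeasure μ]
      (a : ℤ → Ω → 𝕜) (m : ℕ → ℕ) (w : ℕ → (L → ℤ) → ℝ), IsEntryFamily mom μ a →
      Tendsto m atTop atTop → IsScalingWeight m w G → (∀ n J, 0 ≤ w n J) →
      Tendsto (fun n => (m n : 𝕜) *
        (∑ J ∈ labelBox L (m n) with IsClosedLabeling circ sgn J,
          (w n J : 𝕜) * devMean μ a circ kd J Finset.univ) / (m n : 𝕜) ^ M) atTop
        (𝓝 (c : 𝕜)) := by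
  choose c hc using fun π => exists_tendsto_sum_devMean_isKernel.{u} mom hcard hsgn circ G π 𝕜
  refine ⟨∑ π, c π, fun Ω _ μ _ a m w ha hm hw hw0 => ?_⟩
  simp only [sum_closed_eq_sum_isKernel, Finset.mul_sum _ _ (Nat.cast _), Finset.sum_div]
  rw [RCLike.ofReal_sum]
  refine tendsto_finsetSum (M := 𝕜) _ fun π _ => ?_
  refine (hc π Ω μ a m w ha hm hw hw0).congr fun n => ?_
  rw [Finset.mul_sum, Finset.sum_div]

end Limits

/-! ### Limits of normalised traces -/

section TraceLimits

variable {m : ℕ → ℕ} {b : ℝ} {s : ℕ}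

theorem letterSign_eq_ite (s l : ℕ) : letterSign s l = if letterConj s l then 1 else -1 := by
  simp only [letterSign, letterConj, decide_eq_true_eq]
  split_ifs with h
  · exact h.neg_one_pow
  · exact (Nat.not_even_iff_odd.1 h).neg_one_pow

/-- The proportion of the starting points from which the path with steps `y` stays inside. -/
noncomputable def pathWeight (s n : ℕ) {N : ℕ} (y : Fin N → ℤ) : ℝ :=
  (pathCount n (partialSums (letterSign s) y) : ℝ) / n

theorem pathWeight_nonneg (s n : ℕ) {N : ℕ} (y : Fin N → ℤ) : 0 ≤ pathWeight s n y :=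
  pathCount_div_nonneg _ _

theorem pathWeight_le_one (s n : ℕ) {N : ℕ} (y : Fin N → ℤ) : pathWeight s n y ≤ 1 :=
  pathCount_div_le_one _ _

/-- The limit of the path weights. -/
noncomputable def limitWeight (s : ℕ) (b : ℝ) {N : ℕ} (X : Fin N → ℝ) : ℝ :=
  max 0 (1 - b * spread fun k : Fin N => ∑ l ∈ Finset.Iic k, (-1 : ℝ) ^ ((l : ℕ) / s) * X l)

theorem tendsto_pathWeight (hm : IsBandwidth m b) {N : ℕ} {x : ℕ → Fin N → ℤ} {X : Fin N → ℝ}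
    (hx : ∀ l, Tendsto (fun n => (x n l : ℝ) / m n) atTop (𝓝 (X l))) :
    Tendsto (fun n => pathWeight s n (x n)) atTop (𝓝 (limitWeight s b X)) := by
  refine tendsto_pathCount_div hm fun k => ?_
  refine (tendsto_finsetSum (Finset.Iic k)
    fun l _ => (hx l).const_mul ((-1 : ℝ) ^ ((l : ℕ) / s))).congr fun n => ?_
  simp only [partialSums, letterSign]
  push_cast
  rw [Finset.sum_div]
  exact Finset.sum_congr rfl fun l _ => (mul_div_assoc _ _ _).symm

theorem isScalingWeight_pathWeight (hm : IsBandwidth m b) (s N : ℕ) :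
    IsScalingWeight m (fun n (y : Fin N → ℤ) => pathWeight s n y) (limitWeight s b) where
  le_one n y := by
    rw [abs_of_nonneg (pathWeight_nonneg s n y)]
    exact pathWeight_le_one s n y
  tendsto _ _ hx := tendsto_pathWeight hm hx

theorem isScalingWeight_prod_pathWeight (hm : IsBandwidth m b) (s : ℕ) {ι : Type} [Fintype ι]
    (N : ι → ℕ) :
    IsScalingWeight m (fun n (J : (Σ i, Fin (N i)) → ℤ) => ∏ i, pathWeight s n fun l => J ⟨i, l⟩)
      (fun X => ∏ i, limitWeight s b fun l => X ⟨i, l⟩) where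
  le_one n y := by
    rw [abs_of_nonneg (Finset.prod_nonneg fun i _ => pathWeight_nonneg s n _)]
    exact Finset.prod_le_one (fun i _ => pathWeight_nonneg s n _) fun i _ => pathWeight_le_one s n _
  tendsto _ _ hx := tendsto_finsetProd _ fun i _ => tendsto_pathWeight hm fun l => hx ⟨i, l⟩

theorem mem_closedWords_iff {N M : ℕ} {y : Fin N → ℤ} : y ∈ closedWords (letterSign s) N M ↔
    y ∈ labelBox (Fin N) M ∧
      IsClosedLabeling (fun _ => (0 : Fin 1)) (fun l : Fin N => letterSign s l) y := by
  simp [closedWords, IsClosedLabeling]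

variable {𝕜 : Type*} [RCLike 𝕜] {Ω : Type*} [MeasurableSpace Ω] {μ : Measure Ω}
  [IsProbabilityMeasure μ] {mom : ℕ → ℕ → ℝ} {a : ℤ → Ω → 𝕜}



theorem normalized_trace (hs : 1 ≤ s) (n M : ℕ) (p : ℕ) (ω : Ω) :
    (1 / (n : 𝕜)) * (powerMatrix s n M (fun j => a j ω) ^ p).trace =
      ((M : 𝕜) ^ (p * s))⁻¹ * ∑ y ∈ closedWords (letterSign s) (2 * p * s) M,
        (pathWeight s n y : 𝕜) *
          letterProd a (fun l : Fin (2 * p * s) => letterConj s l) y Finset.univ ω := by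
  rw [trace_powerMatrix_pow hs, ← mul_assoc, mul_comm (1 / (n : 𝕜)), mul_assoc, Finset.mul_sum]
  congr 1
  refine Finset.sum_congr rfl fun y _ => ?_
  rw [pathWeight, letterProd]
  push_cast
  ring

open scoped Classical in
/-- The limit of the moments. -/
theorem IsEntryFamily.tendsto_integral_trace (ha : IsEntryFamily mom μ a) (hs : 1 ≤ s)
    (hm : IsBandwidth m b) (p : ℕ) :
    Tendsto (fun n : ℕ => ∫ ω, (1 / (n : 𝕜)) *
      (powerMatrix s n (m n) (fun j => a j ω) ^ p).trace ∂μ) atTop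
      (𝓝 ((∑ π ∈ pairPartitions (2 * p * s),
        if IsBalanced (fun _ => (0 : Fin 1)) (fun l : Fin (2 * p * s) => letterSign s l) π
        then paramIntegral (blockCoeff π) (limitWeight s b) else 0 : ℝ) : 𝕜)) := by
  refine (ha.tendsto_sum_mean (M := p * s) (circ := fun _ => (0 : Fin 1))
    (by rw [Fintype.card_fin, mul_assoc])
    (fun l : Fin (2 * p * s) => letterSign_eq_ite s l) hm.tendsto_atTop
    (isScalingWeight_pathWeight hm s _) fun n y => pathWeight_nonneg s n y).congr fun n => ?_
  simp only [normalized_trace hs]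
  rw [integral_const_mul, integral_finsetSum _ fun y _ =>
    ((HasMoments.const _).mul (ha.hasMoments_letterProd _)).integrable, div_eq_inv_mul]
  simp only [integral_const_mul]
  congr 1
  refine Finset.sum_congr ?_ fun _ _ => rfl
  ext y
  rw [mem_closedWords_iff, Finset.mem_filter]

/-- The fluctuation of the normalised trace of a power. -/
noncomputable def traceDev (s : ℕ) (μ : Measure Ω) (a : ℤ → Ω → 𝕜) (n M p : ℕ) (ω : Ω) : 𝕜 :=
  ((M : 𝕜) ^ (p * s))⁻¹ * ∑ y ∈ closedWords (letterSign s) (2 * p * s) M,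
    (pathWeight s n y : 𝕜) * wordDev μ a (fun l : Fin (2 * p * s) => letterConj s l) y ω

theorem IsEntryFamily.hasMoments_traceDev (ha : IsEntryFamily mom μ a) (n M p : ℕ) :
    HasMoments (traceDev s μ a n M p) μ :=
  (HasMoments.const _).mul (HasMoments.sum fun _ _ =>
    (HasMoments.const _).mul (ha.hasMoments_wordDev _ _))

theorem IsEntryFamily.traceDev_eq (ha : IsEntryFamily mom μ a) (hs : 1 ≤ s) (n M p : ℕ) (ω : Ω) :
    traceDev s μ a n M p ω =
      (1 / (n : 𝕜)) * (powerMatrix s n M (fun j => a j ω) ^ p).trace -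
        ∫ ω', (1 / (n : 𝕜)) * (powerMatrix s n M (fun j => a j ω') ^ p).trace ∂μ := by
  simp only [normalized_trace hs]
  rw [integral_const_mul, integral_finsetSum _ fun y _ =>
    ((HasMoments.const _).mul (ha.hasMoments_letterProd _)).integrable]
  simp only [integral_const_mul]
  rw [← mul_sub, ← Finset.sum_sub_distrib, traceDev]
  congr 1
  refine Finset.sum_congr rfl fun y _ => ?_
  rw [wordDev, mul_sub]

/-- The words of the factors are glued to one labeling of the disjoint union of their positions,
with `Sigma.fst` as circuit map. -/
theorem integral_prod_traceDev (ha : IsEntryFamily mom μ a) (n M : ℕ) {ι : Type} [Fintype ι]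
    [DecidableEq ι] (p : ι → ℕ) :
    ∫ ω, ∏ i, traceDev s μ a n M (p i) ω ∂μ =
      (∑ f ∈ Fintype.piFinset fun i => closedWords (letterSign s) (2 * p i * s) M,
        ((∏ i, pathWeight s n (f i) : ℝ) : 𝕜) * devMean μ a Sigma.fst
          (fun l : Σ i, Fin (2 * p i * s) => letterConj s l.2) (fun l => f l.1 l.2) Finset.univ) /
        (M : 𝕜) ^ ∑ i, p i * s := by
  simp only [traceDev, Finset.prod_mul_distrib, Finset.prod_inv_distrib,
    Finset.prod_pow_eq_pow_sum]
  rw [integral_const_mul, div_eq_inv_mul]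
  congr 1
  simp only [Finset.prod_univ_sum]
  rw [integral_finsetSum _ fun f _ => (HasMoments.prod fun i _ =>
    (HasMoments.const _).mul (ha.hasMoments_wordDev _ _)).integrable]
  refine Finset.sum_congr rfl fun f _ => ?_
  simp only [Finset.prod_mul_distrib]
  rw [integral_const_mul, RCLike.ofReal_prod]
  congr 1
  unfold devMean
  refine integral_congr_ae (Eventually.of_forall fun ω => Finset.prod_congr rfl fun i _ => ?_)
  rw [circDev_sigma (fun i (l : Fin (2 * p i * s)) => letterConj s l) f i]

open scoped Classical in
theorem sum_piFinset_closedWords {E : Type*} [AddCommMonoid E] {ι : Type} [Fintype ι]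
    [DecidableEq ι] (N : ι → ℕ) (M : ℕ) (F : ((Σ i, Fin (N i)) → ℤ) → E) :
    ∑ f ∈ Fintype.piFinset fun i => closedWords (letterSign s) (N i) M, F (fun l => f l.1 l.2) =
      ∑ J ∈ labelBox (Σ i, Fin (N i)) M with
        IsClosedLabeling Sigma.fst (fun l => letterSign s l.2) J, F J := by
  have hcl : ∀ (J : (Σ i, Fin (N i)) → ℤ) (i : ι),
      ∑ l ∈ Finset.univ.filter (fun l : Σ i, Fin (N i) => l.1 = i), letterSign s l.2 * J l =
        ∑ l : Fin (N i), letterSign s l * J ⟨i, l⟩ := by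
    intro J i
    have := lettersOf_fst_eq (N := N) i
    unfold lettersOf at this
    rw [this, Finset.sum_map]
    rfl
  refine Finset.sum_nbij' (fun f l => f l.1 l.2) (fun J i l => J ⟨i, l⟩) ?_ ?_ ?_ ?_ ?_
  · intro f hf
    rw [Fintype.mem_piFinset] at hf
    refine Finset.mem_filter.2 ⟨mem_labelBox.2 fun l => (mem_closedWords.1 (hf l.1)).1 l.2,
      fun i => ?_⟩
    rw [hcl]
    exact (mem_closedWords.1 (hf i)).2
  · intro J hJ
    obtain ⟨h1, h2⟩ := Finset.mem_filter.1 hJ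
    rw [mem_labelBox] at h1
    rw [Fintype.mem_piFinset]
    exact fun i => mem_closedWords.2 ⟨fun l => h1 _, by rw [← hcl]; exact h2 i⟩
  · intro f _
    rfl
  · intro J _
    rfl
  · intro f _
    rfl

/-- The limit of the covariances of the normalised traces. -/
theorem exists_tendsto_integral_traceDev (mom : ℕ → ℕ → ℝ) (s : ℕ) (b : ℝ) (p : Fin 2 → ℕ)
    (𝕜 : Type*) [RCLike 𝕜] :
    ∃ c : ℝ, ∀ (Ω : Type u) [MeasurableSpace Ω] (μ : Measure Ω) [IsProbabilityMeasure μ]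
      (a : ℤ → Ω → 𝕜) (m : ℕ → ℕ), IsEntryFamily mom μ a → IsBandwidth m b →
      Tendsto (fun n => (m n : 𝕜) * ∫ ω, ∏ i, traceDev s μ a n (m n) (p i) ω ∂μ) atTop
        (𝓝 (c : 𝕜)) := by
  classical
  obtain ⟨c, hc⟩ := exists_tendsto_sum_devMean.{u} (L := Σ i, Fin (2 * p i * s))
    (kd := fun l => letterConj s l.2) (sgn := fun l => letterSign s l.2) (M := ∑ i, p i * s) mom
    (by simp only [Fintype.card_sigma, Fintype.card_fin, Finset.mul_sum, mul_assoc])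
    (fun l => letterSign_eq_ite s l.2) Sigma.fst
    (fun X => ∏ i, limitWeight s b fun l => X ⟨i, l⟩) 𝕜
  refine ⟨c, fun Ω _ μ _ a m ha hm => ?_⟩
  refine (hc Ω μ a m _ ha hm.tendsto_atTop (isScalingWeight_prod_pathWeight hm s _)
    fun n J => Finset.prod_nonneg fun i _ => pathWeight_nonneg s n _).congr fun n => ?_
  rw [integral_prod_traceDev ha, ← mul_div_assoc]
  refine congrArg (fun x => (m n : 𝕜) * x / (m n : 𝕜) ^ ∑ i, p i * s) ?_
  exact (sum_piFinset_closedWords (fun i => 2 * p i * s) (m n) fun J =>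
    ((∏ i, pathWeight s n fun l => J ⟨i, l⟩ : ℝ) : 𝕜) *
      devMean μ a Sigma.fst (fun l => letterConj s l.2) J Finset.univ).symm

end TraceLimits

/-! ### Volume of the set of starting points -/

section StartingPoints

/-- The continuous counterpart of `card_staysInside`. -/
theorem setOf_starting_points {κ : Type*} [Fintype κ] (X : κ → ℝ) :
    {x : ℝ | x ∈ Set.Icc (0 : ℝ) 1 ∧ ∀ j, x + X j ∈ Set.Icc (0 : ℝ) 1} =
      Set.Icc ((Finset.univ.sup fun j => (-X j).toNNReal : ℝ≥0) : ℝ)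
        (1 - (Finset.univ.sup fun j => (X j).toNNReal : ℝ≥0)) := by
  ext x
  simp only [Set.mem_ofPred_eq, Set.mem_Icc]
  constructor
  · rintro ⟨⟨h0, h1⟩, h⟩
    constructor
    · lift x to ℝ≥0 using h0
      rw [NNReal.coe_le_coe]
      refine Finset.sup_le fun j _ => ?_
      rw [Real.toNNReal_le_iff_le_coe]
      linarith [(h j).1]
    · obtain ⟨y, hy⟩ : ∃ y : ℝ≥0, (y : ℝ) = 1 - x := ⟨⟨1 - x, by linarith⟩, rfl⟩
      have : (Finset.univ.sup fun j => (X j).toNNReal) ≤ y := by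
        refine Finset.sup_le fun j _ => ?_
        rw [Real.toNNReal_le_iff_le_coe, hy]
        linarith [(h j).2]
      have := NNReal.coe_le_coe.2 this
      linarith
  · rintro ⟨h0, h1⟩
    have hP : ∀ j, X j ≤ (Finset.univ.sup fun j => (X j).toNNReal : ℝ≥0) := fun j =>
      Real.toNNReal_le_iff_le_coe.1
        (Finset.le_sup (f := fun j => (X j).toNNReal) (Finset.mem_univ j))
    have hQ : ∀ j, -X j ≤ (Finset.univ.sup fun j => (-X j).toNNReal : ℝ≥0) := fun j =>
      Real.toNNReal_le_iff_le_coe.1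
        (Finset.le_sup (f := fun j => (-X j).toNNReal) (Finset.mem_univ j))
    have hP0 := NNReal.coe_nonneg (Finset.univ.sup fun j => (X j).toNNReal)
    have hQ0 := NNReal.coe_nonneg (Finset.univ.sup fun j => (-X j).toNNReal)
    refine ⟨⟨by linarith, by linarith⟩, fun j => ⟨?_, ?_⟩⟩
    · linarith [hQ j]
    · linarith [hP j]

theorem volume_real_starting_points {κ : Type*} [Fintype κ] (X : κ → ℝ) :
    volume.real {x : ℝ | x ∈ Set.Icc (0 : ℝ) 1 ∧ ∀ j, x + X j ∈ Set.Icc (0 : ℝ) 1} =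
      max 0 (1 - spread X) := by
  rw [setOf_starting_points, Real.volume_real_Icc, max_comm, spread, NNReal.coe_add]
  congr 1
  ring

end StartingPoints

/-! ### The limiting moments as integrals over pair partitions -/

section LimitMoment

variable {s N : ℕ} {b : ℝ} {π : Finpartition (Finset.univ : Finset (Fin N))}

/-- Every block contains as many letters of positive sign as letters of negative sign. -/
abbrev IsSignBalanced (s : ℕ) {N : ℕ} (π : Finpartition (Finset.univ : Finset (Fin N))) : Prop :=
  IsBalanced (fun _ => (0 : Fin 1)) (fun l : Fin N => letterSign s l) π

theorem sum_blockCoeff_mul (u : {V // V ∈ π.parts} → ℝ) (l : Fin N) :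
    ∑ V, (blockCoeff π l V : ℝ) * u V = blockValue π u l := by
  have h : ∀ V, (blockCoeff π l V : ℝ) * u V = if blockOf π l = V then u V else 0 := fun V => by
    rw [blockCoeff]
    split_ifs <;> simp
  simp only [h]
  rw [Finset.sum_ite_eq, if_pos (Finset.mem_univ _)]
  rfl

/-- Each letter takes the value of its block, so the constraint on the letters is already implied by
the cube. -/
theorem paramIntegral_blockCoeff (G : (Fin N → ℝ) → ℝ) :
    paramIntegral (blockCoeff π) G =
      ∫ u in Set.univ.pi fun _ : {V // V ∈ π.parts} => Set.Icc (-1 : ℝ) 1, G (blockValue π u) := by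
  refine setIntegral_congr_fun (MeasurableSet.univ_pi fun _ => measurableSet_Icc) fun u hu => ?_
  simp only [sum_blockCoeff_mul]
  rw [if_pos]
  exact fun l => abs_le.2 (hu _ (Set.mem_univ _))

theorem sum_signedValue (u : {V // V ∈ π.parts} → ℝ) :
    ∑ i, signedValue s π u i = ∑ V : {V // V ∈ π.parts},
      (circuitSum (fun _ => (0 : Fin 1)) (fun l : Fin N => letterSign s l) 0 V : ℝ) * u V := by
  have h : ∀ V : {V // V ∈ π.parts},
      (circuitSum (fun _ => (0 : Fin 1)) (fun l : Fin N => letterSign s l) 0 V : ℝ) =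
        ∑ l : Fin N, (-1 : ℝ) ^ ((l : ℕ) / s) * blockCoeff π l V := by
    intro V
    rw [← sum_mul_blockCoeff]
    simp [letterSign, lettersOf]
  simp only [h, Finset.sum_mul, mul_assoc]
  rw [Finset.sum_comm]
  refine Finset.sum_congr rfl fun l _ => ?_
  rw [← Finset.mul_sum, sum_blockCoeff_mul]
  rfl

theorem IsBalanced.sum_signedValue (h : IsSignBalanced s π) (u : {V // V ∈ π.parts} → ℝ) :
    ∑ i, signedValue s π u i = 0 := by
  rw [ToeplitzPowers.sum_signedValue]
  refine Finset.sum_eq_zero fun V _ => ?_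
  rw [h 0 V V.2, Int.cast_zero, zero_mul]

/-- An unbalanced block gives the linear form a nonzero coefficient, and its zero set is a proper
hyperplane. -/
theorem ae_sum_signedValue_ne (h : ¬ IsSignBalanced s π) :
    ∀ᵐ u : {V // V ∈ π.parts} → ℝ, ∑ i, signedValue s π u i ≠ 0 := by
  simp only [ToeplitzPowers.sum_signedValue]
  refine ae_sum_mul_ne (fun h0 => h fun i V hV => ?_) 0
  have := congrFun h0 ⟨V, hV⟩
  rw [Subsingleton.elim i 0]
  exact Int.cast_eq_zero.1 this

theorem measurableSet_momentRegion : MeasurableSet (momentRegion s b π) := by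
  have hc : ∀ i, Continuous fun z : ℝ × ({V // V ∈ π.parts} → ℝ) => signedValue s π z.2 i :=
    fun i => continuous_const.mul ((continuous_apply _).comp continuous_snd)
  refine MeasurableSet.inter (measurableSet_eq_fun
    (continuous_finsetSum _ fun i _ => hc i).measurable measurable_const) ?_
  refine MeasurableSet.congr (MeasurableSet.iInter fun j : Fin N =>
    (Continuous.measurable (f := fun z : ℝ × ({V // V ∈ π.parts} → ℝ) =>
      z.1 + b * ∑ i ∈ Finset.Iic j, signedValue s π z.2 i)
      (continuous_fst.add (continuous_const.mul (continuous_finsetSum _ fun i _ => hc i))))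
        (measurableSet_Icc (a := (0 : ℝ)) (b := 1))) ?_
  ext z
  exact Set.mem_iInter

theorem integral_momentRegion_fst (hb : 0 ≤ b) (u : {V // V ∈ π.parts} → ℝ)
    (h : ∑ i, signedValue s π u i = 0) :
    ∫ x in Set.Icc (0 : ℝ) 1, (momentRegion s b π).indicator (fun _ => (1 : ℝ)) (x, u) =
      limitWeight s b (blockValue π u) := by
  set X : Fin N → ℝ := fun j => b * ∑ i ∈ Finset.Iic j, signedValue s π u i with hX
  have hS : MeasurableSet {x : ℝ | ∀ j, x + X j ∈ Set.Icc (0 : ℝ) 1} := by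
    rw [Set.ofPred_forall]
    exact MeasurableSet.iInter fun j => measurableSet_Icc.preimage (measurable_add_const _)
  have e : ∀ x, (momentRegion s b π).indicator (fun _ => (1 : ℝ)) (x, u) =
      {x : ℝ | ∀ j, x + X j ∈ Set.Icc (0 : ℝ) 1}.indicator (fun _ => (1 : ℝ)) x := by
    intro x
    have : (x, u) ∈ momentRegion s b π ↔ x ∈ {x : ℝ | ∀ j, x + X j ∈ Set.Icc (0 : ℝ) 1} := by
      simp [momentRegion, h, hX]
    by_cases hx : (x, u) ∈ momentRegion s b π
    · rw [Set.indicator_of_mem hx, Set.indicator_of_mem (this.1 hx)]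
    · rw [Set.indicator_of_notMem hx, Set.indicator_of_notMem fun h' => hx (this.2 h')]
  simp only [e]
  rw [setIntegral_indicator hS, setIntegral_const, smul_eq_mul, mul_one]
  have h1 := volume_real_starting_points X
  rw [spread_mul hb] at h1
  exact h1

/-- The integral of a pair partition. -/
theorem integral_momentRegion (hb : 0 ≤ b) [Decidable (IsSignBalanced s π)] :
    ∫ z in Set.Icc (0 : ℝ) 1 ×ˢ Set.univ.pi fun _ : {V // V ∈ π.parts} => Set.Icc (-1 : ℝ) 1,
      (momentRegion s b π).indicator (fun _ => (1 : ℝ)) z =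
      if IsSignBalanced s π then paramIntegral (blockCoeff π) (limitWeight s b) else 0 := by
  have hfin : volume (Set.univ.pi fun _ : {V // V ∈ π.parts} => Set.Icc (-1 : ℝ) 1) < ⊤ :=
    (isCompact_univ_pi fun _ => isCompact_Icc).measure_lt_top
  have : IsFiniteMeasure (volume.restrict
      (Set.univ.pi fun _ : {V // V ∈ π.parts} => Set.Icc (-1 : ℝ) 1)) := ⟨by simpa using hfin⟩
  rw [Measure.volume_eq_prod, ← Measure.prod_restrict, integral_prod_symm _
    ((integrable_const (1 : ℝ)).indicator measurableSet_momentRegion)]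
  -- If the partition is balanced, the closing constraint is void and integrating over the starting
  -- point first gives the path weight. Otherwise the integrand vanishes almost everywhere.
  split_ifs with h
  · rw [paramIntegral_blockCoeff]
    exact integral_congr_ae (Eventually.of_forall fun u =>
      integral_momentRegion_fst hb u (h.sum_signedValue u))
  · refine integral_eq_zero_of_ae ?_
    filter_upwards [ae_restrict_of_ae (ae_sum_signedValue_ne h)] with u hu
    simp [momentRegion, hu]

open scoped Classical in
theorem limitMoment_eq (hb : 0 ≤ b) (s p : ℕ) : limitMoment s b p =
    ∑ π ∈ pairPartitions (2 * p * s),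
      if IsSignBalanced s π then paramIntegral (blockCoeff π) (limitWeight s b) else 0 :=
  Finset.sum_congr rfl fun _ _ => integral_momentRegion hb

end LimitMoment

/-! ### Matchings of the two kinds of letters -/

section Matchings

variable {L : Type} [Fintype L] [DecidableEq L]

/-- Every block consists of one letter of each kind. -/
def IsMatching (kd : L → Bool) (π : Finpartition (Finset.univ : Finset L)) : Prop :=
  ∀ V ∈ π.parts, ∀ c, kindCount kd Finset.univ V c = 1

theorem IsMatching.existsUnique {kd : L → Bool} {π : Finpartition (Finset.univ : Finset L)}
    (h : IsMatching kd π) (l : L) (c : Bool) : ∃! l', π.part l' = π.part l ∧ kd l' = c := by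
  have h1 := h _ (blockOf π l).2 c
  rw [kindCount, Finset.card_eq_one] at h1
  obtain ⟨l', hl'⟩ := h1
  have key : ∀ x, (π.part x = π.part l ∧ kd x = c) ↔ x = l' := by
    intro x
    rw [← Finset.mem_singleton (a := l'), ← hl', Finset.mem_filter, blockOf,
      π.mem_part_iff_part_eq_part (Finset.mem_univ _) (Finset.mem_univ _)]
    simp
  exact ⟨l', (key l').2 rfl, fun y hy => (key y).1 hy⟩

theorem isMatching_iff {kd : L → Bool} {π : Finpartition (Finset.univ : Finset L)} :
    IsMatching kd π ↔ ∀ l c, ∃! l', π.part l' = π.part l ∧ kd l' = c := by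
  refine ⟨fun h l c => h.existsUnique l c, fun h V hV c => ?_⟩
  obtain ⟨l, hl⟩ := π.nonempty_of_mem_parts hV
  obtain ⟨l', h1, h2⟩ := h l c
  rw [kindCount, Finset.card_eq_one]
  refine ⟨l', ?_⟩
  have hV' := π.part_eq_of_mem hV hl
  ext x
  rw [Finset.mem_filter, Finset.mem_singleton, ← hV',
    π.mem_part_iff_part_eq_part (Finset.mem_univ _) (Finset.mem_univ _)]
  constructor
  · rintro ⟨-, h3⟩
    exact h2 x h3
  · rintro rfl
    exact ⟨Finset.mem_univ _, h1⟩

/-- The letter of kind `true` that is matched with `l`. -/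
def matchRep (kd : L → Bool) (e : {l // kd l = true} ≃ {l // kd l = false}) (l : L) :
    {l // kd l = true} :=
  if h : kd l = true then ⟨l, h⟩ else e.symm ⟨l, by simpa using h⟩

theorem matchRep_eq_iff {kd : L → Bool} (e : {l // kd l = true} ≃ {l // kd l = false}) (l : L)
    (x : {l // kd l = true}) : matchRep kd e l = x ↔ l = x ∨ l = e x := by
  unfold matchRep
  split_ifs with h
  · rw [Subtype.ext_iff]
    constructor
    · exact Or.inl
    · rintro (h1 | h1)
      · exact h1
      · have := (e x).2
        rw [← h1, h] at this
        simp at this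
  · rw [Equiv.symm_apply_eq, Subtype.ext_iff]
    constructor
    · exact Or.inr
    · rintro (h1 | h1)
      · exact absurd (h1 ▸ x.2) h
      · exact h1

-- A bijection e corresponds to the partition into the pairs {x, e x}, whose blocks are the fibres
-- of `matchRep`. Conversely, a matching sends each letter of kind `true` to the unique letter of
-- kind `false` in its block.
open scoped Classical in
theorem card_isMatching (kd : L → Bool) :
    (Finset.univ.filter fun π : Finpartition (Finset.univ : Finset L) => IsMatching kd π).card =
      Fintype.card ({l // kd l = true} ≃ {l // kd l = false}) := by
  have hex : ∀ e : {l // kd l = true} ≃ {l // kd l = false},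
      ∃ π : Finpartition (Finset.univ : Finset L),
        ∀ l l', π.part l = π.part l' ↔ matchRep kd e l = matchRep kd e l' := by
    intro e
    -- The representatives are encoded as integers, so that the partition into fibres is obtained as
    -- the kernel of a labeling.
    obtain ⟨π, hπ, -⟩ := existsUnique_isKernel fun l : L =>
      ((Fintype.equivFin {l // kd l = true} (matchRep kd e l) : ℕ) : ℤ)
    refine ⟨π, fun l l' => ?_⟩
    rw [← hπ l l', Nat.cast_inj, Fin.val_inj, Equiv.apply_eq_iff_eq]
  choose P hP using hex
  have huniq : ∀ π ρ : Finpartition (Finset.univ : Finset L),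
      (∀ l l', π.part l = π.part l' ↔ ρ.part l = ρ.part l') → π = ρ := by
    intro π ρ h
    have hJ : IsKernel π fun l => ((Fintype.equivFin _ (ρ.part l) : ℕ) : ℤ) := by
      intro l l'
      rw [Nat.cast_inj, Fin.val_inj, Equiv.apply_eq_iff_eq, h]
    refine (existsUnique_isKernel _).unique hJ fun l l' => ?_
    rw [Nat.cast_inj, Fin.val_inj, Equiv.apply_eq_iff_eq]
  rw [← Finset.card_univ]
  symm
  refine Finset.card_bij (fun e _ => P e) ?_ ?_ ?_
  · intro e _
    refine Finset.mem_filter.2 ⟨Finset.mem_univ _, isMatching_iff.2 fun l c => ?_⟩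
    simp only [hP]
    set x := matchRep kd e l
    simp only [matchRep_eq_iff e _ x]
    cases c
    · refine ⟨e x, ⟨Or.inr rfl, (e x).2⟩, ?_⟩
      rintro y ⟨rfl | rfl, h⟩
      · have := x.2
        rw [h] at this
        simp at this
      · rfl
    · refine ⟨x, ⟨Or.inl rfl, x.2⟩, ?_⟩
      rintro y ⟨rfl | rfl, h⟩
      · rfl
      · have := (e x).2
        rw [h] at this
        simp at this
  · intro e _ e' _ h
    refine Equiv.ext fun x => ?_
    have h1 : (P e).part (e x) = (P e).part x := by
      rw [hP, (matchRep_eq_iff e _ x).2 (Or.inr rfl), (matchRep_eq_iff e _ x).2 (Or.inl rfl)]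
    have h' : P e = P e' := h
    rw [h', hP, (matchRep_eq_iff e' (x : L) x).2 (Or.inl rfl), matchRep_eq_iff] at h1
    rcases h1 with h1 | h1
    · have := (e x).2
      rw [h1, x.2] at this
      simp at this
    · exact Subtype.ext h1
  · intro π hπ
    have hm := (Finset.mem_filter.1 hπ).2
    choose f hf hfu using fun l : L => hm.existsUnique l
    have hft : ∀ l : L, kd l = true → ∀ l', π.part l' = π.part l → kd l' = true → l' = l := by
      intro l hl l' h1 h2
      exact (hfu l true l' ⟨h1, h2⟩).trans (hfu l true l ⟨rfl, hl⟩).symm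
    have hff : ∀ l : L, kd l = false → ∀ l', π.part l' = π.part l → kd l' = false → l' = l := by
      intro l hl l' h1 h2
      exact (hfu l false l' ⟨h1, h2⟩).trans (hfu l false l ⟨rfl, hl⟩).symm
    let e : {l // kd l = true} ≃ {l // kd l = false} :=
      { toFun := fun l => ⟨f l false, (hf l false).2⟩
        invFun := fun l => ⟨f l true, (hf l true).2⟩
        left_inv := fun l => Subtype.ext (hft l l.2 _
          ((hf _ true).1.trans (hf l false).1) (hf _ true).2)
        right_inv := fun l => Subtype.ext (hff l l.2 _
          ((hf _ false).1.trans (hf l true).1) (hf _ false).2) }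
    refine ⟨e, Finset.mem_univ _, huniq _ _ fun l l' => ?_⟩
    have hrep : ∀ l, π.part (matchRep kd e l : L) = π.part l := by
      intro l
      rcases (matchRep_eq_iff e l _).1 rfl with h | h
      · rw [← h]
      · nth_rewrite 2 [h]
        exact (hf _ false).1.symm
    rw [hP]
    constructor
    · intro h
      rw [← hrep l, ← hrep l', h]
    · intro h
      rw [← hrep l, ← hrep l'] at h
      exact Subtype.ext (hft _ (matchRep kd e l').2 _ h (matchRep kd e l).2)

end Matchings

/-! ### The case b = 0 -/

section BandwidthZero

variable {s : ℕ}

theorem sum_letterSign (hs : 1 ≤ s) (p : ℕ) :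
    ∑ l ∈ Finset.range (2 * p * s), letterSign s l = 0 := by
  induction p with
  | zero => simp
  | succ p ih =>
    have e : 2 * (p + 1) * s = 2 * p * s + (s + s) := by ring
    rw [e, Finset.sum_range_add, Finset.sum_range_add, ih, zero_add]
    have h1 : ∀ j ∈ Finset.range s, letterSign s (2 * p * s + j) = 1 := by
      intro j hj
      rw [letterSign, show 2 * p * s + j = s * (2 * p) + j by ring, Nat.mul_add_div (by omega),
        Nat.div_eq_of_lt (Finset.mem_range.1 hj), add_zero, (even_two_mul p).neg_one_pow]
    have h2 : ∀ j ∈ Finset.range s, letterSign s (2 * p * s + (s + j)) = -1 := by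
      intro j hj
      rw [letterSign, show 2 * p * s + (s + j) = s * (2 * p + 1) + j by ring,
        Nat.mul_add_div (by omega), Nat.div_eq_of_lt (Finset.mem_range.1 hj), add_zero,
        (odd_two_mul_add_one p).neg_one_pow]
    rw [Finset.sum_congr rfl h1, Finset.sum_congr rfl h2]
    simp

/-- The signs sum to zero, so both kinds occupy exactly half of the positions. -/
theorem card_letterConj (hs : 1 ≤ s) (p : ℕ) (c : Bool) :
    Fintype.card {l : Fin (2 * p * s) // letterConj s l = c} = p * s := by
  have h1 := sum_letterSign hs p
  rw [← Fin.sum_univ_eq_sum_range (fun l => letterSign s l)] at h1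
  simp only [letterSign_eq_ite, Finset.sum_ite, Finset.sum_const, Bool.not_eq_true] at h1
  have h2 := Finset.card_filter_add_card_filter_not (s := (Finset.univ : Finset (Fin (2 * p * s))))
    (fun l => letterConj s l = true)
  simp only [Bool.not_eq_true, Finset.card_univ, Fintype.card_fin] at h2
  rw [Fintype.card_subtype]
  have h3 : 2 * p * s = 2 * (p * s) := by ring
  simp only [nsmul_eq_mul, mul_one, mul_neg] at h1
  cases c <;> omega

theorem mem_pairPartitions_and_isSignBalanced_iff {N : ℕ}
    {π : Finpartition (Finset.univ : Finset (Fin N))} :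
    (π ∈ pairPartitions N ∧ IsSignBalanced s π) ↔
      IsMatching (fun l : Fin N => letterConj s l) π := by
  have hu : lettersOf (fun _ : Fin N => (0 : Fin 1)) 0 = Finset.univ := by simp [lettersOf]
  have hadd := kindCount_add_kindCount_univ (kd := fun l : Fin N => letterConj s l)
  have hsum : ∀ V, circuitSum (fun _ : Fin N => (0 : Fin 1)) (fun l : Fin N => letterSign s l) 0 V =
      kindCount (fun l : Fin N => letterConj s l) Finset.univ V true -
        kindCount (fun l : Fin N => letterConj s l) Finset.univ V false := by
    intro V
    rw [circuitSum_eq (kd := fun l : Fin N => letterConj s l) fun l => letterSign_eq_ite s l, hu]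
  simp only [pairPartitions, Finset.mem_filter, Finset.mem_univ, true_and, IsSignBalanced,
    IsBalanced, IsMatching, Bool.forall_bool, Fin.forall_fin_one, hsum]
  constructor
  · rintro ⟨h1, h2⟩ V hV
    have := h1 V hV
    have := h2 V hV
    have := hadd V
    omega
  · intro h
    refine ⟨fun V hV => ?_, fun V hV => ?_⟩
    · have := h V hV
      have := hadd V
      omega
    · have := h V hV
      omega

/-- For b = 0 the path weight is identically one, and the integral is the volume of the cube. -/
theorem paramIntegral_limitWeight_zero {N : ℕ} {π : Finpartition (Finset.univ : Finset (Fin N))} :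
    paramIntegral (blockCoeff π) (limitWeight s 0) = 2 ^ π.parts.card := by
  rw [paramIntegral_blockCoeff]
  simp only [limitWeight, zero_mul, sub_zero, zero_le_one, sup_of_le_right]
  rw [setIntegral_const, smul_eq_mul, mul_one, Measure.real, volume_pi_pi]
  simp only [Real.volume_Icc, Finset.prod_const, Finset.card_univ, Fintype.card_coe]
  norm_num

theorem limitMoment_zero (hs : 1 ≤ s) (p : ℕ) :
    limitMoment s 0 p = 2 ^ (p * s) * (Nat.factorial (p * s) : ℝ) := by
  classical
  rw [limitMoment_eq le_rfl]
  simp only [paramIntegral_limitWeight_zero]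
  rw [← Finset.sum_filter]
  have h1 : ∀ π ∈ (pairPartitions (2 * p * s)).filter (IsSignBalanced s),
      (2 : ℝ) ^ π.parts.card = 2 ^ (p * s) := by
    intro π hπ
    have := two_mul_card_parts_of_card_eq_two
      (Finset.mem_filter.1 (Finset.mem_filter.1 hπ).1).2
    rw [Fintype.card_fin] at this
    rw [show π.parts.card = p * s by linarith]
  rw [Finset.sum_congr rfl h1, Finset.sum_const, nsmul_eq_mul, mul_comm]
  congr 2
  have h2 : (pairPartitions (2 * p * s)).filter (IsSignBalanced s) =
      Finset.univ.filter (IsMatching fun l : Fin (2 * p * s) => letterConj s l) := by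
    ext π
    rw [Finset.mem_filter, Finset.mem_filter, mem_pairPartitions_and_isSignBalanced_iff]
    simp
  rw [h2, card_isMatching, Fintype.card_equiv (Fintype.equivOfCardEq
    ((card_letterConj hs p true).trans (card_letterConj hs p false).symm)), card_letterConj hs]

end BandwidthZero

/-! ### Fluctuations of polynomial traces -/

section Fluctuations

variable {𝕜 : Type*} [RCLike 𝕜] {Ω : Type*} [MeasurableSpace Ω] {μ : Measure Ω}
  [IsProbabilityMeasure μ] {mom : ℕ → ℕ → ℝ} {a : ℤ → Ω → 𝕜} {s : ℕ} {b : ℝ} {m : ℕ → ℕ}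

theorem IsEntryFamily.hasMoments_trace (ha : IsEntryFamily mom μ a) (hs : 1 ≤ s) (n M p : ℕ) :
    HasMoments (fun ω => (powerMatrix s n M (fun j => a j ω) ^ p).trace) μ := by
  simp only [trace_powerMatrix_pow hs]
  exact (HasMoments.const _).mul (HasMoments.sum fun y _ =>
    (HasMoments.const _).mul (ha.hasMoments_letterProd Finset.univ))

theorem IsEntryFamily.measurable_trace (ha : IsEntryFamily mom μ a) (hs : 1 ≤ s) (n M p : ℕ) :
    Measurable (fun ω => (powerMatrix s n M (fun j => a j ω) ^ p).trace) := by
  simp only [trace_powerMatrix_pow hs]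
  exact (Finset.measurable_fun_sum _ fun y _ => (Finset.measurable_fun_prod _ fun l _ =>
    (measurable_conjIf _).comp (ha.measurable _)).const_mul _).const_mul _

/-- As the trace is real, taking the real part loses nothing, and the statistic is linear in the
traces of the powers over 𝕜. -/
theorem coe_traceStat (n M : ℕ) (x : ℤ → 𝕜) (Q : ℝ[X]) :
    ((traceStat s n M x Q : ℝ) : 𝕜) = ∑ p ∈ Finset.range (Q.natDegree + 1),
      (Q.coeff p : 𝕜) * (powerMatrix s n M x ^ p).trace := by
  rw [traceStat, RCLike.conj_eq_iff_re.1
    (RCLike.conj_eq_iff_im.2 (im_trace_aeval_powerMatrix s n M x Q)),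
    Polynomial.aeval_eq_sum_range, Matrix.trace_sum]
  exact Finset.sum_congr rfl fun p _ => by
    rw [Matrix.trace_smul, RCLike.real_smul_eq_coe_mul]

theorem traceStat_eq (n M : ℕ) (x : ℤ → 𝕜) (Q : ℝ[X]) :
    traceStat s n M x Q = RCLike.re (∑ p ∈ Finset.range (Q.natDegree + 1),
      (Q.coeff p : 𝕜) * (powerMatrix s n M x ^ p).trace) := by
  rw [← coe_traceStat, RCLike.ofReal_re]

theorem IsEntryFamily.hasMoments_traceStat (ha : IsEntryFamily mom μ a) (hs : 1 ≤ s) (n M : ℕ)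
    (Q : ℝ[X]) : HasMoments (fun ω => traceStat s n M (fun j => a j ω) Q) μ := by
  simp only [traceStat_eq]
  exact fun k => (HasMoments.sum (fun p _ =>
    (HasMoments.const _).mul (ha.hasMoments_trace hs n M p)) k).re

theorem IsEntryFamily.measurable_traceStat (ha : IsEntryFamily mom μ a) (hs : 1 ≤ s) (n M : ℕ)
    (Q : ℝ[X]) : Measurable (fun ω => traceStat s n M (fun j => a j ω) Q) := by
  simp only [traceStat_eq]
  exact RCLike.measurable_re.comp (Finset.measurable_fun_sum _ fun p _ =>
    (ha.measurable_trace hs n M p).const_mul _)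

theorem IsEntryFamily.hasMoments_fluctuation (ha : IsEntryFamily mom μ a) (hs : 1 ≤ s) (n : ℕ)
    (Q : ℝ[X]) : HasMoments (fluctuation μ s m a Q n) μ :=
  (HasMoments.const _).mul ((ha.hasMoments_traceStat hs n (m n) Q).sub (HasMoments.const _))

theorem IsEntryFamily.measurable_fluctuation (ha : IsEntryFamily mom μ a) (hs : 1 ≤ s) (n : ℕ)
    (Q : ℝ[X]) : Measurable (fluctuation μ s m a Q n) :=
  ((ha.measurable_traceStat hs n (m n) Q).sub_const _).const_mul _

theorem IsEntryFamily.integral_fluctuation (ha : IsEntryFamily mom μ a) (hs : 1 ≤ s) (n : ℕ)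
    (Q : ℝ[X]) : ∫ ω, fluctuation μ s m a Q n ω ∂μ = 0 := by
  unfold fluctuation
  rw [integral_const_mul, integral_sub (ha.hasMoments_traceStat hs n (m n) Q).integrable
    (integrable_const _)]
  simp

theorem IsEntryFamily.coe_fluctuation (ha : IsEntryFamily mom μ a) (hs : 1 ≤ s) (n : ℕ)
    (Q : ℝ[X]) (ω : Ω) : ((fluctuation μ s m a Q n ω : ℝ) : 𝕜) =
      ∑ p ∈ Finset.range (Q.natDegree + 1),
        (Q.coeff p : 𝕜) * ((√(m n) : ℝ) : 𝕜) * traceDev s μ a n (m n) p ω := by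
  have h1 : ((∫ ω, traceStat s n (m n) (fun j => a j ω) Q ∂μ : ℝ) : 𝕜) =
      ∑ p ∈ Finset.range (Q.natDegree + 1),
        (Q.coeff p : 𝕜) * ∫ ω, (powerMatrix s n (m n) (fun j => a j ω) ^ p).trace ∂μ := by
    rw [← integral_ofReal]
    simp only [coe_traceStat]
    rw [integral_finsetSum _ fun p _ =>
      ((HasMoments.const _).mul (ha.hasMoments_trace hs n (m n) p)).integrable]
    simp only [integral_const_mul]
  simp only [ha.traceDev_eq hs, integral_const_mul]
  rw [fluctuation, RCLike.ofReal_mul, RCLike.ofReal_sub, RCLike.ofReal_div, RCLike.ofReal_natCast,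
    h1, coe_traceStat, ← Finset.sum_sub_distrib, Finset.mul_sum]
  refine Finset.sum_congr rfl fun p _ => ?_
  ring

/-- The Wick recursion for the fluctuations. -/
theorem IsEntryFamily.tendsto_fluctuation_recursion (ha : IsEntryFamily mom μ a) (hs : 1 ≤ s)
    (hm : Tendsto m atTop atTop) (Q : ℝ[X]) (k : ℕ) :
    Tendsto (fun n => ∫ ω, fluctuation μ s m a Q n ω ^ (k + 2) ∂μ -
      (k + 1) * (∫ ω, fluctuation μ s m a Q n ω ^ 2 ∂μ) * ∫ ω, fluctuation μ s m a Q n ω ^ k ∂μ)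
      atTop (𝓝 0) := by
  have h := ha.tendsto_wick (N := fun p => 2 * p * s) (fun p => by simp [mul_assoc])
    (fun p l => letterConj s l) (fun p l => letterSign s l) (fun p l => odd_letterSign s l) hm
    (Q.natDegree + 1) (fun n p => closedWords (letterSign s) (2 * p * s) (m n))
    (fun n p y hy => mem_closedWords.1 hy)
    (fun n p y => (Q.coeff p : 𝕜) * ((√(m n) : ℝ) : 𝕜) *
      (((m n : 𝕜) ^ (p * s))⁻¹ * (pathWeight s n y : 𝕜)))
    -- This constant dominates every single coefficient. The other factors fit the required bound
    -- because √m^(2ps) = m^(ps) and path weights are at most one.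
    (∑ p ∈ Finset.range (Q.natDegree + 1), |Q.coeff p|) (by
      intro n p y hp
      have hpow : √(m n : ℝ) ^ (2 * p * s) = (m n : ℝ) ^ (p * s) := by
        rw [mul_assoc, pow_mul, Real.sq_sqrt (Nat.cast_nonneg _)]
      rw [norm_mul, norm_mul, norm_mul, RCLike.norm_ofReal, RCLike.norm_ofReal,
        RCLike.norm_ofReal, norm_inv, norm_pow, RCLike.norm_natCast, abs_of_nonneg
        (Real.sqrt_nonneg _), abs_of_nonneg (pathWeight_nonneg s n y), hpow, div_eq_mul_inv]
      refine mul_le_mul (mul_le_mul_of_nonneg_right ?_ (Real.sqrt_nonneg _))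
        (mul_le_of_le_one_right (by positivity) (pathWeight_le_one s n y))
        (mul_nonneg (by positivity) (pathWeight_nonneg s n y)) (by positivity)
      exact Finset.single_le_sum (f := fun p => |Q.coeff p|) (fun _ _ => abs_nonneg _) hp) k
  have e : ∀ n, (fun ω => ∑ p ∈ Finset.range (Q.natDegree + 1),
      ∑ y ∈ closedWords (letterSign s) (2 * p * s) (m n), (Q.coeff p : 𝕜) * ((√(m n) : ℝ) : 𝕜) *
        (((m n : 𝕜) ^ (p * s))⁻¹ * (pathWeight s n y : 𝕜)) *
        wordDev μ a (fun l : Fin (2 * p * s) => letterConj s l) y ω) =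
      fun ω => ((fluctuation μ s m a Q n ω : ℝ) : 𝕜) := by
    intro n
    funext ω
    rw [ha.coe_fluctuation hs]
    refine Finset.sum_congr rfl fun p _ => ?_
    rw [traceDev, Finset.mul_sum, Finset.mul_sum]
    exact Finset.sum_congr rfl fun y _ => by ring
  have h1 : Tendsto (fun n => wickBracket μ (0 : Fin (k + 2))
      (fun _ ω => ((fluctuation μ s m a Q n ω : ℝ) : 𝕜))) atTop (𝓝 0) :=
    h.congr fun n => congrArg (wickBracket μ 0) (funext fun _ => e n)
  simp only [wickBracket_const, ← RCLike.ofReal_pow, integral_ofReal] at h1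
  have h2 := (RCLike.continuous_re (K := 𝕜)).continuousAt.tendsto.comp h1
  rw [map_zero] at h2
  refine h2.congr fun n => ?_
  rw [Function.comp_apply, ← RCLike.ofReal_natCast (K := 𝕜) k, ← RCLike.ofReal_one (K := 𝕜),
    ← RCLike.ofReal_add, ← RCLike.ofReal_mul, ← RCLike.ofReal_mul, ← RCLike.ofReal_sub,
    RCLike.ofReal_re]

theorem IsEntryFamily.integral_fluctuation_sq (ha : IsEntryFamily mom μ a) (hs : 1 ≤ s) (n : ℕ)
    (Q : ℝ[X]) : ((∫ ω, fluctuation μ s m a Q n ω ^ 2 ∂μ : ℝ) : 𝕜) =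
      ∑ p ∈ Finset.range (Q.natDegree + 1), ∑ q ∈ Finset.range (Q.natDegree + 1),
        ((Q.coeff p * Q.coeff q : ℝ) : 𝕜) *
          ((m n : 𝕜) * ∫ ω, ∏ i, traceDev s μ a n (m n) (![p, q] i) ω ∂μ) := by
  have hm2 : ((√(m n) : ℝ) : 𝕜) * ((√(m n) : ℝ) : 𝕜) = (m n : 𝕜) := by
    rw [← RCLike.ofReal_mul, Real.mul_self_sqrt (Nat.cast_nonneg _), RCLike.ofReal_natCast]
  rw [← integral_ofReal]
  simp only [RCLike.ofReal_pow, ha.coe_fluctuation hs]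
  simp only [sq, Finset.sum_mul_sum]
  have hint : ∀ p q, Integrable (fun ω =>
      (Q.coeff p : 𝕜) * ((√(m n) : ℝ) : 𝕜) * traceDev s μ a n (m n) p ω *
        ((Q.coeff q : 𝕜) * ((√(m n) : ℝ) : 𝕜) * traceDev s μ a n (m n) q ω)) μ := fun p q =>
    (((HasMoments.const _).mul (ha.hasMoments_traceDev n (m n) p)).mul
      ((HasMoments.const _).mul (ha.hasMoments_traceDev n (m n) q))).integrable
  rw [integral_finsetSum _ fun p _ => integrable_finsetSum _ fun q _ => hint p q]
  refine Finset.sum_congr rfl fun p _ => ?_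
  rw [integral_finsetSum _ fun q _ => hint p q]
  refine Finset.sum_congr rfl fun q _ => ?_
  rw [← hm2, ← integral_const_mul, ← integral_const_mul]
  refine integral_congr_ae (Eventually.of_forall fun ω => ?_)
  simp only [Fin.prod_univ_two, Matrix.cons_val_zero, Matrix.cons_val_one]
  push_cast
  ring

end Fluctuations

/-! ### The limit theorem for prescribed mixed moments -/

section LimitTheorem

/-- The limit theorem for entries with given mixed moments. -/
theorem exists_limit_variance (mom : ℕ → ℕ → ℝ) {s : ℕ} (hs : 1 ≤ s) (b : ℝ) (hb : 0 ≤ b)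
    (𝕜 : Type*) [RCLike 𝕜] :
    ∃ v : ℝ[X] → ℝ≥0, ∀ (Ω : Type u) [MeasurableSpace Ω] (μ : Measure Ω) [IsProbabilityMeasure μ]
      (m : ℕ → ℕ) (a : ℤ → Ω → 𝕜), IsBandwidth m b → IsEntryFamily mom μ a →
      (∀ (Q : ℝ[X]) (n : ℕ),
        Integrable (fun ω => traceStat s n (m n) (fun j => a j ω) Q) μ) ∧
      (∀ Q : ℝ[X],
        TendstoInDistribution (fluctuation μ s m a Q) atTop (id : ℝ → ℝ)
          (fun _ => μ) (gaussianReal 0 (v Q)) ∧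
        Tendsto (fun n => Var[fluctuation μ s m a Q n; μ]) atTop (𝓝 (v Q : ℝ))) ∧
      (∀ p : ℕ, Tendsto (fun n : ℕ => ∫ ω, (1 / (n : 𝕜)) *
          (powerMatrix s n (m n) (fun j => a j ω) ^ p).trace ∂μ)
        atTop (𝓝 ((limitMoment s b p : ℝ) : 𝕜))) := by
  choose c hc using fun p q => exists_tendsto_integral_traceDev.{u} mom s b ![p, q] 𝕜
  -- The variance is a quadratic form in the coefficients of Q. Its nonnegativity follows only once
  -- a model is given, as a limit of second moments (`hv0`), hence `toNNReal` in the definition.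
  refine ⟨fun Q => (∑ p ∈ Finset.range (Q.natDegree + 1), ∑ q ∈ Finset.range (Q.natDegree + 1),
    Q.coeff p * Q.coeff q * c p q).toNNReal, fun Ω _ μ _ m a hm ha => ⟨fun Q n =>
      (ha.hasMoments_traceStat hs n (m n) Q).integrable, fun Q => ?_, fun p => ?_⟩⟩
  · have hlim : Tendsto (fun n => ∫ ω, fluctuation μ s m a Q n ω ^ 2 ∂μ) atTop
        (𝓝 (∑ p ∈ Finset.range (Q.natDegree + 1), ∑ q ∈ Finset.range (Q.natDegree + 1),
          Q.coeff p * Q.coeff q * c p q)) := by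
      have h1 := tendsto_finsetSum (M := 𝕜) (Finset.range (Q.natDegree + 1)) fun p _ =>
        tendsto_finsetSum (M := 𝕜) (Finset.range (Q.natDegree + 1)) fun q _ =>
          (hc p q Ω μ a m ha hm).const_mul ((Q.coeff p * Q.coeff q : ℝ) : 𝕜)
      simp only [← ha.integral_fluctuation_sq hs, ← RCLike.ofReal_mul, ← RCLike.ofReal_sum] at h1
      have h2 := (RCLike.continuous_re (K := 𝕜)).continuousAt.tendsto.comp h1
      simpa only [Function.comp_def, RCLike.ofReal_re] using h2
    have hv0 := ge_of_tendsto' hlim fun n => integral_nonneg fun ω => sq_nonneg _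
    rw [← Real.coe_toNNReal _ hv0] at hlim
    refine ⟨tendstoInDistribution_gaussian_of_moments (fun n => ha.measurable_fluctuation hs n Q)
      (fun n k => ?_) _ (fun n => ha.integral_fluctuation hs n Q) hlim
      fun k => ha.tendsto_fluctuation_recursion hs hm.tendsto_atTop Q k, ?_⟩
    · have h := HasMoments.prod (s := Finset.range k) fun _ _ =>
        ha.hasMoments_fluctuation (m := m) hs n Q
      simpa only [Finset.prod_const, Finset.card_range] using h.integrable
    · refine hlim.congr fun n => ?_
      rw [variance_of_integral_eq_zero (ha.measurable_fluctuation hs n Q).aemeasurable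
        (ha.integral_fluctuation hs n Q)]
  · classical
    rw [limitMoment_eq hb]
    exact ha.tendsto_integral_trace hs hm p

end LimitTheorem

/-! ### Real and complex entries as entry families -/

section Entries

variable {Ω : Type*} [MeasurableSpace Ω] {μ : Measure Ω} [IsProbabilityMeasure μ]

theorem hasMoments_of_lintegral {𝕜 : Type*} [RCLike 𝕜] {f : Ω → 𝕜} (hf : Measurable f)
    (h : ∀ k : ℕ, ∫⁻ ω, ‖f ω‖ₑ ^ k ∂μ < ⊤) : HasMoments f μ := by
  intro k
  refine ⟨hf.aestronglyMeasurable, ?_⟩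
  rcases Nat.eq_zero_or_pos k with rfl | hk
  · simp
  · rw [eLpNorm_lt_top_iff_lintegral_rpow_enorm_lt_top (by exact_mod_cast hk.ne')
      (ENNReal.natCast_ne_top k)]
    simpa using h k

theorem exists_moment_bound {𝕜 : Type*} [RCLike 𝕜] {a : ℤ → Ω → 𝕜} (ha : ∀ j, Measurable (a j))
    (k : ℕ) (h : ⨆ j, ∫⁻ ω, ‖a j ω‖ₑ ^ k ∂μ < ⊤) : ∃ C : ℝ, ∀ j, ∫ ω, ‖a j ω‖ ^ k ∂μ ≤ C := by
  refine ⟨(⨆ j, ∫⁻ ω, ‖a j ω‖ₑ ^ k ∂μ).toReal, fun j => ?_⟩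
  have h1 := integral_norm_eq_lintegral_enorm (f := fun ω => a j ω ^ k) (μ := μ)
    ((ha j).pow_const k).aestronglyMeasurable
  simp only [norm_pow, enorm_pow] at h1
  rw [h1]
  exact ENNReal.toReal_mono h.ne (le_iSup (fun j => ∫⁻ ω, ‖a j ω‖ₑ ^ k ∂μ) j)

/-- The mixed moments in the real case. -/
def realMoment (κ : ℝ) (p q : ℕ) : ℝ :=
  if p + q = 0 ∨ p + q = 2 then 1 else if p + q = 4 then κ else 0

/-- The mixed moments in the complex case. -/
def complexMoment (κ : ℝ) (p q : ℕ) : ℝ :=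
  if p ≠ q then 0 else if p ≤ 1 then 1 else κ

theorem IsRealEntries.isEntryFamily {κ : ℝ} {a : ℤ → Ω → ℝ} (ha : IsRealEntries μ κ a) :
    IsEntryFamily (realMoment κ) μ a where
  measurable := ha.measurable
  indep := ha.indep
  mean := ha.mean
  moment j p q h := by
    simp only [star_trivial, ← pow_add]
    change _ = realMoment κ p q
    unfold realMoment
    obtain h0 | h1 | h2 | h4 : p + q = 0 ∨ p + q = 1 ∨ p + q = 2 ∨ p + q = 4 := by omega
    · simp [h0]
    · simp [h1, ha.mean]
    · rw [h2]
      simpa using ha.variance j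
    · rw [h4]
      simpa [Even.pow_abs (show Even 4 by decide)] using ha.fourth j
  mom_one := by simp [realMoment]
  hasMoments j := hasMoments_of_lintegral (ha.measurable j) fun k =>
    (le_iSup (fun j => ∫⁻ ω, ‖a j ω‖ₑ ^ k ∂μ) j).trans_lt (ha.bounded k)
  bounded k := exists_moment_bound ha.measurable k (ha.bounded k)

/-- Functions of disjoint groups of independent random variables are independent. -/
theorem iIndepFun_of_comap_le {ι κ β : Type*} [MeasurableSpace β] {m : ι × κ → MeasurableSpace Ω}
    (hle : ∀ p, m p ≤ ‹MeasurableSpace Ω›) (hm : iIndep m μ) {f : ι → Ω → β}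
    (hf : ∀ i, MeasurableSpace.comap (f i) inferInstance ≤ ⨆ p ∈ {p : ι × κ | p.1 = i}, m p) :
    iIndepFun f μ := by
  classical
  rw [iIndepFun_iff_iIndep, iIndep_iff]
  intro s g
  induction s using Finset.induction_on with
  | empty => simp
  | insert i s hi ih =>
    intro hg
    rw [Finset.set_biInter_insert, Finset.prod_insert hi,
      ← ih fun j hj => hg j (Finset.mem_insert_of_mem hj)]
    have hd : Disjoint {p : ι × κ | p.1 = i} {p | p.1 ∈ s} := by
      rw [Set.disjoint_left]
      rintro p hp hp'
      have hp1 : p.1 = i := hp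
      have hp2 : p.1 ∈ s := hp'
      exact hi (hp1 ▸ hp2)
    refine (Indep_iff _ _ _).1 (indep_iSup_of_disjoint hle hm hd) _ _
      (hf i _ (hg i (Finset.mem_insert_self i s))) ?_
    refine @Finset.measurableSet_biInter _ _ (⨆ p ∈ {p : ι × κ | p.1 ∈ s}, m p) g s fun j hj => ?_
    refine (iSup₂_le fun p hp => ?_ : (⨆ p ∈ {p : ι × κ | p.1 = j}, m p) ≤ _) _
      (hf j _ (hg j (Finset.mem_insert_of_mem hj)))
    have hp' : p ∈ {p : ι × κ | p.1 ∈ s} := by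
      have : p.1 = j := hp
      change p.1 ∈ s
      rwa [this]
    exact le_iSup₂ (f := fun (p : ι × κ) (_ : p ∈ {p : ι × κ | p.1 ∈ s}) => m p) p hp'

/-- Each entry is measurable with respect to its own real and imaginary parts, so independence of
all these parts is inherited by the groups indexed by j. -/
theorem IsComplexEntries.iIndepFun {κ : ℝ} {a : ℤ → Ω → ℂ} (ha : IsComplexEntries μ κ a) :
    iIndepFun a μ := by
  have hind := (iIndepFun_iff_iIndep _ _ _).1 ha.indep
  refine iIndepFun_of_comap_le (fun p => ?_) hind fun j => ?_
  · refine Measurable.comap_le ?_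
    rcases p with ⟨j, c⟩
    cases c
    · simpa [Function.comp_def] using Complex.measurable_im.comp (ha.measurable j)
    · simpa [Function.comp_def] using Complex.measurable_re.comp (ha.measurable j)
  · set S := ⨆ p ∈ {p : ℤ × Bool | p.1 = j}, MeasurableSpace.comap
      (fun ω => if p.2 = true then (a p.1 ω).re else (a p.1 ω).im) inferInstance with hS
    have hc : ∀ c : Bool, Measurable[S] fun ω => if c = true then (a j ω).re else (a j ω).im := by
      intro c
      refine (comap_measurable _).mono (le_iSup₂ (f := fun (p : ℤ × Bool)
        (_ : p ∈ {p : ℤ × Bool | p.1 = j}) => MeasurableSpace.comap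
        (fun ω => if p.2 = true then (a p.1 ω).re else (a p.1 ω).im) inferInstance) (j, c) rfl)
        le_rfl
    have h1 : Measurable[S] fun ω => (a j ω).re := by simpa using hc true
    have h2 : Measurable[S] fun ω => (a j ω).im := by simpa using hc false
    exact Measurable.comap_le (measurable_of_re_im (𝕜 := ℂ) h1 h2)

/-- The unequal mixed moments vanish through the mean, the square and their conjugates; the equal
ones are moments of the modulus because star z * z = |z|^2. -/
theorem IsComplexEntries.isEntryFamily {κ : ℝ} {a : ℤ → Ω → ℂ} (ha : IsComplexEntries μ κ a) :
    IsEntryFamily (complexMoment κ) μ a where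
  measurable := ha.measurable
  indep := ha.iIndepFun
  mean := ha.mean
  moment j p q h := by
    have hsq : ∀ z : ℂ, star z * z = ((‖z‖ ^ 2 : ℝ) : ℂ) := fun z => by
      rw [Complex.ofReal_pow]
      exact RCLike.conj_mul z
    change _ = ((complexMoment κ p q : ℝ) : ℂ)
    unfold complexMoment
    have hcases : (p = 0 ∧ q = 0) ∨ (p = 1 ∧ q = 0) ∨ (p = 0 ∧ q = 1) ∨ (p = 2 ∧ q = 0) ∨
      (p = 1 ∧ q = 1) ∨ (p = 0 ∧ q = 2) ∨ (p = 2 ∧ q = 2) := by omega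
    rcases hcases with ⟨rfl, rfl⟩ | ⟨rfl, rfl⟩ | ⟨rfl, rfl⟩ | ⟨rfl, rfl⟩ | ⟨rfl, rfl⟩ | ⟨rfl, rfl⟩ |
      ⟨rfl, rfl⟩
    · simp
    · have h1 : ∫ ω, star (a j ω) ∂μ = star (∫ ω, a j ω ∂μ) := integral_conj
      simp only [pow_one, pow_zero, mul_one]
      rw [h1, ha.mean]
      simp
    · simp [ha.mean]
    · have h1 : ∫ ω, star (a j ω ^ 2) ∂μ = star (∫ ω, a j ω ^ 2 ∂μ) := integral_conj
      simp only [star_pow] at h1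
      simp only [pow_zero, mul_one]
      rw [h1, ha.square]
      simp
    · simp only [pow_one, hsq]
      rw [integral_complex_ofReal, ha.variance]
      simp
    · simp [ha.square]
    · simp only [← mul_pow, hsq, ← Complex.ofReal_pow, ← pow_mul]
      rw [integral_complex_ofReal, ha.fourth]
      simp
  mom_one := by simp [complexMoment]
  hasMoments j := hasMoments_of_lintegral (ha.measurable j) fun k =>
    (le_iSup (fun j => ∫⁻ ω, ‖a j ω‖ₑ ^ k ∂μ) j).trans_lt (ha.bounded k)
  bounded k := exists_moment_bound ha.measurable k (ha.bounded k)

end Entries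

end ToeplitzPowers

theorem mainTheorem9 (s : ℕ) (hs : 1 ≤ s) (b κ : ℝ) (hb : b ∈ Set.Icc (0 : ℝ) 1) :
    (∃ v : ℝ[X] → ℝ≥0,
      ∀ (Ω : Type u) [MeasurableSpace Ω] (μ : Measure Ω) [IsProbabilityMeasure μ]
        (bw : ℕ → ℕ) (a : ℤ → Ω → ℝ),
        ToeplitzPowers.IsBandwidth bw b → ToeplitzPowers.IsRealEntries μ κ a →
        (∀ (Q : ℝ[X]) (n : ℕ), Integrable
          (fun ω => ToeplitzPowers.traceStat s n (bw n) (fun j => a j ω) Q) μ) ∧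
        (∀ Q : ℝ[X], 1 ≤ Q.natDegree →
          TendstoInDistribution (ToeplitzPowers.fluctuation μ s bw a Q) atTop (id : ℝ → ℝ)
            (fun _ => μ) (gaussianReal 0 (v Q)) ∧
          Tendsto (fun n => Var[ToeplitzPowers.fluctuation μ s bw a Q n; μ]) atTop
            (𝓝 (v Q : ℝ))) ∧
        (∀ p : ℕ, Tendsto
          (fun n : ℕ => ∫ ω, (1 / (n : ℝ)) *
            ((ToeplitzPowers.powerMatrix s n (bw n) (fun j => a j ω)) ^ p).trace ∂μ)
          atTop (𝓝 (ToeplitzPowers.limitMoment s b p)))) ∧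
    (∃ v : ℝ[X] → ℝ≥0,
      ∀ (Ω : Type u) [MeasurableSpace Ω] (μ : Measure Ω) [IsProbabilityMeasure μ]
        (bw : ℕ → ℕ) (a : ℤ → Ω → ℂ),
        ToeplitzPowers.IsBandwidth bw b → ToeplitzPowers.IsComplexEntries μ κ a →
        (∀ (Q : ℝ[X]) (n : ℕ), Integrable
          (fun ω => ToeplitzPowers.traceStat s n (bw n) (fun j => a j ω) Q) μ) ∧
        (∀ Q : ℝ[X], 1 ≤ Q.natDegree →
          TendstoInDistribution (ToeplitzPowers.fluctuation μ s bw a Q) atTop (id : ℝ → ℝ)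
            (fun _ => μ) (gaussianReal 0 (v Q)) ∧
          Tendsto (fun n => Var[ToeplitzPowers.fluctuation μ s bw a Q n; μ]) atTop
            (𝓝 (v Q : ℝ))) ∧
        (∀ p : ℕ, Tendsto
          (fun n : ℕ => ∫ ω, (1 / (n : ℂ)) *
            ((ToeplitzPowers.powerMatrix s n (bw n) (fun j => a j ω)) ^ p).trace ∂μ)
          atTop (𝓝 (ToeplitzPowers.limitMoment s b p : ℂ)))) ∧
    (∀ p : ℕ, ToeplitzPowers.limitMoment s 0 p = 2 ^ (p * s) * (Nat.factorial (p * s) : ℝ)) := by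
  refine ⟨?_, ?_, fun p => ToeplitzPowers.limitMoment_zero hs p⟩
  · obtain ⟨v, hv⟩ := ToeplitzPowers.exists_limit_variance.{u}
      (ToeplitzPowers.realMoment κ) hs b hb.1 ℝ
    refine ⟨v, fun Ω _ μ _ bw a hbw ha => ?_⟩
    obtain ⟨h1, h2, h3⟩ := hv Ω μ bw a hbw ha.isEntryFamily
    exact ⟨h1, fun Q _ => h2 Q, h3⟩
  · obtain ⟨v, hv⟩ := ToeplitzPowers.exists_limit_variance.{u}
      (ToeplitzPowers.complexMoment κ) hs b hb.1 ℂ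
    refine ⟨v, fun Ω _ μ _ bw a hbw ha => ?_⟩
    obtain ⟨h1, h2, h3⟩ := hv Ω μ bw a hbw ha.isEntryFamily
    exact ⟨h1, fun Q _ => h2 Q, h3⟩
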